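/- Let $\Omega\subset\mathbb R^d$ be a bounded open set, $Y=[0,1)^d$, $T>0$, $H=L^2(\Omega)$, $V=H^1_0(\Omega)$, $V'=H^{-1}(\Omega)$. For $k=1,2$ let $\mathcal C_{kk}(x,y)$, $\kappa_k(x,y)$ and $Q(x,y)$ be continuous on $\overline\Omega\times\mathbb R^d$ and $Y$-periodic in $y$, with $\mathcal C_{kk}\ge \underline C>0$, $\kappa_k\ge\underline\kappa>0$ and $\int_Y Q(x,y)\,dy=0$ for all $x\in\overline\Omega$. For $x\in\Omega$ let $N_k^i(x,\cdot)$ ($i=1,\dots,d$) and $M_k(x,\cdot)$ in $H^1_\#(Y)$ be weak solutions of the periodic cell problems $$\operatorname{div}_y\big(\kappa_k(e^i+\nabla_yN_k^i)\big)=0,\qquad \operatorname{div}_y(\kappa_k\nabla_yM_k)+Q=0 ,$$ and put $\overline{\mathcal C}_k(x)=\int_Y\mathcal C_{kk}\,dy$ and $\kappa^*_{k,ij}(x)=\int_Y\kappa_k\big(\delta_{ij}+\partial_{y_i}N_k^j\big)\,dy$. Let $q\in L^2((0,T)\times\Omega)$ and $g_1,g_2\in H$. Write $k'=3-k$ for the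 index of the other continuum. A weak solution of the homogenized dual-continuum system is a pair $(u_1,u_2)$ with, for $k=1,2$: $u_k\in L^2(0,T;V)$; $\overline{\mathcal C}_k\,\partial_t u_k=\partial_t(\overline{\mathcal C}_k u_k)\in L^2(0,T;V')$; $u_k\in C([0,T];H)$ (after modification on a null set of times) with $u_k(0)=g_k$; and, for all $\phi\in L^2(0,T;V)$, $$\int_0^T\langle\overline{\mathcal C}_k\,\partial_tu_k,\phi\rangle\,dt+\int_0^T\!\!\int_\Omega\kappa_k^*\nabla u_k\cdot\nabla\phi\,dx\,dt+\int_0^T\!\!\int_\Omega\Big(\int_Y\kappa_k\nabla_yM_k\,dy\Big)\cdot\nabla\phi\,(u_{k'}-u_k)\,dx\,dt$$ $$+\int_0^T\!\!\int_\Omega\sum_{i=1}^d\Big[\Big(\int_YQN_k^i\,dy\Big)\partial_{x_i}u_k-\Big(\int_YQN_{k'}^i\,dy\Big)\partial_{x_i}u_{k'}\Big]\phi\,dx\,dt-\int_0^T\!\!\int_\Omega\Big(\int_YQ(M_1+M_2)\,dy\Big)(u_k-u_{k'})\phi\,dx\,dt=\int_0^T\!\!\int_\Omega q\,\phi\,dx\,dt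 .$$ Theorem. The homogenized system has exactly one weak solution. Moreover, for each $k$ such that $\overline{\mathcal C}_k$ is Lipschitz on $\Omega$, the solution satisfies $\partial_tu_k\in L^2(0,T;V')$. -/

import Mathlib

open MeasureTheory Set Filter Topology
open scoped ContDiff ENNReal NNReal

namespace DualContinuum

/-- Euclidean space `ℝ^d`. -/
abbrev E (d : ℕ) : Type := EuclideanSpace ℝ (Fin d)

/-! ### Periodic functions and the cell problems -/

/-- The unit cube `Y = [0,1)^d`. -/
def unitCube (d : ℕ) : Set (E d) := {y | ∀ i, y i ∈ Ico (0 : ℝ) 1}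

/-- `f` is `Y`-periodic: it has period one in every coordinate direction. -/
def IsPeriodic {d : ℕ} {F : Type*} (f : E d → F) : Prop :=
  ∀ (i : Fin d) (y : E d), f (y + EuclideanSpace.single i 1) = f y

/-- An element of `H^1_#(Y)`: a periodic function on `ℝ^d`, square integrable over `Y`, together
with its weak gradient (in the sense of distributions on `ℝ^d`), which is periodic and square
integrable over `Y`. -/
structure PeriodicH1 (d : ℕ) where
  /-- the function -/
  fn : E d → ℝ
  /-- its weak gradient -/
  grad : E d → E d
  periodic_fn : IsPeriodic fn
  periodic_grad : IsPeriodic grad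
  memLp_fn : MemLp fn 2 (volume.restrict (unitCube d))
  memLp_grad : MemLp grad 2 (volume.restrict (unitCube d))
  weak_grad : ∀ φ : E d → ℝ, ContDiff ℝ ∞ φ → HasCompactSupport φ → ∀ i : Fin d,
    ∫ y, fn y * fderiv ℝ φ y (EuclideanSpace.single i 1) = - ∫ y, grad y i * φ y

/-- `w ∈ H^1_#(Y)` is a weak solution of `div_y (k (e^i + ∇_y w)) = 0`. -/
def SolvesGradientCell {d : ℕ} (k : E d → ℝ) (i : Fin d) (w : PeriodicH1 d) : Prop :=
  ∀ ψ : PeriodicH1 d,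
    ∫ y in unitCube d, k y * inner ℝ (EuclideanSpace.single i 1 + w.grad y) (ψ.grad y) = 0

/-- `w ∈ H^1_#(Y)` is a weak solution of `div_y (k ∇_y w) + r = 0`. -/
def SolvesExchangeCell {d : ℕ} (k r : E d → ℝ) (w : PeriodicH1 d) : Prop :=
  ∀ ψ : PeriodicH1 d,
    ∫ y in unitCube d, k y * inner ℝ (w.grad y) (ψ.grad y) = ∫ y in unitCube d, r y * ψ.fn y

/-! ### Homogenized coefficients

The first argument of `κ`, `C`, `N`, `M` is the index of the continuum. -/

/-- `∫_Y C_kk(x,y) dy`. -/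
noncomputable def homCapacity {d : ℕ} (C : Fin 2 → E d → E d → ℝ) (k : Fin 2) (x : E d) : ℝ :=
  ∫ y in unitCube d, C k x y

/-- `κ*_{k,ij}(x) = ∫_Y κ_k (δ_ij + ∂N_k^j/∂y_i) dy`. -/
noncomputable def homDiffusion {d : ℕ} (κ : Fin 2 → E d → E d → ℝ)
    (N : Fin 2 → Fin d → E d → PeriodicH1 d) (k : Fin 2) (i j : Fin d) (x : E d) : ℝ :=
  ∫ y in unitCube d, κ k x y * ((if i = j then 1 else 0) + (N k j x).grad y i)

/-- The `i`-th component of `∫_Y κ_k ∇_y M_k dy`. -/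
noncomputable def homDrift {d : ℕ} (κ : Fin 2 → E d → E d → ℝ)
    (M : Fin 2 → E d → PeriodicH1 d) (k : Fin 2) (i : Fin d) (x : E d) : ℝ :=
  ∫ y in unitCube d, κ k x y * (M k x).grad y i

/-- `∫_Y Q N_k^i dy`. -/
noncomputable def homConvection {d : ℕ} (Q : E d → E d → ℝ)
    (N : Fin 2 → Fin d → E d → PeriodicH1 d) (k : Fin 2) (i : Fin d) (x : E d) : ℝ :=
  ∫ y in unitCube d, Q x y * (N k i x).fn y

/-- `∫_Y Q (M_1 + M_2) dy`. -/
noncomputable def homExchange {d : ℕ} (Q : E d → E d → ℝ)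
    (M : Fin 2 → E d → PeriodicH1 d) (x : E d) : ℝ :=
  ∫ y in unitCube d, Q x y * ((M 0 x).fn y + (M 1 x).fn y)

/-! ### The function spaces on `Ω` -/

/-- `H = L^2(Ω)`. -/
abbrev L2 {d : ℕ} (Ω : Set (E d)) : Type := Lp ℝ 2 (volume.restrict Ω)

/-- `L^2(Ω)^d`. -/
abbrev L2Vec {d : ℕ} (Ω : Set (E d)) : Type := Lp (E d) 2 (volume.restrict Ω)

/-- The pairs `(φ, ∇φ)` with `φ ∈ C_0^∞(Ω)`, as a subspace of `L^2(Ω) × L^2(Ω)^d`. -/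
def testPairs {d : ℕ} (Ω : Set (E d)) : Submodule ℝ (WithLp 2 (L2 Ω × L2Vec Ω)) where
  carrier := {p | ∃ φ : E d → ℝ, ContDiff ℝ ∞ φ ∧ HasCompactSupport φ ∧ tsupport φ ⊆ Ω ∧
    p.fst =ᵐ[volume.restrict Ω] φ ∧ p.snd =ᵐ[volume.restrict Ω] gradient φ}
  zero_mem' := by
    refine ⟨0, contDiff_const, HasCompactSupport.zero, ?_, ?_, ?_⟩
    · rw [tsupport_eq_empty_iff.mpr rfl]; exact empty_subset _
    · exact Lp.coeFn_zero _ _ _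
    · filter_upwards [Lp.coeFn_zero (E d) 2 (volume.restrict Ω)] with x hx
      have h0 : gradient (0 : E d → ℝ) x = 0 := gradient_const x (0 : ℝ)
      rw [h0]; exact hx
  add_mem' := by
    rintro p p' ⟨φ, hφ, hc, hs, h1, h2⟩ ⟨φ', hφ', hc', hs', h1', h2'⟩
    refine ⟨φ + φ', hφ.add hφ', hc.add hc',
      (tsupport_add φ φ').trans (union_subset hs hs'), ?_, ?_⟩
    · filter_upwards [h1, h1', Lp.coeFn_add p.fst p'.fst] with x a b c
      exact c.trans (by simp [a, b])
    · filter_upwards [h2, h2', Lp.coeFn_add p.snd p'.snd] with x a b c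
      refine c.trans ?_
      have hd : DifferentiableAt ℝ φ x := (hφ.differentiable (by simp)) x
      have hd' : DifferentiableAt ℝ φ' x := (hφ'.differentiable (by simp)) x
      simp only [Pi.add_apply, a, b, gradient, fderiv_add hd hd', map_add]
  smul_mem' := by
    rintro r p ⟨φ, hφ, hc, hs, h1, h2⟩
    refine ⟨r • φ, contDiff_const.smul hφ, hc.smul_left (f := fun _ => r),
      (closure_mono (Function.support_const_smul_subset r φ)).trans hs, ?_, ?_⟩
    · filter_upwards [h1, Lp.coeFn_smul r p.fst] with x a c
      exact c.trans (by simp [a])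
    · filter_upwards [h2, Lp.coeFn_smul r p.snd] with x a c
      refine c.trans ?_
      have hd : DifferentiableAt ℝ φ x := (hφ.differentiable (by simp)) x
      simp only [Pi.smul_apply, a, gradient, fderiv_const_smul hd, map_smul]

/-- `V = H^1_0(Ω)`, the closure of `C_0^∞(Ω)` in the `H^1` norm. An element is stored as the pair
of the function and its gradient, and the norm is `(‖v‖² + ‖∇v‖²)^{1/2}`. -/
abbrev H10 {d : ℕ} (Ω : Set (E d)) : Type := ↥(testPairs Ω).topologicalClosure

/-- The function underlying an element of `H^1_0(Ω)`. -/
noncomputable def H10.fn {d : ℕ} {Ω : Set (E d)} (v : H10 Ω) : L2 Ω := v.1.fst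

/-- The weak gradient of an element of `H^1_0(Ω)`. -/
noncomputable def H10.grad {d : ℕ} {Ω : Set (E d)} (v : H10 Ω) : L2Vec Ω := v.1.snd

/-- `L^2(0,T;V)`. -/
abbrev L2V {d : ℕ} (Ω : Set (E d)) (T : ℝ) : Type :=
  Lp (H10 Ω) 2 (volume.restrict (Ioo 0 T))

/-- `L^2(0,T;V')`, with `V' = H^{-1}(Ω)` the dual of `H^1_0(Ω)`. -/
abbrev L2V' {d : ℕ} (Ω : Set (E d)) (T : ℝ) : Type :=
  Lp (StrongDual ℝ (H10 Ω)) 2 (volume.restrict (Ioo 0 T))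

/-- `f = c ∂u/∂t` in `L^2(0,T;V')`, where the weight `c` is a function of `x` only. As usual, the
elements `c u(t)` of `L^2(Ω)` are regarded as the functionals `v ↦ ∫_Ω c u(t) v dx` on `V`, and the
derivative is taken in the sense of `V'`-valued distributions on `(0,T)`. -/
def IsTimeDeriv {d : ℕ} {Ω : Set (E d)} {T : ℝ} (c : E d → ℝ) (u : L2V Ω T) (f : L2V' Ω T) :
    Prop :=
  ∀ η : ℝ → ℝ, ContDiff ℝ ∞ η → HasCompactSupport η → tsupport η ⊆ Ioo 0 T → ∀ v : H10 Ω,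
    ∫ t in Ioo 0 T, deriv η t * (∫ x in Ω, c x * (u t).fn x * v.fn x)
      = - ∫ t in Ioo 0 T, η t * f t v

/-- `u(0) = g`: the function `u` has a representative in `C([0,T];H)` with value `g` at `0`. -/
def HasInitialValue {d : ℕ} {Ω : Set (E d)} {T : ℝ} (u : L2V Ω T) (g : L2 Ω) : Prop :=
  ∃ w : ℝ → L2 Ω, ContinuousOn w (Icc 0 T) ∧
    (∀ᵐ t ∂(volume.restrict (Ioo 0 T)), w t = (u t).fn) ∧ w 0 = g

/-! ### The homogenized system -/

/-- The spatial part of the `k`-th equation of the homogenized system in variational form, at a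
fixed time. Here `k.rev` is the index of the other continuum. -/
noncomputable def homForm {d : ℕ} {Ω : Set (E d)} (κ : Fin 2 → E d → E d → ℝ) (Q : E d → E d → ℝ)
    (N : Fin 2 → Fin d → E d → PeriodicH1 d) (M : Fin 2 → E d → PeriodicH1 d)
    (k : Fin 2) (u : Fin 2 → H10 Ω) (φ : H10 Ω) : ℝ :=
  (∫ x in Ω, ∑ i, ∑ j, homDiffusion κ N k i j x * (u k).grad x j * φ.grad x i)
  + (∫ x in Ω, (∑ i, homDrift κ M k i x * φ.grad x i) * ((u k.rev).fn x - (u k).fn x))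
  + (∫ x in Ω, (∑ i, (homConvection Q N k i x * (u k).grad x i
        - homConvection Q N k.rev i x * (u k.rev).grad x i)) * φ.fn x)
  - (∫ x in Ω, homExchange Q M x * ((u k).fn x - (u k.rev).fn x) * φ.fn x)

/-- `u = (u_10, u_20)` is a weak solution of the homogenized dual-continuum system with source `q`
and initial data `g`. -/
def IsWeakSolution {d : ℕ} (Ω : Set (E d)) (T : ℝ)
    (C κ : Fin 2 → E d → E d → ℝ) (Q : E d → E d → ℝ)
    (N : Fin 2 → Fin d → E d → PeriodicH1 d) (M : Fin 2 → E d → PeriodicH1 d)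
    (q : ℝ × E d → ℝ) (g : Fin 2 → L2 Ω) (u : Fin 2 → L2V Ω T) : Prop :=
  ∀ k : Fin 2, HasInitialValue (u k) (g k) ∧
    ∃ f : L2V' Ω T, IsTimeDeriv (homCapacity C k) (u k) f ∧
      ∀ φ : L2V Ω T,
        (∫ t in Ioo 0 T, f t (φ t))
          + (∫ t in Ioo 0 T, homForm κ Q N M k (fun l => u l t) (φ t))
        = ∫ t in Ioo 0 T, ∫ x in Ω, q (t, x) * (φ t).fn x

end DualContinuum

/-!
The homogenized system is an abstract parabolic equation `(S u)' + A u = F` on the product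
`V × V` with pivot space `H × H`, where `S = ι† m ι` collects the capacities and `A` represents the
spatial form. Three facts make it well posed.

*The coefficients are bounded and measurable, and the diffusion is elliptic.* The solutions of the
cell problems are not given as functions with any regularity in the slow variable `x`. Ellipticity
of the cell problems, together with the Poincaré inequality for periodic functions and the zero mean
of `Q`, shows that the cell gradients depend continuously in `L²(Y)` on the coefficients, hence on
`x`; the averages `∫_Y Q N` and `∫_Y Q M` only see the gradients for the same reason. So the
homogenized coefficients are continuous and bounded on `Ω` (`boundedCoefficients`). Testing the cell
problem of `∑ ξ_i N^i` with itself gives `κ* ξ · ξ ≥ κ₀ |ξ|²` (`le_homDiffusion`). In every other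
term of the form at least one factor is free of derivatives, so a Gårding inequality holds
(`exists_garding`).

*The abstract problem has exactly one solution.* The data `(u(0), S u' + A u)` of smooth functions
`u` form a dense subspace of `H × L²(0,T;V)`, and the energy inequality bounds `u` in `C([0,T];H)`
and in `L²(0,T;V)` by its data. Completeness then yields a solution for all data
(`ParabolicOperator.exists_distribSolution`). For uniqueness, the primitive `U = ∫_0^t u` of a
solution with zero data is differentiable with `(S U)' + A U = 0` pointwise, and the energy
argument applies to it without any product rule for `u` itself
(`ParabolicOperator.eq_zero_of_isDistribSolution`). Testing with functions `η(t) w` shows that weak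
solutions of the system are the solutions of the abstract problem
(`isDistribSolution_of_isWeakSolution`, `isWeakSolution_of_isDistribSolution`).

*Division by a Lipschitz capacity acts on `H^1_0(Ω)`.* If `c ≥ c₀ > 0` is Lipschitz, then so is
`1/c`, and the multiplications by its mollifications are uniformly bounded operators on `H^1_0(Ω)`.
A weak limit `P` of them satisfies `∫ c u (P v) = ∫ u v` (`exists_lipschitzDivision`), so that
composing the functional `c ∂_t u` with `P` gives `∂_t u`.
-/

open scoped Pointwise

namespace DualContinuum


/-! ### Calculus on a time interval -/

section TimeCalculus

variable {V : Type*} [NormedAddCommGroup V] [NormedSpace ℝ V]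

theorem setIntegral_ite_lt_left {T t : ℝ} (ht : t ∈ Ioo 0 T) (f : ℝ → V) :
    (∫ s in Ioo 0 T, if s < t then f s else 0) = ∫ s in (0 : ℝ)..t, f s := by
  have h : (fun s => if s < t then f s else 0) = (Iio t).indicator f := by
    ext s; simp [indicator]
  rw [h, setIntegral_indicator measurableSet_Iio, intervalIntegral.integral_of_le ht.1.le,
    integral_Ioc_eq_integral_Ioo]
  congr 2
  ext s
  simp only [mem_inter_iff, mem_Ioo, mem_Iio]
  exact ⟨fun h => ⟨h.1.1, h.2⟩, fun h => ⟨⟨h.1, h.2.trans ht.2⟩, h.2⟩⟩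

theorem setIntegral_ite_lt_right {T s : ℝ} (hs : s ∈ Ioo 0 T) (f : ℝ → V) :
    (∫ t in Ioo 0 T, if s < t then f t else 0) = ∫ t in s..T, f t := by
  have h : (fun t => if s < t then f t else 0) = (Ioi s).indicator f := by
    ext s; simp [indicator]
  rw [h, setIntegral_indicator measurableSet_Ioi, intervalIntegral.integral_of_le hs.2.le,
    integral_Ioc_eq_integral_Ioo]
  congr 2
  ext t
  simp only [mem_inter_iff, mem_Ioo, mem_Ioi]
  exact ⟨fun h => ⟨h.2, h.1.2⟩, fun h => ⟨⟨hs.1.trans h.1, h.2⟩, h.1⟩⟩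

/-- Integration by parts between two primitives, as Fubini's theorem on a triangle. No pointwise
derivative of the primitives is needed. -/
theorem integral_primitive_smul [CompleteSpace V] {T : ℝ} {η : ℝ → ℝ} {f : ℝ → V}
    (hη : IntegrableOn η (Ioo 0 T)) (hf : IntegrableOn f (Ioo 0 T)) :
    ∫ t in Ioo 0 T, (∫ s in (0 : ℝ)..t, η s) • f t
      = ∫ s in Ioo 0 T, η s • ∫ t in s..T, f t := by
  have hint : Integrable (Function.uncurry fun s t => if s < t then η s • f t else 0)
      ((volume.restrict (Ioo 0 T)).prod (volume.restrict (Ioo 0 T))) := by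
    have h := (hη.integrable.smul_prod hf.integrable).indicator
      (measurableSet_lt measurable_fst measurable_snd : MeasurableSet {p : ℝ × ℝ | p.1 < p.2})
    refine h.congr (Eventually.of_forall fun p => ?_)
    simp [indicator, Function.uncurry]
  have := integral_integral_swap hint
  rw [setIntegral_congr_fun (g := fun t => ∫ s in Ioo 0 T, if s < t then η s • f t else 0)
    measurableSet_Ioo, ← this]
  · refine setIntegral_congr_fun measurableSet_Ioo fun s hs => ?_
    rw [← setIntegral_ite_lt_right hs, ← integral_smul]
    congr 1; ext t; split_ifs <;> simp
  · intro t ht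
    simp only
    rw [← setIntegral_ite_lt_left ht, ← integral_smul_const]
    congr 1; ext t; split_ifs <;> simp

theorem primitive_deriv {T : ℝ} {η : ℝ → ℝ} (hη : ContDiff ℝ ∞ η)
    (hs : tsupport η ⊆ Ioo 0 T) (t : ℝ) : ∫ s in (0 : ℝ)..t, deriv η s = η t := by
  have h0 : η 0 = 0 := image_eq_zero_of_notMem_tsupport fun h => (hs h).1.false
  rw [intervalIntegral.integral_deriv_eq_sub (fun x _ => (hη.differentiable (by simp)) x)
    ((hη.continuous_deriv (by simp)).intervalIntegrable _ _), h0, sub_zero]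

theorem integral_deriv_eq_zero_of_tsupport_subset {T : ℝ} (hT : 0 ≤ T) {η : ℝ → ℝ}
    (hη : ContDiff ℝ ∞ η) (hs : tsupport η ⊆ Ioo 0 T) : ∫ t in Ioo 0 T, deriv η t = 0 := by
  rw [← integral_Ioc_eq_integral_Ioo, ← intervalIntegral.integral_of_le hT, primitive_deriv hη hs]
  exact image_eq_zero_of_notMem_tsupport fun h => (hs h).2.false

/-- A primitive has the expected distributional derivative. -/
theorem integral_deriv_smul_primitive [CompleteSpace V] {T : ℝ} (hT : 0 < T) {η : ℝ → ℝ}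
    (hη : ContDiff ℝ ∞ η)
    (hs : tsupport η ⊆ Ioo 0 T) {f : ℝ → V} (hf : IntegrableOn f (Ioo 0 T)) :
    ∫ t in Ioo 0 T, deriv η t • (∫ s in (0 : ℝ)..t, f s) = - ∫ t in Ioo 0 T, η t • f t := by
  have hd : IntegrableOn (deriv η) (Ioo 0 T) :=
    ((hη.continuous_deriv (by simp)).integrableOn_Icc).mono_set Ioo_subset_Icc_self
  have hfi : ∀ a ∈ Icc 0 T, ∀ b ∈ Icc 0 T, IntervalIntegrable f volume a b := by
    intro a ha b hb
    rw [intervalIntegrable_iff]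
    have h1 : IntegrableOn f (Icc 0 T) := (integrableOn_Icc_iff_integrableOn_Ioo).mpr hf
    exact h1.mono_set ((uIoc_subset_uIcc).trans (uIcc_subset_Icc ha hb))
  have h := integral_primitive_smul hd hf
  simp_rw [primitive_deriv hη hs] at h
  have hsplit : ∀ t ∈ Ioo 0 T, (∫ s in (0 : ℝ)..t, f s)
      = (∫ s in (0 : ℝ)..T, f s) - ∫ s in t..T, f s := fun t ht => by
    rw [eq_sub_iff_add_eq, intervalIntegral.integral_add_adjacent_intervals
      (hfi _ ⟨le_rfl, hT.le⟩ _ ⟨ht.1.le, ht.2.le⟩) (hfi _ ⟨ht.1.le, ht.2.le⟩ _ ⟨hT.le, le_rfl⟩)]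
  have hcont : ContinuousOn (fun t => ∫ s in t..T, f s) (Icc 0 T) := by
    have := intervalIntegral.continuousOn_primitive_interval_left (μ := volume) (f := f)
      (a := 0) (b := T) (by
        rw [uIcc_of_le hT.le]; exact (integrableOn_Icc_iff_integrableOn_Ioo).mpr hf)
    rwa [uIcc_of_le hT.le] at this
  have i2 : IntegrableOn (fun t => deriv η t • ∫ s in t..T, f s) (Ioo 0 T) :=
    (((hη.continuous_deriv (by simp)).continuousOn.smul hcont).integrableOn_Icc).mono_set
      Ioo_subset_Icc_self
  rw [h, setIntegral_congr_fun (g := fun t => deriv η t • (∫ s in (0 : ℝ)..T, f s)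
    - deriv η t • ∫ s in t..T, f s) measurableSet_Ioo
    (fun t ht => by simp only; rw [hsplit t ht, smul_sub])]
  rw [integral_sub (hd.smul_const _) i2, integral_smul_const,
    integral_deriv_eq_zero_of_tsupport_subset hT.le hη hs, zero_smul, zero_sub]

end TimeCalculus

/-! ### Energy estimates for an abstract parabolic equation -/

section Energy

variable {V : Type*} [NormedAddCommGroup V] [InnerProductSpace ℝ V]

/-- `d/dt ⟪S u, u⟫ = 2 ⟪(S u)', u⟫` for symmetric `S`; only `S u` is assumed differentiable. -/
theorem hasDerivAt_inner_symm {S : V →L[ℝ] V} (hS : ∀ u v, inner ℝ (S u) v = inner ℝ u (S v))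
    {u : ℝ → V} {t : ℝ} {z : V} (hu : ContinuousAt u t)
    (hd : HasDerivAt (fun t => S (u t)) z t) :
    HasDerivAt (fun t => inner ℝ (S (u t)) (u t)) (2 * inner ℝ z (u t)) t := by
  rw [hasDerivAt_iff_tendsto_slope] at hd ⊢
  have h : ∀ s, slope (fun t => inner ℝ (S (u t)) (u t)) t s
      = inner ℝ (slope (fun t => S (u t)) t s) (u s + u t) := by
    intro s
    simp only [slope, vsub_eq_sub, inner_smul_left, smul_eq_mul, inner_sub_left, inner_add_right]
    have h1 := hS (u s) (u t)
    have h2 := real_inner_comm (u s) (S (u t))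
    simp only [conj_trivial]
    rw [h1, h2]; ring
  have hc : Tendsto (fun s => u s + u t) (𝓝[≠] t) (𝓝 (u t + u t)) :=
    (hu.tendsto.mono_left nhdsWithin_le_nhds).add tendsto_const_nhds
  have := hd.inner (𝕜 := ℝ) hc
  rw [inner_add_right, ← two_mul] at this
  exact this.congr fun s => (h s).symm

/-- The homogeneous equation `(S Φ)' + A Φ = 0` with `Φ(0) = 0` has only the zero solution. -/
theorem eq_zero_of_hasDerivAt_symm {S A : V →L[ℝ] V}
    (hS : ∀ u v, inner ℝ (S u) v = inner ℝ u (S v)) (hS0 : ∀ u, 0 ≤ inner ℝ (S u) u)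
    {α lam : ℝ} (hα : 0 < α) (hA : ∀ v, α * ‖v‖ ^ 2 ≤ inner ℝ (A v) v + lam * inner ℝ (S v) v)
    {T : ℝ} {Φ : ℝ → V} (hc : ContinuousOn Φ (Icc 0 T)) (h0 : Φ 0 = 0)
    (hd : ∀ t ∈ Ioo 0 T, HasDerivAt (fun t => S (Φ t)) (-A (Φ t)) t) :
    ∀ t ∈ Ioo 0 T, Φ t = 0 := by
  set y : ℝ → ℝ := fun t => inner ℝ (S (Φ t)) (Φ t) with hy
  have hyd : ∀ t ∈ Ioo 0 T, HasDerivAt y (2 * inner ℝ (-A (Φ t)) (Φ t)) t := fun t ht =>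
    hasDerivAt_inner_symm hS (hc.continuousAt (Icc_mem_nhds ht.1 ht.2)) (hd t ht)
  have hyc : ContinuousOn y (Icc 0 T) := (S.continuous.comp_continuousOn hc).inner hc
  have hzd : ∀ t ∈ Ioo 0 T, HasDerivAt (fun t => Real.exp (-(2 * lam) * t) * y t)
      (Real.exp (-(2 * lam) * t) * (2 * inner ℝ (-A (Φ t)) (Φ t) - 2 * lam * y t)) t := by
    intro t ht
    have h1 : HasDerivAt (fun t => Real.exp (-(2 * lam) * t))
        (Real.exp (-(2 * lam) * t) * (-(2 * lam))) t := by
      simpa using ((hasDerivAt_id t).const_mul (-(2 * lam))).exp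
    exact (h1.mul (hyd t ht)).congr_deriv (by ring)
  have hanti : AntitoneOn (fun t => Real.exp (-(2 * lam) * t) * y t) (Icc 0 T) := by
    refine antitoneOn_of_deriv_nonpos (convex_Icc _ _) ?_ ?_ ?_
    · exact (Continuous.continuousOn (by fun_prop)).mul hyc
    · rw [interior_Icc]
      exact fun t ht => (hzd t ht).differentiableAt.differentiableWithinAt
    · rw [interior_Icc]
      intro t ht
      rw [(hzd t ht).deriv]
      refine mul_nonpos_of_nonneg_of_nonpos (Real.exp_pos _).le ?_
      have := hA (Φ t)
      rw [inner_neg_left]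
      simp only [hy]
      nlinarith [mul_nonneg hα.le (sq_nonneg ‖Φ t‖)]
  have hy0 : ∀ t ∈ Ioo 0 T, y t = 0 := by
    intro t ht
    have h := hanti ⟨le_rfl, (ht.1.trans ht.2).le⟩ ⟨ht.1.le, ht.2.le⟩ ht.1.le
    have hz : y 0 = 0 := by simp [hy, h0]
    simp only [hz, mul_zero] at h
    exact le_antisymm (nonpos_of_mul_nonpos_right h (Real.exp_pos _)) (hS0 _)
  intro t ht
  have h1 : HasDerivAt y 0 t := by
    refine (hasDerivAt_const t (0 : ℝ)).congr_of_eventuallyEq ?_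
    filter_upwards [Ioo_mem_nhds ht.1 ht.2] with s hs using hy0 s hs
  have h2 := (hyd t ht).unique h1
  have h3 := hA (Φ t)
  have h4 : inner ℝ (S (Φ t)) (Φ t) = 0 := hy0 t ht
  rw [inner_neg_left] at h2
  rw [h4] at h3
  have h5 : ‖Φ t‖ ^ 2 ≤ 0 := by
    by_contra hcon
    push Not at hcon
    nlinarith [mul_pos hα hcon]
  exact norm_eq_zero.mp (pow_eq_zero_iff (two_ne_zero) |>.mp (le_antisymm h5 (sq_nonneg _)))

/-- The energy inequality for a classical function `u`, with `F = S u' + A u`. -/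
theorem energy_inequality {S A : V →L[ℝ] V}
    (hS : ∀ u v, inner ℝ (S u) v = inner ℝ u (S v))
    {α lam : ℝ} (hα : 0 < α) (hlam : 0 ≤ lam) (hS0 : ∀ u, 0 ≤ inner ℝ (S u) u)
    (hA : ∀ v, α * ‖v‖ ^ 2 ≤ inner ℝ (A v) v + lam * inner ℝ (S v) v)
    {T : ℝ} {u θ : ℝ → V} (hθ : Continuous θ) (hu : ∀ t, HasDerivAt u (θ t) t)
    {t : ℝ} (ht : t ∈ Icc 0 T) :
    Real.exp (-(2 * lam) * T) * (inner ℝ (S (u t)) (u t) + α * ∫ s in (0 : ℝ)..t, ‖u s‖ ^ 2)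
      ≤ inner ℝ (S (u 0)) (u 0) + α⁻¹ * ∫ s in (0 : ℝ)..T, ‖S (θ s) + A (u s)‖ ^ 2 := by
  have huc : Continuous u := continuous_iff_continuousAt.mpr fun t => (hu t).continuousAt
  set F : ℝ → V := fun s => S (θ s) + A (u s) with hF
  have hFc : Continuous F := by fun_prop
  set y : ℝ → ℝ := fun t => inner ℝ (S (u t)) (u t) with hy
  have hyd : ∀ t, HasDerivAt y (2 * inner ℝ (S (θ t)) (u t)) t := fun t =>
    hasDerivAt_inner_symm hS huc.continuousAt (S.hasFDerivAt.comp_hasDerivAt t (hu t))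
  have hzd : ∀ t, HasDerivAt (fun t => Real.exp (-(2 * lam) * t) * y t)
      (Real.exp (-(2 * lam) * t) * (2 * inner ℝ (S (θ t)) (u t) - 2 * lam * y t)) t := by
    intro t
    have h1 : HasDerivAt (fun t => Real.exp (-(2 * lam) * t))
        (Real.exp (-(2 * lam) * t) * (-(2 * lam))) t := by
      simpa using ((hasDerivAt_id t).const_mul (-(2 * lam))).exp
    exact (h1.mul (hyd t)).congr_deriv (by ring)
  have hpt : ∀ s ∈ Ioo 0 t,
      Real.exp (-(2 * lam) * s) * (2 * inner ℝ (S (θ s)) (u s) - 2 * lam * y s)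
        ≤ α⁻¹ * ‖F s‖ ^ 2 - Real.exp (-(2 * lam) * T) * α * ‖u s‖ ^ 2 := by
    intro s hs
    have e1 : Real.exp (-(2 * lam) * s) ≤ 1 := Real.exp_le_one_iff.mpr (by nlinarith [hs.1])
    have e2 : Real.exp (-(2 * lam) * T) ≤ Real.exp (-(2 * lam) * s) :=
      Real.exp_le_exp.mpr (by nlinarith [hs.2, ht.2])
    have h1 := hA (u s)
    have h2 : inner ℝ (S (θ s)) (u s) = inner ℝ (F s) (u s) - inner ℝ (A (u s)) (u s) := by
      simp [hF, inner_add_left]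
    have h3 : 2 * inner ℝ (F s) (u s) ≤ α⁻¹ * ‖F s‖ ^ 2 + α * ‖u s‖ ^ 2 := by
      have h4 := real_inner_le_norm (F s) (u s)
      have h5 : 0 ≤ α⁻¹ * (‖F s‖ - α * ‖u s‖) ^ 2 := by positivity
      have h6 : α⁻¹ * (‖F s‖ - α * ‖u s‖) ^ 2
          = α⁻¹ * ‖F s‖ ^ 2 - 2 * (‖F s‖ * ‖u s‖) + α * ‖u s‖ ^ 2 := by
        field_simp; ring
      linarith
    have h7 : 2 * inner ℝ (S (θ s)) (u s) - 2 * lam * y s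
        ≤ α⁻¹ * ‖F s‖ ^ 2 - α * ‖u s‖ ^ 2 := by
      rw [h2]; simp only [hy]; linarith
    have p1 : 0 ≤ α⁻¹ * ‖F s‖ ^ 2 := by positivity
    have p2 : 0 ≤ α * ‖u s‖ ^ 2 := by positivity
    have p3 := Real.exp_pos (-(2 * lam) * s)
    calc _ ≤ Real.exp (-(2 * lam) * s) * (α⁻¹ * ‖F s‖ ^ 2 - α * ‖u s‖ ^ 2) :=
          mul_le_mul_of_nonneg_left h7 p3.le
      _ ≤ _ := by nlinarith [mul_nonneg (sub_nonneg.mpr e1) p1, mul_nonneg (sub_nonneg.mpr e2) p2]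
  have i1 : ∀ a b, IntervalIntegrable (fun s => ‖F s‖ ^ 2) volume a b := fun a b =>
    (by fun_prop : Continuous fun s => ‖F s‖ ^ 2).intervalIntegrable _ _
  have i2 : ∀ a b, IntervalIntegrable (fun s => ‖u s‖ ^ 2) volume a b := fun a b =>
    (by fun_prop : Continuous fun s => ‖u s‖ ^ 2).intervalIntegrable _ _
  have hint := intervalIntegral.sub_le_integral_of_hasDeriv_right_of_le ht.1
    (fun s _ => (hzd s).continuousAt.continuousWithinAt)
    (fun s _ => (hzd s).hasDerivWithinAt)
    ((by fun_prop : Continuous fun s => α⁻¹ * ‖F s‖ ^ 2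
      - Real.exp (-(2 * lam) * T) * α * ‖u s‖ ^ 2).integrableOn_Icc) hpt
  rw [intervalIntegral.integral_sub ((i1 _ _).const_mul _) ((i2 _ _).const_mul _),
    intervalIntegral.integral_const_mul, intervalIntegral.integral_const_mul] at hint
  have e2 : Real.exp (-(2 * lam) * T) ≤ Real.exp (-(2 * lam) * t) :=
    Real.exp_le_exp.mpr (by nlinarith [ht.2])
  have h8 := mul_le_mul_of_nonneg_right e2 (hS0 (u t))
  have h9 : (∫ s in (0 : ℝ)..t, ‖F s‖ ^ 2) ≤ ∫ s in (0 : ℝ)..T, ‖F s‖ ^ 2 :=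
    intervalIntegral.integral_mono_interval le_rfl ht.1 ht.2
      (Eventually.of_forall fun s => sq_nonneg _) (i1 _ _)
  have h10 := mul_le_mul_of_nonneg_left h9 (inv_pos.mpr hα).le
  simp only [mul_zero, Real.exp_zero, one_mul, hy] at hint
  linarith

end Energy


/-! ### The abstract parabolic problem -/

theorem memLp_of_continuous_Ioo {V : Type*} [NormedAddCommGroup V] {f : ℝ → V} (hf : Continuous f)
    (T : ℝ) : MemLp f 2 (volume.restrict (Ioo 0 T)) := by
  obtain ⟨K, hK⟩ := (isCompact_Icc (a := (0 : ℝ)) (b := T)).exists_bound_of_continuousOn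
    hf.continuousOn
  refine MemLp.of_bound hf.aestronglyMeasurable K ?_
  filter_upwards [ae_restrict_mem measurableSet_Ioo] with t ht using hK t (Ioo_subset_Icc_self ht)

theorem ae_eq_zero_of_forall_test {V : Type*} [NormedAddCommGroup V] [NormedSpace ℝ V]
    [CompleteSpace V] {T : ℝ} {f : ℝ → V} (hf : IntegrableOn f (Ioo 0 T))
    (h : ∀ η : ℝ → ℝ, ContDiff ℝ ∞ η → HasCompactSupport η → tsupport η ⊆ Ioo 0 T →
      ∫ t in Ioo 0 T, η t • f t = 0) :
    ∀ᵐ t ∂(volume.restrict (Ioo 0 T)), f t = 0 := by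
  rw [ae_restrict_iff' measurableSet_Ioo]
  refine isOpen_Ioo.ae_eq_zero_of_integral_contDiff_smul_eq_zero hf.locallyIntegrableOn ?_
  intro η h1 h2 h3
  rw [← h η h1 h2 h3]
  refine (setIntegral_eq_integral_of_forall_compl_eq_zero fun t ht => ?_).symm
  rw [image_eq_zero_of_notMem_tsupport (fun hh => ht (h3 hh)), zero_smul]

theorem integrableOn_of_Lp {V : Type*} [NormedAddCommGroup V] {T : ℝ}
    (f : Lp V 2 (volume.restrict (Ioo 0 T))) : IntegrableOn f (Ioo 0 T) :=
  (Lp.memLp f).integrable (by norm_num)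

variable {V H : Type*} [NormedAddCommGroup V] [InnerProductSpace ℝ V] [CompleteSpace V]
  [NormedAddCommGroup H] [InnerProductSpace ℝ H] [CompleteSpace H]

/-- The data of an abstract evolution equation `(m ι u)' + A u = F` in the dual of `V`, which is
identified with `V`: the map `ι : V → H` has dense range, the weight `m` on `H` is symmetric and
coercive, and `A` satisfies a Gårding inequality. -/
structure ParabolicOperator (V H : Type*) [NormedAddCommGroup V] [InnerProductSpace ℝ V]
    [NormedAddCommGroup H] [InnerProductSpace ℝ H] where
  /-- the map into the pivot space -/
  ι : V →L[ℝ] H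
  /-- the weight in front of the time derivative -/
  m : H →L[ℝ] H
  /-- the spatial operator -/
  A : V →L[ℝ] V
  /-- coercivity constant of the weight -/
  ν : ℝ
  /-- coercivity constant of the spatial operator -/
  α : ℝ
  /-- the zeroth order shift in the Gårding inequality -/
  lam : ℝ
  ν_pos : 0 < ν
  α_pos : 0 < α
  lam_nonneg : 0 ≤ lam
  dense : ∀ h : H, (∀ v : V, inner ℝ (ι v) h = 0) → h = 0
  m_symm : ∀ x y, inner ℝ (m x) y = inner ℝ x (m y)
  m_coercive : ∀ x, ν * ‖x‖ ^ 2 ≤ inner ℝ (m x) x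
  garding : ∀ v, α * ‖v‖ ^ 2 ≤ inner ℝ (A v) v + lam * inner ℝ (m (ι v)) (ι v)

namespace ParabolicOperator

/-- The weight transported to `V`. -/
noncomputable def S (P : ParabolicOperator V H) : V →L[ℝ] V :=
  (ContinuousLinearMap.adjoint P.ι) ∘L P.m ∘L P.ι

variable (P : ParabolicOperator V H)

theorem inner_S (u v : V) : inner ℝ (P.S u) v = inner ℝ (P.m (P.ι u)) (P.ι v) := by
  simp [S, ContinuousLinearMap.adjoint_inner_left]

theorem S_symm (u v : V) : inner ℝ (P.S u) v = inner ℝ u (P.S v) := by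
  rw [inner_S, P.m_symm, real_inner_comm, ← P.inner_S, real_inner_comm]

theorem S_nonneg (u : V) : 0 ≤ inner ℝ (P.S u) u := by
  rw [inner_S]; exact (mul_nonneg P.ν_pos.le (sq_nonneg _)).trans (P.m_coercive _)

theorem garding_S (v : V) : P.α * ‖v‖ ^ 2 ≤ inner ℝ (P.A v) v + P.lam * inner ℝ (P.S v) v := by
  rw [inner_S]; exact P.garding v

/-- The initial values and right hand sides `(u(0), S u' + A u)` of continuously differentiable
functions `u : ℝ → V`. -/
def classicalData (T : ℝ) : Submodule ℝ (WithLp 2 (H × Lp V 2 (volume.restrict (Ioo 0 T)))) where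
  carrier := {p | ∃ u θ : ℝ → V, Continuous θ ∧ (∀ t, HasDerivAt u (θ t) t) ∧ p.fst = P.ι (u 0) ∧
    p.snd =ᵐ[volume.restrict (Ioo 0 T)] fun t => P.S (θ t) + P.A (u t)}
  zero_mem' := by
    refine ⟨fun _ => 0, fun _ => 0, continuous_const, fun t => hasDerivAt_const _ _, by simp, ?_⟩
    filter_upwards [Lp.coeFn_zero V 2 (volume.restrict (Ioo 0 T))] with t ht
    simpa using ht
  add_mem' := by
    rintro p p' ⟨u, θ, hθ, hu, h1, h2⟩ ⟨u', θ', hθ', hu', h1', h2'⟩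
    refine ⟨fun t => u t + u' t, fun t => θ t + θ' t, hθ.add hθ',
      fun t => (hu t).add (hu' t), by simp [h1, h1'], ?_⟩
    filter_upwards [h2, h2', Lp.coeFn_add p.snd p'.snd] with t a b c
    refine c.trans ?_
    simp only [Pi.add_apply, a, b, map_add]; abel
  smul_mem' := by
    rintro r p ⟨u, θ, hθ, hu, h1, h2⟩
    refine ⟨fun t => r • u t, fun t => r • θ t, hθ.const_smul r,
      fun t => (hu t).const_smul r, by simp [h1], ?_⟩
    filter_upwards [h2, Lp.coeFn_smul r p.snd] with t a c
    refine c.trans ?_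
    simp only [Pi.smul_apply, a, map_smul, smul_add]

theorem orthogonal_classicalData {T : ℝ} {p : WithLp 2 (H × Lp V 2 (volume.restrict (Ioo 0 T)))}
    (hp : p ∈ (P.classicalData T)ᗮ) {u θ : ℝ → V} (hθ : Continuous θ)
    (hu : ∀ t, HasDerivAt u (θ t) t) :
    inner ℝ (P.ι (u 0)) p.fst
      + ∫ t in Ioo 0 T, inner ℝ (P.S (θ t) + P.A (u t)) (p.snd t) = 0 := by
  have huc : Continuous u := continuous_iff_continuousAt.mpr fun t => (hu t).continuousAt
  have hm := memLp_of_continuous_Ioo (f := fun t => P.S (θ t) + P.A (u t)) (by fun_prop) T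
  have h := (Submodule.mem_orthogonal _ _).mp hp (WithLp.toLp 2 (P.ι (u 0), hm.toLp _))
    ⟨u, θ, hθ, hu, rfl, hm.coeFn_toLp⟩
  rw [WithLp.prod_inner_apply, L2.inner_def] at h
  refine Eq.trans ?_ h
  congr 1
  refine integral_congr_ae ?_
  filter_upwards [hm.coeFn_toLp] with t ht
  simp only [ht]
  rfl

/-- The data of classical functions are dense. An element `(h, φ)` of the orthogonal complement
gives the solution `Φ = ∫_t^T φ` of the homogeneous backward adjoint equation. -/
theorem topologicalClosure_classicalData {T : ℝ} (hT : 0 < T) :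
    (P.classicalData T).topologicalClosure = ⊤ := by
  rw [Submodule.topologicalClosure_eq_top_iff, Submodule.eq_bot_iff]
  intro p hp
  set φ : ℝ → V := fun t => p.snd t with hφ
  have hφi : IntegrableOn φ (Ioo 0 T) := integrableOn_of_Lp p.snd
  have hφii : IntegrableOn φ (Icc 0 T) := (integrableOn_Icc_iff_integrableOn_Ioo).mpr hφi
  set Φ : ℝ → V := fun s => ∫ t in s..T, φ t with hΦ
  have hΦc : ContinuousOn Φ (Icc 0 T) := by
    have := intervalIntegral.continuousOn_primitive_interval_left (μ := volume) (f := φ)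
      (a := 0) (b := T) (by rwa [uIcc_of_le hT.le])
    rwa [uIcc_of_le hT.le] at this
  set B := ContinuousLinearMap.adjoint P.A with hB
  -- the Euler-Lagrange equation, tested with `u t = (∫_0^t η) v`
  have hEL : ∀ η : ℝ → ℝ, ContDiff ℝ ∞ η → HasCompactSupport η → tsupport η ⊆ Ioo 0 T →
      ∫ t in Ioo 0 T, η t • (P.S (φ t) + B (Φ t)) = 0 := by
    intro η hη _ _
    have hηi : IntegrableOn η (Ioo 0 T) :=
      (hη.continuous.integrableOn_Icc).mono_set Ioo_subset_Icc_self
    set K : ℝ → ℝ := fun t => ∫ s in (0 : ℝ)..t, η s with hK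
    have hKd : ∀ t, HasDerivAt K (η t) t := fun t =>
      hη.continuous.integral_hasStrictDerivAt 0 t |>.hasDerivAt
    have hKc : Continuous K := continuous_iff_continuousAt.mpr fun t => (hKd t).continuousAt
    have j1 : IntegrableOn (fun t => η t • φ t) (Ioo 0 T) :=
      (hφii.continuousOn_smul hη.continuous.continuousOn isCompact_Icc).mono_set Ioo_subset_Icc_self
    have j2 : IntegrableOn (fun t => K t • φ t) (Ioo 0 T) :=
      (hφii.continuousOn_smul hKc.continuousOn isCompact_Icc).mono_set Ioo_subset_Icc_self
    have j3 : IntegrableOn (fun t => η t • Φ t) (Ioo 0 T) :=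
      ((hη.continuous.continuousOn.smul hΦc).integrableOn_Icc).mono_set Ioo_subset_Icc_self
    have htri := integral_primitive_smul hηi hφi
    have e1 : ∫ t in Ioo 0 T, η t • (P.S (φ t) + B (Φ t))
        = P.S (∫ t in Ioo 0 T, η t • φ t) + B (∫ t in Ioo 0 T, η t • Φ t) := by
      rw [← P.S.integral_comp_comm j1, ← B.integral_comp_comm j3, ← integral_add
        (P.S.integrable_comp j1) (B.integrable_comp j3)]
      simp only [map_smul, smul_add]
    rw [e1, ← htri]
    refine ext_inner_left ℝ fun v => ?_
    have h := P.orthogonal_classicalData hp (u := fun t => K t • v) (θ := fun t => η t • v)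
      (hη.continuous.smul continuous_const) (fun t => (hKd t).smul_const v)
    have h0 : K 0 = 0 := by simp [hK]
    simp only [h0, zero_smul, map_zero, inner_zero_left, zero_add] at h
    rw [inner_zero_right, inner_add_right, ← P.S_symm, hB, ContinuousLinearMap.adjoint_inner_right,
      ← integral_inner j1, ← integral_inner j2, ← integral_add (j1.const_inner _)
      (j2.const_inner _)]
    refine Eq.trans ?_ h
    congr 1; ext t
    simp only [map_smul, inner_add_left, inner_smul_left, inner_smul_right, conj_trivial, hφ]
  have hSφ : ∀ᵐ t ∂(volume.restrict (Ioo 0 T)), P.S (φ t) + B (Φ t) = 0 := by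
    refine ae_eq_zero_of_forall_test ?_ hEL
    exact (P.S.integrable_comp hφi).add
      (((B.continuous.comp_continuousOn hΦc).integrableOn_Icc).mono_set Ioo_subset_Icc_self)
  have hSΦ : ∀ s ∈ Ioo 0 T, P.S (Φ s) = ∫ t in T..s, B (Φ t) := by
    intro s hs
    have hi : IntervalIntegrable φ volume s T := by
      rw [intervalIntegrable_iff, uIoc_of_le hs.2.le]
      exact hφii.mono_set fun x hx => ⟨hs.1.le.trans hx.1.le, hx.2⟩
    calc P.S (Φ s) = ∫ t in s..T, P.S (φ t) := (P.S.intervalIntegral_comp_comm hi).symm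
      _ = ∫ t in s..T, -B (Φ t) := by
        rw [intervalIntegral.integral_of_le hs.2.le, intervalIntegral.integral_of_le hs.2.le,
          integral_Ioc_eq_integral_Ioo, integral_Ioc_eq_integral_Ioo]
        refine integral_congr_ae ?_
        filter_upwards [ae_restrict_of_ae_restrict_of_subset
          (Ioo_subset_Ioo_left hs.1.le) hSφ] with t ht using eq_neg_of_add_eq_zero_left ht
      _ = ∫ t in T..s, B (Φ t) := by
        rw [intervalIntegral.integral_neg, intervalIntegral.integral_symm, neg_neg]
  have hΦ0 : ∀ s ∈ Ioo 0 T, Φ s = 0 := by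
    have key := eq_zero_of_hasDerivAt_symm (S := P.S) (A := B) P.S_symm P.S_nonneg P.α_pos
      (lam := P.lam) (fun v => by
        rw [hB, ContinuousLinearMap.adjoint_inner_left, real_inner_comm]; exact P.garding_S v)
      (T := T) (Φ := fun t => Φ (T - t))
      (hΦc.comp (by fun_prop) fun t ht => ⟨by linarith [ht.2], by linarith [ht.1]⟩)
      (by simp [hΦ]) ?_
    · intro s hs
      have := key (T - s) ⟨by linarith [hs.2], by linarith [hs.1]⟩
      simpa using this
    · intro t ht
      have hd : HasDerivAt (fun s => P.S (Φ s)) (B (Φ (T - t))) (T - t) := by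
        have ht' : T - t ∈ Ioo 0 T := ⟨by linarith [ht.2], by linarith [ht.1]⟩
        have hcB : ContinuousOn (fun s => B (Φ s)) (Icc 0 T) := B.continuous.comp_continuousOn hΦc
        have h1 : HasDerivAt (fun s => ∫ t in T..s, B (Φ t)) (B (Φ (T - t))) (T - t) := by
          refine intervalIntegral.integral_hasDerivAt_right ?_ ?_ ?_
          · refine (hcB.mono ?_).intervalIntegrable
            exact uIcc_subset_Icc ⟨hT.le, le_rfl⟩ (Ioo_subset_Icc_self ht')
          · exact (hcB.mono Ioo_subset_Icc_self).stronglyMeasurableAtFilter isOpen_Ioo _ ht'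
          · exact hcB.continuousAt (Icc_mem_nhds ht'.1 ht'.2)
        refine h1.congr_of_eventuallyEq ?_
        filter_upwards [Ioo_mem_nhds ht'.1 ht'.2] with s hs using hSΦ s hs
      have := hd.scomp t ((hasDerivAt_const t T).sub (hasDerivAt_id t))
      simpa [Function.comp_def] using this
  have hφ0 : ∀ᵐ t ∂(volume.restrict (Ioo 0 T)), φ t = 0 := by
    refine ae_eq_zero_of_forall_test hφi fun η hη hc hs => ?_
    have hd : IntegrableOn (deriv η) (Ioo 0 T) :=
      ((hη.continuous_deriv (by simp)).integrableOn_Icc).mono_set Ioo_subset_Icc_self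
    have htri := integral_primitive_smul hd hφi
    simp_rw [primitive_deriv hη hs] at htri
    rw [htri]
    refine setIntegral_eq_zero_of_forall_eq_zero fun s hs' => ?_
    have := hΦ0 s hs'
    simp only [hΦ] at this
    simp [this]
  have hsnd : p.snd = 0 := by
    refine Lp.ext ?_
    filter_upwards [hφ0, Lp.coeFn_zero V 2 (volume.restrict (Ioo 0 T))] with t h1 h2
    exact h1.trans h2.symm
  have hfst : p.fst = 0 := by
    refine P.dense _ fun v => ?_
    have h := P.orthogonal_classicalData hp (u := fun _ => v) (θ := fun _ => 0)
      continuous_const (fun t => hasDerivAt_const _ _)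
    rw [integral_eq_zero_of_ae, add_zero] at h
    · exact h
    · filter_upwards [hφ0] with t ht
      simp only [hφ] at ht
      simp [ht]
  exact WithLp.ofLp_injective 2 (Prod.ext hfst hsnd)

end ParabolicOperator


/-- Lemma of du Bois-Reymond: a continuous function on `[0,T]` with vanishing distributional
derivative is constant. -/
theorem eqOn_const_of_integral_deriv_smul_eq_zero {V : Type*} [NormedAddCommGroup V]
    [NormedSpace ℝ V] [CompleteSpace V] {T : ℝ} (hT : 0 < T) {f : ℝ → V}
    (hf : ContinuousOn f (Icc 0 T))
    (h : ∀ η : ℝ → ℝ, ContDiff ℝ ∞ η → HasCompactSupport η → tsupport η ⊆ Ioo 0 T →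
      ∫ t in Ioo 0 T, deriv η t • f t = 0) :
    EqOn f (fun _ => f 0) (Icc 0 T) := by
  have hfi : IntegrableOn f (Ioo 0 T) := hf.integrableOn_Icc.mono_set Ioo_subset_Icc_self
  -- a test function of integral one, used to correct the mean of other test functions
  let b : ContDiffBump (T / 2) := ⟨T / 8, T / 4, by positivity, by linarith⟩
  set ψ₀ : ℝ → ℝ := b.normed volume with hψ₀
  have hψ₀s : ContDiff ℝ ∞ ψ₀ := b.contDiff_normed
  have hψ₀c : HasCompactSupport ψ₀ := b.hasCompactSupport_normed
  have hψ₀t : tsupport ψ₀ ⊆ Ioo 0 T := by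
    rw [hψ₀, b.tsupport_normed_eq, Real.closedBall_eq_Icc]
    intro x hx
    have h1 := hx.1; have h2 := hx.2
    change T / 2 - T / 4 ≤ x at h1
    change x ≤ T / 2 + T / 4 at h2
    exact ⟨by linarith, by linarith⟩
  have hset : ∀ g : ℝ → ℝ, tsupport g ⊆ Ioo 0 T → ∫ t in Ioo 0 T, g t = ∫ t, g t := fun g hg =>
    setIntegral_eq_integral_of_forall_compl_eq_zero fun t ht =>
      image_eq_zero_of_notMem_tsupport fun hh => ht (hg hh)
  have hψ₀i : ∫ t in Ioo 0 T, ψ₀ t = 1 := by rw [hset _ hψ₀t]; exact b.integral_normed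
  have key : ∀ ψ : ℝ → ℝ, ContDiff ℝ ∞ ψ → HasCompactSupport ψ → tsupport ψ ⊆ Ioo 0 T →
      ∫ t in Ioo 0 T, ψ t • (f t - ∫ s in Ioo 0 T, ψ₀ s • f s) = 0 := by
    intro ψ hψs hψc hψt
    set c : ℝ := ∫ t in Ioo 0 T, ψ t with hc
    set χ : ℝ → ℝ := fun t => ψ t - c * ψ₀ t with hχ
    have hχs : ContDiff ℝ ∞ χ := hψs.sub (contDiff_const.mul hψ₀s)
    set η : ℝ → ℝ := fun t => ∫ s in (0 : ℝ)..t, χ s with hη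
    have hηd : ∀ t, HasDerivAt η (χ t) t := fun t =>
      (hχs.continuous.integral_hasStrictDerivAt 0 t).hasDerivAt
    have hηder : deriv η = χ := funext fun t => (hηd t).deriv
    have hηs : ContDiff ℝ ∞ η := by
      rw [contDiff_infty_iff_deriv, hηder]
      exact ⟨fun t => (hηd t).differentiableAt, hχs⟩
    -- the support of `η` lies between the extreme points of the supports of `ψ` and `ψ₀`
    have hK : IsCompact (tsupport ψ ∪ tsupport ψ₀) := hψc.isCompact.union hψ₀c.isCompact
    have hKne : (tsupport ψ ∪ tsupport ψ₀).Nonempty := by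
      refine Nonempty.inr ?_
      by_contra hne
      rw [not_nonempty_iff_eq_empty, tsupport_eq_empty_iff] at hne
      rw [hne] at hψ₀i
      simp at hψ₀i
    have hKs : tsupport ψ ∪ tsupport ψ₀ ⊆ Ioo 0 T := union_subset hψt hψ₀t
    obtain ⟨p, hp, hpl⟩ := hK.exists_isLeast hKne
    obtain ⟨r, hr, hrg⟩ := hK.exists_isGreatest hKne
    have hχ0 : ∀ t, t ∉ Icc p r → χ t = 0 := by
      intro t ht
      have : t ∉ tsupport ψ ∪ tsupport ψ₀ := fun hh => ht ⟨hpl hh, hrg hh⟩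
      rw [mem_union, not_or] at this
      simp [hχ, image_eq_zero_of_notMem_tsupport this.1, image_eq_zero_of_notMem_tsupport this.2]
    have hψi : IntegrableOn ψ (Ioo 0 T) :=
      hψs.continuous.integrableOn_Icc.mono_set Ioo_subset_Icc_self
    have hψ₀I : IntegrableOn ψ₀ (Ioo 0 T) :=
      hψ₀s.continuous.integrableOn_Icc.mono_set Ioo_subset_Icc_self
    have hχT : η T = 0 := by
      simp only [hη]
      rw [intervalIntegral.integral_of_le hT.le, integral_Ioc_eq_integral_Ioo, hχ,
        integral_sub hψi (hψ₀I.const_mul c), integral_const_mul, hψ₀i, mul_one, sub_self]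
    have hη0 : ∀ t, t ∉ Icc p r → η t = 0 := by
      intro t ht
      by_cases h1 : t < p
      · simp only [hη]
        refine intervalIntegral.integral_zero_ae (Eventually.of_forall fun s hs => hχ0 s ?_)
        have hle := (uIoc_subset_uIcc hs).2
        have : s < p := lt_of_le_of_lt hle (max_lt (hKs hp).1 h1)
        exact fun hh => absurd hh.1 (not_le.mpr this)
      · have h2 : r < t := by
          by_contra h2
          exact ht ⟨not_lt.mp h1, not_lt.mp h2⟩
        have hsub : η t - η T = ∫ s in T..t, χ s :=
          intervalIntegral.integral_interval_sub_left
            (hχs.continuous.intervalIntegrable _ _) (hχs.continuous.intervalIntegrable _ _)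
        rw [hχT, sub_zero] at hsub
        rw [hsub]
        refine intervalIntegral.integral_zero_ae (Eventually.of_forall fun s hs => hχ0 s ?_)
        have hle := (uIoc_subset_uIcc hs).1
        have : r < s := lt_of_lt_of_le (lt_min (hKs hr).2 h2) hle
        exact fun hh => absurd hh.2 (not_le.mpr this)
    have hηt : tsupport η ⊆ Icc p r :=
      closure_minimal (fun t ht => by_contra fun hh => ht (hη0 t hh)) isClosed_Icc
    have hIcc : Icc p r ⊆ Ioo 0 T := fun t ht =>
      ⟨(hKs hp).1.trans_le ht.1, ht.2.trans_lt (hKs hr).2⟩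
    have h1 := h η hηs (isCompact_Icc.of_isClosed_subset (isClosed_tsupport _) hηt)
      (hηt.trans hIcc)
    rw [hηder] at h1
    have hfI : IntegrableOn f (Icc 0 T) := hf.integrableOn_Icc
    have i1 : IntegrableOn (fun t => ψ t • f t) (Ioo 0 T) :=
      (hfI.continuousOn_smul hψs.continuous.continuousOn isCompact_Icc).mono_set
        Ioo_subset_Icc_self
    have i2 : IntegrableOn (fun t => ψ₀ t • f t) (Ioo 0 T) :=
      (hfI.continuousOn_smul hψ₀s.continuous.continuousOn isCompact_Icc).mono_set
        Ioo_subset_Icc_self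
    have i3 : IntegrableOn (fun t => c • ψ₀ t • f t) (Ioo 0 T) := i2.smul c
    rw [← h1]
    simp only [hχ, smul_sub, sub_smul, mul_smul]
    rw [integral_sub i1 (hψi.smul_const _), integral_sub i1 i3, integral_smul_const,
      integral_smul]
  have hae : ∀ᵐ t ∂(volume.restrict (Ioo 0 T)), f t - ∫ s in Ioo 0 T, ψ₀ s • f s = 0 :=
    ae_eq_zero_of_forall_test (hfi.sub (integrableOn_const (by simp))) key
  have heq : EqOn f (fun _ => ∫ s in Ioo 0 T, ψ₀ s • f s) (Icc 0 T) := by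
    refine Measure.eqOn_Icc_of_ae_eq volume hT.ne ?_ hf continuousOn_const
    rw [← restrict_Ioo_eq_restrict_Icc]
    filter_upwards [hae] with t ht using sub_eq_zero.mp ht
  intro t ht
  rw [heq ht]
  exact (heq ⟨le_rfl, hT.le⟩).symm

namespace ParabolicOperator

variable {V H : Type*} [NormedAddCommGroup V] [InnerProductSpace ℝ V] [CompleteSpace V]
  [NormedAddCommGroup H] [InnerProductSpace ℝ H] [CompleteSpace H] (P : ParabolicOperator V H)

omit [CompleteSpace V] in
theorem norm_sq_toLp {T : ℝ} {u : ℝ → V} (hu : MemLp u 2 (volume.restrict (Ioo 0 T))) :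
    ‖hu.toLp u‖ ^ 2 = ∫ t in Ioo 0 T, ‖u t‖ ^ 2 := by
  rw [← real_inner_self_eq_norm_sq, L2.inner_def]
  refine integral_congr_ae ?_
  filter_upwards [hu.coeFn_toLp] with t ht
  rw [ht, real_inner_self_eq_norm_sq]

/-- The energy estimate: a classical function is controlled in `C([0,T];H)` and in `L²(0,T;V)` by
its initial value and its right hand side. -/
theorem energy_bound {T : ℝ} (hT : 0 < T) : ∃ C : ℝ, 0 ≤ C ∧
    ∀ (p : WithLp 2 (H × Lp V 2 (volume.restrict (Ioo 0 T)))) (u θ : ℝ → V), Continuous θ →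
      (∀ t, HasDerivAt u (θ t) t) → p.fst = P.ι (u 0) →
      (p.snd =ᵐ[volume.restrict (Ioo 0 T)] fun t => P.S (θ t) + P.A (u t)) →
      (∀ t ∈ Icc 0 T, ‖P.ι (u t)‖ ≤ C * ‖p‖) ∧
      ∀ hu : MemLp u 2 (volume.restrict (Ioo 0 T)), ‖hu.toLp u‖ ≤ C * ‖p‖ := by
  set e := Real.exp (-(2 * P.lam) * T) with he
  have he0 : 0 < e := Real.exp_pos _
  set K : ℝ := ‖P.m‖ + P.α⁻¹ with hK
  have hα := P.α_pos
  have hν := P.ν_pos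
  have hK0 : 0 ≤ K := by positivity
  have hle : ∀ (a x n : ℝ), 0 < a → 0 ≤ x → 0 ≤ n → e * (a * x ^ 2) ≤ K * n ^ 2 →
      x ≤ Real.sqrt (K / (e * a)) * n := by
    intro a x n ha hx hn h
    refine le_of_sq_le_sq ?_ (by positivity) 
    rw [mul_pow, Real.sq_sqrt (by positivity), div_mul_eq_mul_div, le_div_iff₀ (by positivity)]
    linarith
  refine ⟨max (Real.sqrt (K / (e * P.ν))) (Real.sqrt (K / (e * P.α))),
    le_max_of_le_left (Real.sqrt_nonneg _), ?_⟩
  intro p u θ hθ hu h1 h2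
  have huc : Continuous u := continuous_iff_continuousAt.mpr fun t => (hu t).continuousAt
  have hp : ‖p‖ ^ 2 = ‖P.ι (u 0)‖ ^ 2 + ∫ t in (0 : ℝ)..T, ‖P.S (θ t) + P.A (u t)‖ ^ 2 := by
    rw [WithLp.prod_norm_sq_eq_of_L2, h1, intervalIntegral.integral_of_le hT.le,
      integral_Ioc_eq_integral_Ioo]
    congr 1
    rw [← real_inner_self_eq_norm_sq, L2.inner_def]
    refine integral_congr_ae ?_
    filter_upwards [h2] with t ht
    rw [ht, real_inner_self_eq_norm_sq]
  have hS0 : inner ℝ (P.S (u 0)) (u 0) ≤ ‖P.m‖ * ‖P.ι (u 0)‖ ^ 2 := by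
    rw [P.inner_S]
    calc _ ≤ ‖P.m (P.ι (u 0))‖ * ‖P.ι (u 0)‖ := real_inner_le_norm _ _
      _ ≤ (‖P.m‖ * ‖P.ι (u 0)‖) * ‖P.ι (u 0)‖ := by gcongr; exact P.m.le_opNorm _
      _ = _ := by ring
  have hI : 0 ≤ ∫ t in (0 : ℝ)..T, ‖P.S (θ t) + P.A (u t)‖ ^ 2 :=
    intervalIntegral.integral_nonneg hT.le fun _ _ => sq_nonneg _
  have hrhs : inner ℝ (P.S (u 0)) (u 0)
      + P.α⁻¹ * ∫ t in (0 : ℝ)..T, ‖P.S (θ t) + P.A (u t)‖ ^ 2 ≤ K * ‖p‖ ^ 2 := by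
    rw [hp, hK]
    have := mul_nonneg (norm_nonneg P.m) hI
    have := mul_nonneg (inv_pos.mpr hα).le (sq_nonneg ‖P.ι (u 0)‖)
    linarith
  have hen : ∀ t ∈ Icc 0 T, _ := fun t ht =>
    (energy_inequality P.S_symm P.α_pos P.lam_nonneg P.S_nonneg P.garding_S hθ hu ht).trans hrhs
  constructor
  · intro t ht
    refine (hle P.ν _ ‖p‖ hν (norm_nonneg _) (norm_nonneg _) ((le_trans ?_ (hen t ht)))).trans
      (mul_le_mul_of_nonneg_right (le_max_left _ _) (norm_nonneg _))
    refine mul_le_mul_of_nonneg_left ?_ he0.le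
    have h3 : 0 ≤ ∫ s in (0 : ℝ)..t, ‖u s‖ ^ 2 :=
      intervalIntegral.integral_nonneg ht.1 fun _ _ => sq_nonneg _
    have h4 := P.m_coercive (P.ι (u t))
    rw [P.inner_S]
    nlinarith [mul_nonneg hα.le h3]
  · intro hm
    refine (hle P.α _ ‖p‖ hα (norm_nonneg _) (norm_nonneg _)
      ((le_trans ?_ (hen T ⟨hT.le, le_rfl⟩)))).trans
      (mul_le_mul_of_nonneg_right (le_max_right _ _) (norm_nonneg _))
    refine mul_le_mul_of_nonneg_left ?_ he0.le
    rw [norm_sq_toLp, intervalIntegral.integral_of_le hT.le, integral_Ioc_eq_integral_Ioo]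
    linarith [P.S_nonneg (u T)]

/-- The equation `(S u)' + A u = F` in the sense of distributions on `(0,T)`. -/
def IsDistribSolution {T : ℝ} (u F : Lp V 2 (volume.restrict (Ioo 0 T))) : Prop :=
  ∀ η : ℝ → ℝ, ContDiff ℝ ∞ η → HasCompactSupport η → tsupport η ⊆ Ioo 0 T → ∀ v : V,
    ∫ t in Ioo 0 T, deriv η t * inner ℝ (P.S (u t)) v
      = - ∫ t in Ioo 0 T, η t * inner ℝ (F t - P.A (u t)) v

omit [CompleteSpace V] in
theorem integral_mul_inner_eq_inner {T : ℝ} {η : ℝ → ℝ} (hη : Continuous η) (v : V)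
    (f : Lp V 2 (volume.restrict (Ioo 0 T))) :
    ∫ t in Ioo 0 T, η t * inner ℝ (f t) v = inner ℝ f
      ((memLp_of_continuous_Ioo (f := fun t => η t • v) (by fun_prop) T).toLp _) := by
  rw [L2.inner_def]
  refine integral_congr_ae ?_
  filter_upwards [(memLp_of_continuous_Ioo (f := fun t => η t • v) (by fun_prop) T).coeFn_toLp]
    with t ht
  rw [ht, inner_smul_right]

/-- The distributional equation in terms of continuous functionals on `L²(0,T;V)`. -/
theorem isDistribSolution_iff {T : ℝ} (u F : Lp V 2 (volume.restrict (Ioo 0 T))) :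
    P.IsDistribSolution u F ↔ ∀ η : ℝ → ℝ, ContDiff ℝ ∞ η → HasCompactSupport η →
      tsupport η ⊆ Ioo 0 T → ∀ v : V,
      ∫ t in Ioo 0 T, deriv η t * inner ℝ (P.S.compLp u t) v
        = - ∫ t in Ioo 0 T, η t * inner ℝ ((F - P.A.compLp u : Lp V 2 _) t) v := by
  refine forall₄_congr fun η _ _ _ => forall_congr' fun v => ?_
  have e1 : ∫ t in Ioo 0 T, deriv η t * inner ℝ (P.S.compLp u t) v
      = ∫ t in Ioo 0 T, deriv η t * inner ℝ (P.S (u t)) v := by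
    refine integral_congr_ae ?_
    filter_upwards [P.S.coeFn_compLp u] with t ht
    rw [ht]
  have e2 : ∫ t in Ioo 0 T, η t * inner ℝ ((F - P.A.compLp u : Lp V 2 _) t) v
      = ∫ t in Ioo 0 T, η t * inner ℝ (F t - P.A (u t)) v := by
    refine integral_congr_ae ?_
    filter_upwards [P.A.coeFn_compLp u, Lp.coeFn_sub F (P.A.compLp u)] with t ht ht'
    rw [ht', Pi.sub_apply, ht]
  rw [e1, e2]

theorem isDistribSolution_of_tendsto {T : ℝ} {u F : ℕ → Lp V 2 (volume.restrict (Ioo 0 T))}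
    {u₀ F₀ : Lp V 2 (volume.restrict (Ioo 0 T))} (h : ∀ n, P.IsDistribSolution (u n) (F n))
    (hu : Tendsto u atTop (𝓝 u₀)) (hF : Tendsto F atTop (𝓝 F₀)) : P.IsDistribSolution u₀ F₀ := by
  rw [isDistribSolution_iff]
  intro η hη hc hs v
  have hSu : Tendsto (fun n => P.S.compLp (u n)) atTop (𝓝 (P.S.compLp u₀)) :=
    ((P.S.compLpL 2 (volume.restrict (Ioo 0 T))).continuous.tendsto u₀).comp hu
  have hAu : Tendsto (fun n => P.A.compLp (u n)) atTop (𝓝 (P.A.compLp u₀)) :=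
    ((P.A.compLpL 2 (volume.restrict (Ioo 0 T))).continuous.tendsto u₀).comp hu
  have hn := fun n => (P.isDistribSolution_iff (u n) (F n)).mp (h n) η hη hc hs v
  simp_rw [integral_mul_inner_eq_inner (hη.continuous_deriv (by simp)) v,
    integral_mul_inner_eq_inner hη.continuous v] at hn ⊢
  refine tendsto_nhds_unique (hSu.inner tendsto_const_nhds) ?_
  simp_rw [hn]
  exact ((hF.sub hAu).inner tendsto_const_nhds).neg

theorem isDistribSolution_of_classical {T : ℝ} (hT : 0 < T)
    {F : Lp V 2 (volume.restrict (Ioo 0 T))} {u θ : ℝ → V} (hθ : Continuous θ)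
    (hu : ∀ t, HasDerivAt u (θ t) t) (hm : MemLp u 2 (volume.restrict (Ioo 0 T)))
    (hF : F =ᵐ[volume.restrict (Ioo 0 T)] fun t => P.S (θ t) + P.A (u t)) :
    P.IsDistribSolution (hm.toLp u) F := by
  intro η hη _ hs v
  have huc : Continuous u := continuous_iff_continuousAt.mpr fun t => (hu t).continuousAt
  have hd := hη.continuous_deriv (by simp)
  have hηc := hη.continuous
  have hη0 : ∀ t, t ∉ Ioo 0 T → η t = 0 := fun t ht =>
    image_eq_zero_of_notMem_tsupport fun h => ht (hs h)
  have h := intervalIntegral.integral_deriv_mul_eq_sub (a := 0) (b := T)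
    (u := η) (u' := deriv η) (v := fun t => inner ℝ (P.S (u t)) v)
    (v' := fun t => inner ℝ (P.S (θ t)) v)
    (fun t _ => ((hη.differentiable (by simp)) t).hasDerivAt)
    (fun t _ => by
      have := (P.S.hasFDerivAt.comp_hasDerivAt t (hu t)).inner ℝ (hasDerivAt_const t v)
      simpa using this)
    (hd.intervalIntegrable _ _)
    ((by fun_prop : Continuous fun t => inner ℝ (P.S (θ t)) v).intervalIntegrable _ _)
  rw [hη0 T (by simp), hη0 0 (by simp), zero_mul, zero_mul, sub_zero,
    intervalIntegral.integral_of_le hT.le, integral_Ioc_eq_integral_Ioo, integral_add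
    (((by fun_prop : Continuous fun t =>
      deriv η t * inner ℝ (P.S (u t)) v).integrableOn_Icc).mono_set Ioo_subset_Icc_self)
    (((by fun_prop : Continuous fun t => η t * inner ℝ (P.S (θ t)) v).integrableOn_Icc).mono_set
      Ioo_subset_Icc_self)] at h
  have e1 : ∫ t in Ioo 0 T, deriv η t * inner ℝ (P.S (hm.toLp u t)) v
      = ∫ t in Ioo 0 T, deriv η t * inner ℝ (P.S (u t)) v := by
    refine integral_congr_ae ?_
    filter_upwards [hm.coeFn_toLp] with t ht
    rw [ht]
  have e2 : ∫ t in Ioo 0 T, η t * inner ℝ (F t - P.A (hm.toLp u t)) v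
      = ∫ t in Ioo 0 T, η t * inner ℝ (P.S (θ t)) v := by
    refine integral_congr_ae ?_
    filter_upwards [hm.coeFn_toLp, hF] with t ht ht'
    rw [ht, ht', add_sub_cancel_right]
  rw [e1, e2]
  exact eq_neg_of_add_eq_zero_left h

/-- Existence for the abstract problem. Classical functions whose data converge to `(G, F)` form
a Cauchy sequence in `C([0,T];H)` and in `L²(0,T;V)`. -/
theorem exists_distribSolution {T : ℝ} (hT : 0 < T) (G : H)
    (F : Lp V 2 (volume.restrict (Ioo 0 T))) :
    ∃ (u : Lp V 2 (volume.restrict (Ioo 0 T))) (W : ℝ → H), ContinuousOn W (Icc 0 T) ∧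
      (∀ᵐ t ∂(volume.restrict (Ioo 0 T)), W t = P.ι (u t)) ∧ W 0 = G ∧
      P.IsDistribSolution u F := by
  have hmem : WithLp.toLp 2 (G, F) ∈ closure (P.classicalData T : Set (WithLp 2 (H × _))) := by
    rw [← Submodule.topologicalClosure_coe, P.topologicalClosure_classicalData hT]
    trivial
  obtain ⟨x, hx, hlim⟩ := mem_closure_iff_seq_limit.mp hmem
  choose u θ hθ hu h1 h2 using hx
  have huc : ∀ n, Continuous (u n) := fun n =>
    continuous_iff_continuousAt.mpr fun t => (hu n t).continuousAt
  have hm : ∀ n, MemLp (u n) 2 (volume.restrict (Ioo 0 T)) := fun n =>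
    memLp_of_continuous_Ioo (huc n) T
  obtain ⟨C, hC0, hC⟩ := P.energy_bound hT
  have hdiff : ∀ k n, (∀ t ∈ Icc 0 T, ‖P.ι (u k t) - P.ι (u n t)‖ ≤ C * ‖x k - x n‖) ∧
      ‖(hm k).toLp (u k) - (hm n).toLp (u n)‖ ≤ C * ‖x k - x n‖ := by
    intro k n
    have h := hC (x k - x n) (fun t => u k t - u n t) (fun t => θ k t - θ n t)
      ((hθ k).sub (hθ n)) (fun t => (hu k t).sub (hu n t)) (by simp [h1]) ?_
    · refine ⟨fun t ht => by simpa using h.1 t ht, ?_⟩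
      rw [← MemLp.toLp_sub]
      exact h.2 ((hm k).sub (hm n))
    · filter_upwards [h2 k, h2 n, Lp.coeFn_sub (x k).snd (x n).snd] with t a b c
      refine c.trans ?_
      simp only [Pi.sub_apply, a, b, map_sub]; abel
  have hxC : CauchySeq x := hlim.cauchySeq
  have hcau : ∀ ε > 0, ∃ N, ∀ k ≥ N, ∀ n ≥ N, C * ‖x k - x n‖ < ε := by
    intro ε hε
    obtain ⟨N, hN⟩ := Metric.cauchySeq_iff.mp hxC (ε / (C + 1)) (by positivity)
    refine ⟨N, fun k hk n hn => ?_⟩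
    have h3 := hN k hk n hn
    rw [dist_eq_norm, lt_div_iff₀ (by positivity)] at h3
    nlinarith [norm_nonneg (x k - x n)]
  have hcu : CauchySeq fun n => (hm n).toLp (u n) := by
    refine Metric.cauchySeq_iff.mpr fun ε hε => ?_
    obtain ⟨N, hN⟩ := hcau ε hε
    exact ⟨N, fun k hk n hn => by
      rw [dist_eq_norm]; exact (hdiff k n).2.trans_lt (hN k hk n hn)⟩
  obtain ⟨uu, huu⟩ := cauchySeq_tendsto_of_complete hcu
  have hunif : UniformCauchySeqOn (fun n t => P.ι (u n t)) atTop (Icc 0 T) := by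
    refine Metric.uniformCauchySeqOn_iff.mpr fun ε hε => ?_
    obtain ⟨N, hN⟩ := hcau ε hε
    exact ⟨N, fun k hk n hn t ht => by
      rw [dist_eq_norm]; exact ((hdiff k n).1 t ht).trans_lt (hN k hk n hn)⟩
  have hex : ∀ t, ∃ w, t ∈ Icc 0 T → Tendsto (fun n => P.ι (u n t)) atTop (𝓝 w) := by
    intro t
    by_cases ht : t ∈ Icc 0 T
    · obtain ⟨w, hw⟩ := cauchySeq_tendsto_of_complete (hunif.cauchySeq ht)
      exact ⟨w, fun _ => hw⟩
    · exact ⟨0, fun h => absurd h ht⟩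
  choose W hW using hex
  have hWu := hunif.tendstoUniformlyOn_of_tendsto hW
  refine ⟨uu, W, hWu.continuousOn (Frequently.of_forall fun n =>
    (P.ι.continuous.comp (huc n)).continuousOn), ?_, ?_, ?_⟩
  · obtain ⟨ns, hns, hae⟩ := (tendstoInMeasure_of_tendsto_Lp huu).exists_seq_tendsto_ae
    have hall : ∀ᵐ t ∂(volume.restrict (Ioo 0 T)), ∀ n, (hm n).toLp (u n) t = u n t :=
      ae_all_iff.mpr fun n => (hm n).coeFn_toLp
    filter_upwards [hae, hall, ae_restrict_mem measurableSet_Ioo] with t ht hn htI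
    simp only [hn] at ht
    exact tendsto_nhds_unique ((hW t (Ioo_subset_Icc_self htI)).comp hns.tendsto_atTop)
      ((P.ι.continuous.tendsto _).comp ht)
  · have h3 : Tendsto (fun n => (x n).fst) atTop (𝓝 G) :=
      ((WithLp.prod_continuous_ofLp 2 H _).fst.tendsto _).comp hlim
    simp only [h1] at h3
    exact tendsto_nhds_unique (hW 0 ⟨le_rfl, hT.le⟩) h3
  · have h4 : Tendsto (fun n => (x n).snd) atTop (𝓝 F) :=
      ((WithLp.prod_continuous_ofLp 2 H _).snd.tendsto _).comp hlim
    exact P.isDistribSolution_of_tendsto (fun n =>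
      P.isDistribSolution_of_classical hT (hθ n) (hu n) (hm n) (h2 n)) huu h4

/-- Uniqueness for the abstract problem. The primitive `U = ∫_0^t u` satisfies
`(S U)' + A U = 0` pointwise. -/
theorem eq_zero_of_isDistribSolution {T : ℝ} (hT : 0 < T)
    {u : Lp V 2 (volume.restrict (Ioo 0 T))} (h : P.IsDistribSolution u 0) {W : ℝ → H}
    (hWc : ContinuousOn W (Icc 0 T))
    (hWu : ∀ᵐ t ∂(volume.restrict (Ioo 0 T)), W t = P.ι (u t)) (hW0 : W 0 = 0) : u = 0 := by
  have hui : IntegrableOn u (Ioo 0 T) := integrableOn_of_Lp u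
  have huii : IntegrableOn u (Icc 0 T) := (integrableOn_Icc_iff_integrableOn_Ioo).mpr hui
  set U : ℝ → V := fun t => ∫ s in (0 : ℝ)..t, u s with hU
  have hUc : ContinuousOn U (Icc 0 T) := by
    have := intervalIntegral.continuousOn_primitive_interval (μ := volume) (f := u)
      (a := 0) (b := T) (by rwa [uIcc_of_le hT.le])
    rwa [uIcc_of_le hT.le] at this
  set R : H →L[ℝ] V := (ContinuousLinearMap.adjoint P.ι) ∘L P.m with hR
  have hRW : ContinuousOn (fun t => R (W t)) (Icc 0 T) := R.continuous.comp_continuousOn hWc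
  have hAU : ContinuousOn (fun t => P.A (U t)) (Icc 0 T) := P.A.continuous.comp_continuousOn hUc
  have hRu : ∀ᵐ t ∂(volume.restrict (Ioo 0 T)), R (W t) = P.S (u t) := by
    filter_upwards [hWu] with t ht
    rw [ht]; rfl
  have hconst := eqOn_const_of_integral_deriv_smul_eq_zero hT (hRW.add hAU) (fun η hη hc hs => by
    have hd := hη.continuous_deriv (by simp)
    have hdI : IntegrableOn (deriv η) (Ioo 0 T) :=
      hd.integrableOn_Icc.mono_set Ioo_subset_Icc_self
    have k1 : IntegrableOn (fun t => deriv η t • R (W t)) (Ioo 0 T) :=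
      (hd.continuousOn.smul hRW).integrableOn_Icc.mono_set Ioo_subset_Icc_self
    have k2 : IntegrableOn (fun t => deriv η t • U t) (Ioo 0 T) :=
      (hd.continuousOn.smul hUc).integrableOn_Icc.mono_set Ioo_subset_Icc_self
    have k3 : IntegrableOn (fun t => η t • u t) (Ioo 0 T) :=
      (huii.continuousOn_smul hη.continuous.continuousOn isCompact_Icc).mono_set
        Ioo_subset_Icc_self
    have e1 : ∫ t in Ioo 0 T, deriv η t • (R (W t) + P.A (U t))
        = (∫ t in Ioo 0 T, deriv η t • R (W t)) - P.A (∫ t in Ioo 0 T, η t • u t) := by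
      rw [sub_eq_add_neg, ← map_neg, ← integral_deriv_smul_primitive hT hη hs hui,
        ← P.A.integral_comp_comm k2, ← integral_add k1 (P.A.integrable_comp k2)]
      simp only [map_smul, smul_add]
    refine Eq.trans e1 ?_
    refine ext_inner_left ℝ fun v => ?_
    have h1 := h η hη hc hs v
    have e2 : ∫ t in Ioo 0 T, η t * inner ℝ ((0 : Lp V 2 (volume.restrict (Ioo 0 T))) t
        - P.A (u t)) v = - ∫ t in Ioo 0 T, inner ℝ v (P.A (η t • u t)) := by
      rw [← integral_neg]
      refine integral_congr_ae ?_
      filter_upwards [Lp.coeFn_zero V 2 (volume.restrict (Ioo 0 T))] with t ht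
      rw [ht]
      simp [inner_smul_right, real_inner_comm]
    rw [e2, neg_neg] at h1
    rw [inner_zero_right, inner_sub_right, ← integral_inner k1, ← P.A.integral_comp_comm k3,
      ← integral_inner (P.A.integrable_comp k3), ← h1, sub_eq_zero]
    refine integral_congr_ae ?_
    filter_upwards [hRu] with t ht
    rw [ht, inner_smul_right, real_inner_comm])
  have hRA : ∀ t ∈ Icc 0 T, R (W t) = - P.A (U t) := by
    intro t ht
    have hUz : U 0 = 0 := intervalIntegral.integral_same
    have : R (W t) + P.A (U t) = R (W 0) + P.A (U 0) := hconst ht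
    rw [hW0, hUz, map_zero, map_zero, zero_add] at this
    exact eq_neg_of_add_eq_zero_left this
  have hSU : ∀ t ∈ Ioo 0 T, P.S (U t) = ∫ s in (0 : ℝ)..t, R (W s) := by
    intro t ht
    have hi : IntervalIntegrable u volume 0 t := by
      rw [intervalIntegrable_iff, uIoc_of_le ht.1.le]
      exact huii.mono_set fun x hx => ⟨hx.1.le, hx.2.trans ht.2.le⟩
    simp only [hU]
    rw [← P.S.intervalIntegral_comp_comm hi, intervalIntegral.integral_of_le ht.1.le,
      intervalIntegral.integral_of_le ht.1.le, integral_Ioc_eq_integral_Ioo,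
      integral_Ioc_eq_integral_Ioo]
    refine integral_congr_ae ?_
    filter_upwards [ae_restrict_of_ae_restrict_of_subset
      (Ioo_subset_Ioo_right ht.2.le) hRu] with s hs using hs.symm
  have hU0 := eq_zero_of_hasDerivAt_symm P.S_symm P.S_nonneg P.α_pos P.garding_S hUc
    (by simp [hU]) (T := T) (fun t ht => by
      have h1 : HasDerivAt (fun s => ∫ r in (0 : ℝ)..s, R (W r)) (R (W t)) t := by
        refine intervalIntegral.integral_hasDerivAt_right ?_ ?_ ?_
        · refine (hRW.mono ?_).intervalIntegrable
          exact uIcc_subset_Icc ⟨le_rfl, hT.le⟩ (Ioo_subset_Icc_self ht)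
        · exact (hRW.mono Ioo_subset_Icc_self).stronglyMeasurableAtFilter isOpen_Ioo _ ht
        · exact hRW.continuousAt (Icc_mem_nhds ht.1 ht.2)
      rw [hRA t (Ioo_subset_Icc_self ht)] at h1
      refine h1.congr_of_eventuallyEq ?_
      filter_upwards [Ioo_mem_nhds ht.1 ht.2] with s hs using hSU s hs)
  have hu0 : ∀ᵐ t ∂(volume.restrict (Ioo 0 T)), u t = 0 := by
    refine ae_eq_zero_of_forall_test hui fun η hη hc hs => ?_
    have := integral_deriv_smul_primitive hT hη hs hui
    rw [setIntegral_eq_zero_of_forall_eq_zero fun t ht => by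
      have := hU0 t ht
      simp only [hU] at this
      rw [this, smul_zero]] at this
    exact neg_eq_zero.mp this.symm
  refine Lp.ext ?_
  filter_upwards [hu0, Lp.coeFn_zero V 2 (volume.restrict (Ioo 0 T))] with t h1 h2
  exact h1.trans h2.symm

end ParabolicOperator


/-! ### Periodic functions -/

section Periodic

variable {d : ℕ}

/-- The standard basis of `ℝ^d`. -/
noncomputable def stdBasis (d : ℕ) : Module.Basis (Fin d) ℝ (E d) :=
  (EuclideanSpace.basisFun (Fin d) ℝ).toBasis

theorem stdBasis_repr (y : E d) (i : Fin d) : (stdBasis d).repr y i = y i := by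
  simp [stdBasis]

theorem stdBasis_apply (i : Fin d) : stdBasis d i = EuclideanSpace.single i 1 := by
  simp [stdBasis]

theorem unitCube_eq : unitCube d = ZSpan.fundamentalDomain (stdBasis d) := by
  ext y
  simp only [unitCube, ZSpan.mem_fundamentalDomain, stdBasis_repr]
  rfl

theorem measurableSet_unitCube : MeasurableSet (unitCube d) := by
  rw [unitCube_eq]; exact ZSpan.fundamentalDomain_measurableSet _

theorem isBounded_unitCube : Bornology.IsBounded (unitCube d) := by
  rw [unitCube_eq]; exact ZSpan.fundamentalDomain_isBounded _

theorem volume_unitCube : volume (unitCube d) = 1 := by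
  have h := (EuclideanSpace.volume_preserving_symm_measurableEquiv_toLp (Fin d)).measure_preimage
    (MeasurableSet.univ_pi fun _ : Fin d =>
      (measurableSet_Ico (a := (0 : ℝ)) (b := 1))).nullMeasurableSet
  rw [Real.volume_pi_Ico] at h
  simp only [sub_zero, ENNReal.ofReal_one, Finset.prod_const_one] at h
  rw [← h]
  congr 1
  ext y
  simp [unitCube]

instance isProbabilityMeasure_unitCube :
    IsProbabilityMeasure (volume.restrict (unitCube d)) :=
  ⟨by rw [Measure.restrict_apply_univ, volume_unitCube]⟩

/-- The lattice `ℤ^d`. -/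
abbrev intLattice (d : ℕ) : AddSubgroup (E d) :=
  (Submodule.span ℤ (Set.range (stdBasis d))).toAddSubgroup

instance countable_intLattice : Countable (intLattice d) :=
  inferInstanceAs (Countable (Submodule.span ℤ (Set.range (stdBasis d))))

theorem isAddFundamentalDomain_vadd_unitCube (h : E d) :
    IsAddFundamentalDomain (intLattice d) (h +ᵥ unitCube d) (volume : Measure (E d)) := by
  rw [unitCube_eq]
  exact (ZSpan.isAddFundamentalDomain' (stdBasis d) volume).vadd_of_comm h

theorem isAddFundamentalDomain_unitCube :
    IsAddFundamentalDomain (intLattice d) (unitCube d) (volume : Measure (E d)) := by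
  rw [unitCube_eq]
  exact ZSpan.isAddFundamentalDomain' (stdBasis d) volume

theorem IsPeriodic.vadd_lattice {F : Type*} {f : E d → F} (hf : IsPeriodic f) (z : intLattice d)
    (y : E d) : f (z +ᵥ y) = f y := by
  obtain ⟨z, hz⟩ := z
  change f (z + y) = f y
  have hz' : z ∈ Submodule.span ℤ (Set.range (stdBasis d)) := hz
  clear hz
  induction hz' using Submodule.span_induction generalizing y with
  | mem x hx =>
    obtain ⟨i, rfl⟩ := hx
    rw [stdBasis_apply, add_comm]; exact hf i y
  | zero => rw [zero_add]
  | add a b _ _ ha hb => rw [add_assoc, ha, hb]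
  | smul n x _ hx =>
    induction n using Int.induction_on generalizing y with
    | zero => rw [zero_smul, zero_add]
    | succ n ih => rw [add_smul, one_smul, add_assoc, ih, hx]
    | pred n ih =>
      rw [sub_smul, one_smul]
      rw [← hx (_ + y), ← ih y]
      congr 1
      abel

variable {F : Type*} [NormedAddCommGroup F]

theorem add_right_preimage_vadd_unitCube (h : E d) :
    (fun y => y + h) ⁻¹' (h +ᵥ unitCube d) = unitCube d := by
  ext y
  rw [mem_preimage, add_comm]
  exact vadd_mem_vadd_set_iff

theorem IsPeriodic.integrableOn_add {f : E d → F} (hf : IsPeriodic f)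
    (hi : IntegrableOn f (unitCube d)) (h : E d) :
    IntegrableOn (fun y => f (y + h)) (unitCube d) := by
  have h1 : IntegrableOn f (h +ᵥ unitCube d) :=
    ((isAddFundamentalDomain_unitCube.integrableOn_iff (isAddFundamentalDomain_vadd_unitCube h)
      hf.vadd_lattice).mp hi)
  have h2 := ((measurePreserving_add_right (volume : Measure (E d)) h).integrableOn_comp_preimage
    (measurableEmbedding_addRight h) (f := f) (s := h +ᵥ unitCube d)).mpr h1
  rw [add_right_preimage_vadd_unitCube] at h2
  exact h2

/-- The integral of a periodic function over the unit cube is translation invariant. -/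
theorem IsPeriodic.setIntegral_add [NormedSpace ℝ F] {f : E d → F} (hf : IsPeriodic f) (h : E d) :
    ∫ y in unitCube d, f (y + h) = ∫ y in unitCube d, f y := by
  have h1 : ∫ y in unitCube d, f y = ∫ y in h +ᵥ unitCube d, f y :=
    isAddFundamentalDomain_unitCube.setIntegral_eq (isAddFundamentalDomain_vadd_unitCube h)
      hf.vadd_lattice
  have h2 := (measurePreserving_add_right (volume : Measure (E d)) h).setIntegral_preimage_emb
    (measurableEmbedding_addRight h) f (h +ᵥ unitCube d)
  rw [add_right_preimage_vadd_unitCube] at h2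
  rw [h2, h1]

theorem IsPeriodic.locallyIntegrable {f : E d → F} (hf : IsPeriodic f)
    (hi : IntegrableOn f (unitCube d)) : LocallyIntegrable f := by
  intro x
  -- the translate of the unit cube that is centred at `x` is a neighbourhood of `x`
  set h : E d := x - WithLp.toLp 2 (fun _ => (1 / 2 : ℝ)) with hh
  refine ⟨h +ᵥ unitCube d, ?_, (isAddFundamentalDomain_unitCube.integrableOn_iff
    (isAddFundamentalDomain_vadd_unitCube h) hf.vadd_lattice).mp hi⟩
  have hopen : IsOpen {y : E d | ∀ i, y i - h i ∈ Ioo (0 : ℝ) 1} := by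
    simp only [ofPred_forall]
    refine isOpen_iInter_of_finite fun i => ?_
    exact isOpen_Ioo.preimage (by fun_prop)
  refine mem_of_superset (hopen.mem_nhds fun i => ?_) fun y hy => ?_
  · simp only [hh, PiLp.sub_apply]; constructor <;> norm_num
  · rw [mem_vadd_set_iff_neg_vadd_mem]
    intro i
    have := hy i
    simp only [vadd_eq_add, PiLp.add_apply, PiLp.neg_apply]
    constructor <;> linarith [this.1, this.2]

/-- Measurability of the family of translates of `f` by a measurable function `τ`. -/
theorem aestronglyMeasurable_add {f : E d → F} (hf : AEStronglyMeasurable f volume)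
    {S : Type*} [MeasurableSpace S] (ρ : Measure S) [SFinite ρ] {τ : S → E d}
    (hτ : Measurable τ) :
    AEStronglyMeasurable (fun p : S × E d => f (p.2 + τ p.1)) (ρ.prod volume) := by
  have h1 : MeasurePreserving (fun p : S × E d => (p.1, p.2 + τ p.1)) (ρ.prod volume)
      (ρ.prod volume) :=
    (MeasurePreserving.id ρ).skew_product (g := fun s y => y + τ s)
      (measurable_snd.add (hτ.comp measurable_fst))
      (Eventually.of_forall fun s => (measurePreserving_add_right volume (τ s)).map_eq)
  exact hf.comp_quasiMeasurePreserving
    (Measure.quasiMeasurePreserving_snd.comp h1.quasiMeasurePreserving)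

theorem IsPeriodic.integrable_prod_add [NormedSpace ℝ F] {f : E d → F} (hf : IsPeriodic f)
    (hi : IntegrableOn f (unitCube d)) {S : Type*} [MeasurableSpace S] (ρ : Measure S)
    [IsFiniteMeasure ρ] {τ : S → E d} (hτ : Measurable τ) :
    Integrable (fun p : S × E d => f (p.2 + τ p.1)) (ρ.prod (volume.restrict (unitCube d))) := by
  have hm : AEStronglyMeasurable (fun p : S × E d => f (p.2 + τ p.1))
      (ρ.prod (volume.restrict (unitCube d))) := by
    refine (aestronglyMeasurable_add (hf.locallyIntegrable hi).aestronglyMeasurable ρ hτ).mono_ac ?_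
    exact (Measure.AbsolutelyContinuous.refl ρ).prod Measure.restrict_le_self.absolutelyContinuous
  rw [integrable_prod_iff hm]
  refine ⟨Eventually.of_forall fun s => hf.integrableOn_add hi (τ s), ?_⟩
  have hn : IsPeriodic fun y => ‖f y‖ := fun i y => by simp only [hf i y]
  simp only
  simp_rw [fun s => hn.setIntegral_add (τ s)]
  exact integrable_const _

end Periodic

/-! ### Periodic Sobolev functions -/

namespace PeriodicH1

variable {d : ℕ} (ψ : PeriodicH1 d)

theorem integrableOn_fn : IntegrableOn ψ.fn (unitCube d) := ψ.memLp_fn.integrable (by norm_num)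

theorem integrableOn_grad : IntegrableOn ψ.grad (unitCube d) :=
  ψ.memLp_grad.integrable (by norm_num)

theorem locallyIntegrable_fn : LocallyIntegrable ψ.fn :=
  ψ.periodic_fn.locallyIntegrable ψ.integrableOn_fn

theorem periodic_inner (h : E d) : IsPeriodic fun y => inner ℝ (ψ.grad y) h := fun i y => by
  simp only [ψ.periodic_grad i y]

theorem integrableOn_inner (h : E d) :
    IntegrableOn (fun y => inner ℝ (ψ.grad y) h) (unitCube d) :=
  ψ.integrableOn_grad.inner_const h

theorem locallyIntegrable_inner (h : E d) : LocallyIntegrable fun y => inner ℝ (ψ.grad y) h :=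
  (ψ.periodic_inner h).locallyIntegrable (ψ.integrableOn_inner h)

/-- The defining property of the weak gradient for an arbitrary direction. -/
theorem weak_grad_direction {φ : E d → ℝ} (hφ : ContDiff ℝ ∞ φ) (hc : HasCompactSupport φ)
    (h : E d) :
    ∫ y, ψ.fn y * fderiv ℝ φ y h = - ∫ y, inner ℝ (ψ.grad y) h * φ y := by
  have hh : h = ∑ i, h i • EuclideanSpace.single i (1 : ℝ) := by
    have := (EuclideanSpace.basisFun (Fin d) ℝ).sum_repr h
    simpa using this.symm
  have e1 : ∀ y, ψ.fn y * fderiv ℝ φ y h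
      = ∑ i, h i * (ψ.fn y * fderiv ℝ φ y (EuclideanSpace.single i 1)) := by
    intro y
    conv_lhs => rw [hh, map_sum, Finset.mul_sum]
    refine Finset.sum_congr rfl fun i _ => ?_
    rw [map_smul, smul_eq_mul]; ring
  have e2 : ∀ y, inner ℝ (ψ.grad y) h * φ y = ∑ i, h i * (ψ.grad y i * φ y) := by
    intro y
    conv_lhs => rw [hh, inner_sum, Finset.sum_mul]
    refine Finset.sum_congr rfl fun i _ => ?_
    rw [inner_smul_right, EuclideanSpace.inner_single_right]
    simp [mul_assoc]
  have hg : ∀ i, LocallyIntegrable fun y => ψ.grad y i := fun i => by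
    have := ψ.locallyIntegrable_inner (EuclideanSpace.single i 1)
    simpa [EuclideanSpace.inner_single_right] using this
  have hcd : ∀ v, HasCompactSupport fun y => fderiv ℝ φ y v := fun v =>
    hc.fderiv_apply (𝕜 := ℝ) v
  have hdc : ∀ v, Continuous fun y => fderiv ℝ φ y v := fun v =>
    (hφ.continuous_fderiv (by simp)).clm_apply continuous_const
  simp_rw [e1, e2]
  rw [integral_finsetSum, integral_finsetSum, ← Finset.sum_neg_distrib]
  · refine Finset.sum_congr rfl fun i _ => ?_
    rw [integral_const_mul, integral_const_mul, ψ.weak_grad φ hφ hc i, mul_neg]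
  · intro i _
    exact ((hg i).integrable_smul_right_of_hasCompactSupport hφ.continuous hc).const_mul _
  · intro i _
    exact ((ψ.locallyIntegrable_fn).integrable_smul_right_of_hasCompactSupport (hdc _)
      (hcd _)).const_mul _

end PeriodicH1

theorem integrable_shift_mul {d : ℕ} {f g : E d → ℝ} (hf : LocallyIntegrable f)
    (hg : Continuous g) (hc : HasCompactSupport g) (h : E d) :
    Integrable (fun p : ℝ × E d => g (p.2 - p.1 • h) * f p.2)
      ((volume.restrict (Ioc (0 : ℝ) 1)).prod volume) := by
  -- on `[0,1]` all the translates of `g` are supported in one compact set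
  set B : Set (E d) := (fun p : ℝ × E d => p.2 + p.1 • h) '' (Icc (0 : ℝ) 1 ×ˢ tsupport g) with hB
  have hBc : IsCompact B := (isCompact_Icc.prod hc.isCompact).image (by fun_prop)
  obtain ⟨K, hK⟩ := hc.exists_bound_of_continuous hg
  have h1 : Integrable (fun p : ℝ × E d => (1 : ℝ) * B.indicator f p.2)
      ((volume.restrict (Ioc (0 : ℝ) 1)).prod volume) :=
    (integrable_const (1 : ℝ)).mul_prod
      ((integrable_indicator_iff hBc.measurableSet).mpr (hf.integrableOn_isCompact hBc))
  have h2 := h1.bdd_mul (f := fun p : ℝ × E d => g (p.2 - p.1 • h)) (c := K)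
    (by fun_prop : Continuous fun p : ℝ × E d => g (p.2 - p.1 • h)).aestronglyMeasurable
    (Eventually.of_forall fun p => hK _)
  refine h2.congr ?_
  have hae : ∀ᵐ p ∂((volume.restrict (Ioc (0 : ℝ) 1)).prod (volume : Measure (E d))),
      p.1 ∈ Ioc (0 : ℝ) 1 :=
    Measure.quasiMeasurePreserving_fst.ae (ae_restrict_mem measurableSet_Ioc)
  filter_upwards [hae] with p hp
  rw [one_mul]
  by_cases hpB : p.2 ∈ B
  · rw [indicator_of_mem hpB]
  · have hg0 : g (p.2 - p.1 • h) = 0 := image_eq_zero_of_notMem_tsupport fun hh =>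
      hpB ⟨(p.1, p.2 - p.1 • h), ⟨Ioc_subset_Icc_self hp, hh⟩, by simp⟩
    rw [indicator_of_notMem hpB, hg0, zero_mul, zero_mul]

theorem integrable_mul_shift {d : ℕ} {f g : E d → ℝ} (hf : LocallyIntegrable f)
    (hg : Continuous g) (hc : HasCompactSupport g) (h : E d) :
    Integrable (fun p : ℝ × E d => g p.2 * f (p.2 + p.1 • h))
      ((volume.restrict (Ioc (0 : ℝ) 1)).prod volume) := by
  have hmp : MeasurePreserving (fun p : ℝ × E d => (p.1, p.2 + p.1 • h))
      ((volume.restrict (Ioc (0 : ℝ) 1)).prod volume)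
      ((volume.restrict (Ioc (0 : ℝ) 1)).prod volume) :=
    (MeasurePreserving.id _).skew_product (g := fun (s : ℝ) (y : E d) => y + s • h)
      (by fun_prop)
      (Eventually.of_forall fun s => (measurePreserving_add_right volume (s • h)).map_eq)
  have := hmp.integrable_comp_of_integrable (integrable_shift_mul hf hg hc h)
  refine this.congr (Eventually.of_forall fun p => ?_)
  simp

theorem integral_fderiv_shift {d : ℕ} {g : E d → ℝ} (hg : ContDiff ℝ ∞ g) (h y : E d) :
    g (y - h) - g y = - ∫ s in Ioc (0 : ℝ) 1, fderiv ℝ g (y - s • h) h := by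
  have hdc : Continuous fun y => fderiv ℝ g y h :=
    (hg.continuous_fderiv (by simp)).clm_apply continuous_const
  have hd : ∀ s : ℝ, HasDerivAt (fun s : ℝ => g (y - s • h)) (- fderiv ℝ g (y - s • h) h) s := by
    intro s
    have h1 : HasDerivAt (fun s : ℝ => y - s • h) (-h) s := by
      simpa using ((hasDerivAt_id s).smul_const h).const_sub y
    have h2 := (hg.differentiable (by simp) (y - s • h)).hasFDerivAt.comp_hasDerivAt s h1
    simpa [Function.comp_def] using h2
  have h3 := intervalIntegral.integral_eq_sub_of_hasDerivAt (a := 0) (b := 1) (fun s _ => hd s)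
    ((by fun_prop : Continuous fun s : ℝ => - fderiv ℝ g (y - s • h) h).intervalIntegrable _ _)
  rw [intervalIntegral.integral_of_le zero_le_one, integral_neg] at h3
  rw [h3]; simp

/-- The fundamental theorem of calculus for a Sobolev function along translations, tested with a
smooth function. -/
theorem PeriodicH1.integral_mul_sub {d : ℕ} (ψ : PeriodicH1 d) (h : E d) {g : E d → ℝ}
    (hg : ContDiff ℝ ∞ g) (hc : HasCompactSupport g) :
    ∫ y, (g (y - h) - g y) * ψ.fn y
      = ∫ y, g y * ∫ s in Ioc (0 : ℝ) 1, inner ℝ (ψ.grad (y + s • h)) h := by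
  have hfl := ψ.locallyIntegrable_inner h
  have hdc : Continuous fun y => fderiv ℝ g y h :=
    (hg.continuous_fderiv (by simp)).clm_apply continuous_const
  have s1 := integral_integral_swap (f := fun s y => fderiv ℝ g (y - s • h) h * ψ.fn y)
    (integrable_shift_mul ψ.locallyIntegrable_fn hdc (hc.fderiv_apply (𝕜 := ℝ) h) h)
  have s2 := integral_integral_swap (f := fun s y => g y * inner ℝ (ψ.grad (y + s • h)) h)
    (integrable_mul_shift hfl hg.continuous hc h)
  have e1 : ∫ y, (g (y - h) - g y) * ψ.fn y
      = - ∫ y, ∫ s in Ioc (0 : ℝ) 1, fderiv ℝ g (y - s • h) h * ψ.fn y := by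
    rw [← integral_neg]
    congr 1; ext y
    rw [integral_fderiv_shift hg h y, neg_mul, integral_mul_const]
  have e2 : ∫ y, g y * ∫ s in Ioc (0 : ℝ) 1, inner ℝ (ψ.grad (y + s • h)) h
      = ∫ y, ∫ s in Ioc (0 : ℝ) 1, g y * inner ℝ (ψ.grad (y + s • h)) h := by
    congr 1; ext y
    rw [integral_const_mul]
  rw [e1, e2, ← s1, ← s2, ← integral_neg]
  refine integral_congr_ae (Eventually.of_forall fun s => ?_)
  have hgs : ContDiff ℝ ∞ fun y => g (y - s • h) := hg.comp (contDiff_id.sub contDiff_const)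
  have hgc : HasCompactSupport fun y => g (y - s • h) :=
    hc.comp_homeomorph (Homeomorph.subRight (s • h))
  have w := ψ.weak_grad_direction hgs hgc h
  simp_rw [fderiv_comp_sub (𝕜 := ℝ) (f := g)] at w
  have e3 : ∫ y, g y * inner ℝ (ψ.grad (y + s • h)) h
      = ∫ y, g (y - s • h) * inner ℝ (ψ.grad y) h := by
    rw [← integral_add_right_eq_self (fun y => g (y - s • h) * inner ℝ (ψ.grad y) h) (s • h)]
    simp
  refine Eq.trans ?_ e3.symm
  simp_rw [mul_comm (fderiv ℝ g _ h), w, neg_neg, mul_comm]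

/-- The fundamental theorem of calculus for a Sobolev function along translations. -/
theorem PeriodicH1.ae_sub_eq_integral {d : ℕ} (ψ : PeriodicH1 d) (h : E d) :
    ∀ᵐ y, ψ.fn (y + h) - ψ.fn y
      = ∫ s in Ioc (0 : ℝ) 1, inner ℝ (ψ.grad (y + s • h)) h := by
  have hτ : Measurable fun s : ℝ => s • h := by fun_prop
  have hIp : IsPeriodic fun y => ∫ s in Ioc (0 : ℝ) 1, inner ℝ (ψ.grad (y + s • h)) h := by
    intro i y
    refine integral_congr_ae (Eventually.of_forall fun s => ?_)
    simp only
    rw [add_right_comm, ψ.periodic_grad i]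
  have hIi : IntegrableOn (fun y => ∫ s in Ioc (0 : ℝ) 1, inner ℝ (ψ.grad (y + s • h)) h)
      (unitCube d) :=
    ((ψ.periodic_inner h).integrable_prod_add (ψ.integrableOn_inner h)
      (volume.restrict (Ioc (0 : ℝ) 1)) hτ).integral_prod_right
  have hIl := hIp.locallyIntegrable hIi
  have hsp : IsPeriodic fun y => ψ.fn (y + h) := fun i y => by
    simp only [add_right_comm y, ψ.periodic_fn i]
  have hsl := hsp.locallyIntegrable (ψ.periodic_fn.integrableOn_add ψ.integrableOn_fn h)
  have key : ∀ᵐ y, ψ.fn (y + h) - ψ.fn y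
      - ∫ s in Ioc (0 : ℝ) 1, inner ℝ (ψ.grad (y + s • h)) h = 0 := by
    refine ae_eq_zero_of_integral_contDiff_smul_eq_zero
      ((hsl.sub ψ.locallyIntegrable_fn).sub hIl) fun g hg hc => ?_
    have i1 := hsl.integrable_smul_left_of_hasCompactSupport hg.continuous hc
    have i2 := ψ.locallyIntegrable_fn.integrable_smul_left_of_hasCompactSupport hg.continuous hc
    have i3 := hIl.integrable_smul_left_of_hasCompactSupport hg.continuous hc
    have i4 : Integrable fun y => g (y - h) • ψ.fn y :=
      ψ.locallyIntegrable_fn.integrable_smul_left_of_hasCompactSupport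
        (hg.continuous.comp (continuous_id.sub continuous_const))
        (hc.comp_homeomorph (Homeomorph.subRight h))
    have e1 : ∫ y, g y • ψ.fn (y + h) = ∫ y, g (y - h) • ψ.fn y := by
      rw [← integral_add_right_eq_self (fun y => g (y - h) • ψ.fn y) h]
      simp
    have e2 := ψ.integral_mul_sub h hg hc
    simp_rw [sub_mul, ← smul_eq_mul (g _)] at e2
    rw [integral_sub i4 i2] at e2
    simp only [smul_sub]
    have i5 : Integrable fun y => g y • ψ.fn (y + h) - g y • ψ.fn y := i1.sub i2
    rw [integral_sub i5 i3, integral_sub i1 i2, e1, sub_eq_zero]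
    exact e2
  filter_upwards [key] with y hy using sub_eq_zero.mp hy

/-- The weak gradient of a periodic function has mean zero. -/
theorem PeriodicH1.setIntegral_grad_apply {d : ℕ} (ψ : PeriodicH1 d) (i : Fin d) :
    ∫ y in unitCube d, ψ.grad y i = 0 := by
  set h : E d := EuclideanSpace.single i 1 with hh
  have hin : ∀ y, inner ℝ (ψ.grad y) h = ψ.grad y i := fun y => by
    rw [hh, EuclideanSpace.inner_single_right]; simp
  have hτ : Measurable fun s : ℝ => s • h := by fun_prop
  have hint := (ψ.periodic_inner h).integrable_prod_add (ψ.integrableOn_inner h)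
    (volume.restrict (Ioc (0 : ℝ) 1)) hτ
  have hsw := integral_integral_swap (f := fun s y => inner ℝ (ψ.grad (y + s • h)) h) hint
  simp_rw [fun s : ℝ => (ψ.periodic_inner h).setIntegral_add (s • h)] at hsw
  have h0 : ∫ y in unitCube d, ∫ s in Ioc (0 : ℝ) 1, inner ℝ (ψ.grad (y + s • h)) h = 0 := by
    refine integral_eq_zero_of_ae ?_
    filter_upwards [ae_restrict_of_ae (ψ.ae_sub_eq_integral h)] with y hy
    rw [← hy, hh, ψ.periodic_fn i y, sub_self]; rfl
  rw [h0] at hsw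
  simpa [hin] using hsw

/-- A Poincaré inequality: a mean-zero weight on the unit cube integrates a periodic Sobolev
function to at most a multiple of the norm of its gradient. -/
theorem exists_poincare_const (d : ℕ) : ∃ D : ℝ, 0 ≤ D ∧ ∀ (ψ : PeriodicH1 d) (R : E d → ℝ) (K : ℝ),
    AEStronglyMeasurable R (volume.restrict (unitCube d)) → 0 ≤ K →
    (∀ y ∈ unitCube d, |R y| ≤ K) → ∫ y in unitCube d, R y = 0 →
    |∫ y in unitCube d, R y * ψ.fn y| ≤ K * D * ∫ y in unitCube d, ‖ψ.grad y‖ := by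
  obtain ⟨D, hD0, hD⟩ := (isBounded_unitCube (d := d)).exists_pos_norm_le
  refine ⟨D, hD0.le, fun ψ R K hRm hK hR hR0 => ?_⟩
  set μ : Measure (E d) := volume.restrict (unitCube d) with hμ
  have hRb : ∀ᵐ y ∂μ, ‖R y‖ ≤ K := by
    filter_upwards [ae_restrict_mem measurableSet_unitCube] with y hy using hR y hy
  set J : E d → ℝ := fun h => ∫ y, R y * ψ.fn (y + h) ∂μ with hJ
  set G : ℝ := ∫ y in unitCube d, ‖ψ.grad y‖ with hG
  have hn : IsPeriodic fun y => ‖ψ.grad y‖ := fun i y => by simp only [ψ.periodic_grad i y]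
  have hsi : ∀ h, Integrable (fun y => R y * ψ.fn (y + h)) μ := fun h =>
    (ψ.periodic_fn.integrableOn_add ψ.integrableOn_fn h).integrable.bdd_mul hRm hRb
  -- the difference of two translates is controlled by the gradient
  have hdiff : ∀ h ∈ unitCube d, |J h - J 0| ≤ K * D * G := by
    intro h hh
    have hτ : Measurable fun s : ℝ => s • h := by fun_prop
    have hpi := hn.integrable_prod_add ψ.integrableOn_grad.norm
      (volume.restrict (Ioc (0 : ℝ) 1)) hτ
    have hsw := integral_integral_swap (f := fun (s : ℝ) y => ‖ψ.grad (y + s • h)‖) hpi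
    simp_rw [fun s : ℝ => hn.setIntegral_add (s • h)] at hsw
    have e1 : J h - J 0 = ∫ y, R y * (ψ.fn (y + h) - ψ.fn y) ∂μ := by
      have := hsi 0
      simp only [add_zero] at this
      simp only [hJ, add_zero, mul_sub]
      rw [integral_sub (hsi h) this]
    have hpi2 : Integrable (fun y => ∫ s in Ioc (0 : ℝ) 1, ‖ψ.grad (y + s • h)‖) μ :=
      hpi.integral_prod_right
    have hae : ∀ᵐ y ∂μ, Integrable (fun s : ℝ => ‖ψ.grad (y + s • h)‖)
        (volume.restrict (Ioc (0 : ℝ) 1)) := hpi.prod_left_ae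
    rw [e1, ← Real.norm_eq_abs]
    calc ‖∫ y, R y * (ψ.fn (y + h) - ψ.fn y) ∂μ‖
        ≤ ∫ y, K * D * (∫ s in Ioc (0 : ℝ) 1, ‖ψ.grad (y + s • h)‖) ∂μ := by
          refine norm_integral_le_of_norm_le (hpi2.const_mul _) ?_
          filter_upwards [ae_restrict_of_ae (ψ.ae_sub_eq_integral h), hRb, hae] with y h1 h2 h3
          rw [h1, norm_mul, mul_assoc]
          refine mul_le_mul h2 ?_ (norm_nonneg _) hK
          rw [← integral_const_mul]
          refine norm_integral_le_of_norm_le (h3.const_mul D)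
            (Eventually.of_forall fun s : ℝ => ?_)
          rw [mul_comm]
          exact (norm_inner_le_norm _ _).trans
            (mul_le_mul_of_nonneg_left (hD h hh) (norm_nonneg _))
      _ = K * D * G := by
          rw [integral_const_mul, ← hsw]; simp [hG]
  -- the mean over all translates vanishes
  have hpi := ψ.periodic_fn.integrable_prod_add ψ.integrableOn_fn μ (τ := fun h : E d => h)
    measurable_id
  have hpi' : Integrable (fun p : E d × E d => R p.2 * ψ.fn (p.2 + p.1)) (μ.prod μ) := by
    refine hpi.bdd_mul (c := K) (f := fun p : E d × E d => R p.2)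
      (hRm.comp_quasiMeasurePreserving Measure.quasiMeasurePreserving_snd) ?_
    exact Measure.quasiMeasurePreserving_snd.ae hRb
  have hmean : ∫ h, J h ∂μ = 0 := by
    rw [hJ, integral_integral_swap (f := fun h y => R y * ψ.fn (y + h)) hpi']
    simp_rw [integral_const_mul]
    have : ∀ y, ∫ h, ψ.fn (y + h) ∂μ = ∫ h, ψ.fn h ∂μ := fun y => by
      simp_rw [add_comm y]
      exact ψ.periodic_fn.setIntegral_add y
    simp_rw [this, integral_mul_const]
    rw [hR0, zero_mul]
  have hJi : Integrable J μ := hpi'.integral_prod_left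
  have hfin : J 0 = - ∫ h, (J h - J 0) ∂μ := by
    rw [integral_sub hJi (integrable_const _), hmean]; simp
  have hgoal : ∫ y in unitCube d, R y * ψ.fn y = J 0 := by simp [hJ, hμ]
  rw [hgoal, hfin, abs_neg, ← Real.norm_eq_abs]
  refine (norm_integral_le_of_norm_le_const (C := K * D * G) ?_).trans ?_
  · filter_upwards [ae_restrict_mem measurableSet_unitCube] with h hh using hdiff h hh
  · simp


/-! ### Multiplication by bounded functions -/

section Multiplication

variable {X : Type*} [MeasurableSpace X] {μ : Measure X}
  {F : Type*} [NormedAddCommGroup F] [InnerProductSpace ℝ F]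

/-- Multiplication of square integrable functions by essentially bounded ones. -/
noncomputable def mulL (μ : Measure X) (F : Type*) [NormedAddCommGroup F] [InnerProductSpace ℝ F] :
    Lp ℝ ∞ μ →L[ℝ] Lp F 2 μ →L[ℝ] Lp F 2 μ :=
  (ContinuousLinearMap.lsmul ℝ ℝ : ℝ →L[ℝ] F →L[ℝ] F).holderL μ ∞ 2 2

theorem coeFn_mulL {c : X → ℝ} (hc : MemLp c ∞ μ) (f : Lp F 2 μ) :
    mulL μ F (hc.toLp c) f =ᵐ[μ] fun x => c x • f x := by
  have h := (ContinuousLinearMap.lsmul ℝ ℝ : ℝ →L[ℝ] F →L[ℝ] F).coeFn_holder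
    (p := ∞) (q := 2) (r := 2) (hc.toLp c) f
  filter_upwards [h, hc.coeFn_toLp] with x h1 h2
  refine h1.trans ?_
  rw [h2]; rfl

theorem inner_mulL {c : X → ℝ} (hc : MemLp c ∞ μ) (f g : Lp F 2 μ) :
    inner ℝ (mulL μ F (hc.toLp c) f) g = ∫ x, c x * inner ℝ (f x) (g x) ∂μ := by
  rw [L2.inner_def]
  refine integral_congr_ae ?_
  filter_upwards [coeFn_mulL hc f] with x hx
  rw [hx, inner_smul_left]; rfl

theorem mulL_comm {c : X → ℝ} (hc : MemLp c ∞ μ) (f g : Lp F 2 μ) :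
    inner ℝ (mulL μ F (hc.toLp c) f) g = inner ℝ f (mulL μ F (hc.toLp c) g) := by
  rw [inner_mulL, real_inner_comm, inner_mulL]
  simp_rw [real_inner_comm]

theorem le_inner_mulL {c : X → ℝ} (hc : MemLp c ∞ μ) {c₀ : ℝ} (h : ∀ᵐ x ∂μ, c₀ ≤ c x)
    (f : Lp F 2 μ) : c₀ * ‖f‖ ^ 2 ≤ inner ℝ (mulL μ F (hc.toLp c) f) f := by
  have hi := L2.integrable_inner (𝕜 := ℝ) f f
  have hi2 := L2.integrable_inner (𝕜 := ℝ) (mulL μ F (hc.toLp c) f) f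
  rw [← real_inner_self_eq_norm_sq, L2.inner_def, L2.inner_def, ← integral_const_mul]
  refine integral_mono_ae (hi.const_mul _) hi2 ?_
  filter_upwards [h, coeFn_mulL hc f] with x h1 h2
  rw [h2, inner_smul_left]
  exact mul_le_mul_of_nonneg_right h1 real_inner_self_nonneg

theorem norm_mulL_le {c : X → ℝ} (hc : MemLp c ∞ μ) {K : ℝ} (h : ∀ᵐ x ∂μ, |c x| ≤ K)
    (f : Lp F 2 μ) : ‖mulL μ F (hc.toLp c) f‖ ≤ K * ‖f‖ := by
  refine Lp.norm_le_mul_norm_of_ae_le_mul ?_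
  filter_upwards [h, coeFn_mulL hc f] with x h1 h2
  rw [h2, norm_smul]
  exact mul_le_mul_of_nonneg_right h1 (norm_nonneg _)

end Multiplication

/-! ### Two-scale functions -/

section TwoScale

variable {d : ℕ} {Ω : Set (E d)} {f : E d → E d → ℝ}

theorem continuous_slice (hf : ContinuousOn (Function.uncurry f) (closure Ω ×ˢ univ)) {x : E d}
    (hx : x ∈ closure Ω) : Continuous (f x) := by
  have h := hf.comp (f := fun y : E d => (x, y)) (s := univ) (by fun_prop)
    (fun y _ => ⟨hx, mem_univ y⟩)
  exact continuousOn_univ.mp h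

theorem exists_bound_twoScale (hΩb : Bornology.IsBounded Ω)
    (hf : ContinuousOn (Function.uncurry f) (closure Ω ×ˢ univ)) :
    ∃ K, 0 ≤ K ∧ ∀ x ∈ closure Ω, ∀ y ∈ unitCube d, |f x y| ≤ K := by
  have hc : IsCompact (closure Ω ×ˢ closure (unitCube d)) :=
    hΩb.isCompact_closure.prod isBounded_unitCube.isCompact_closure
  obtain ⟨K, hK⟩ := hc.exists_bound_of_continuousOn
    (hf.mono (prod_mono_right (subset_univ _)))
  exact ⟨max K 0, le_max_right _ _, fun x hx y hy =>
    (hK (x, y) ⟨hx, subset_closure hy⟩).trans (le_max_left _ _)⟩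

theorem eventually_abs_sub_le_twoScale (hΩb : Bornology.IsBounded Ω)
    (hf : ContinuousOn (Function.uncurry f) (closure Ω ×ˢ univ)) {x₀ : E d} (hx₀ : x₀ ∈ Ω)
    {ε : ℝ} (hε : 0 < ε) :
    ∀ᶠ x in 𝓝[Ω] x₀, ∀ y ∈ unitCube d, |f x y - f x₀ y| ≤ ε := by
  have hc : IsCompact (closure Ω ×ˢ closure (unitCube d)) :=
    hΩb.isCompact_closure.prod isBounded_unitCube.isCompact_closure
  have hu := hc.uniformContinuousOn_of_continuous (hf.mono (prod_mono_right (subset_univ _)))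
  obtain ⟨δ, hδ, h⟩ := Metric.uniformContinuousOn_iff.mp hu ε hε
  filter_upwards [self_mem_nhdsWithin, mem_nhdsWithin_of_mem_nhds (Metric.ball_mem_nhds x₀ hδ)]
    with x hx hxb y hy
  have := h (x, y) ⟨subset_closure hx, subset_closure hy⟩ (x₀, y)
    ⟨subset_closure hx₀, subset_closure hy⟩ (by simpa [Prod.dist_eq, hδ] using hxb)
  rw [Real.dist_eq] at this
  exact this.le

theorem memLp_top_slice (hΩb : Bornology.IsBounded Ω)
    (hf : ContinuousOn (Function.uncurry f) (closure Ω ×ˢ univ)) {x : E d}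
    (hx : x ∈ closure Ω) : MemLp (f x) ∞ (volume.restrict (unitCube d)) := by
  obtain ⟨K, -, hK⟩ := exists_bound_twoScale hΩb hf
  refine memLp_top_of_bound (continuous_slice hf hx).aestronglyMeasurable K ?_
  filter_upwards [ae_restrict_mem measurableSet_unitCube] with y hy using hK x hx y hy

open Classical in
/-- A function of the fast variable as an element of `L^∞(Y)`, and zero if it is not essentially
bounded. -/
noncomputable def toLinf {d : ℕ} (c : E d → ℝ) : Lp ℝ ∞ (volume.restrict (unitCube d)) :=
  if h : MemLp c ∞ (volume.restrict (unitCube d)) then h.toLp c else 0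

theorem toLinf_eq {c : E d → ℝ} (h : MemLp c ∞ (volume.restrict (unitCube d))) :
    toLinf c = h.toLp c := dif_pos h

theorem norm_toLinf_le {c : E d → ℝ} {K : ℝ} (hK : 0 ≤ K) (h : ∀ y ∈ unitCube d, |c y| ≤ K) :
    ‖toLinf c‖ ≤ K := by
  unfold toLinf
  split_ifs with hc
  · refine Lp.norm_le_of_ae_bound hK ?_ |>.trans ?_
    · filter_upwards [hc.coeFn_toLp, ae_restrict_mem measurableSet_unitCube] with y h1 h2
      rw [h1]; exact h y h2
    · simp
  · simpa using hK

theorem continuousOn_toLinf (hΩb : Bornology.IsBounded Ω)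
    (hf : ContinuousOn (Function.uncurry f) (closure Ω ×ˢ univ)) :
    ContinuousOn (fun x => toLinf (f x)) Ω := by
  intro x₀ hx₀
  rw [ContinuousWithinAt, Metric.tendsto_nhds]
  intro ε hε
  filter_upwards [eventually_abs_sub_le_twoScale hΩb hf hx₀ (half_pos hε), self_mem_nhdsWithin]
    with x hx hxΩ
  have h1 := memLp_top_slice hΩb hf (subset_closure hxΩ)
  have h2 := memLp_top_slice hΩb hf (subset_closure hx₀)
  have h3 : toLinf (f x) - toLinf (f x₀) = toLinf (f x - f x₀) := by
    rw [toLinf_eq h1, toLinf_eq h2, toLinf_eq (h1.sub h2), MemLp.toLp_sub]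
  rw [dist_eq_norm, h3]
  exact (norm_toLinf_le (half_pos hε).le hx).trans_lt (half_lt_self hε)

end TwoScale

/-! ### The cell problems -/

namespace PeriodicH1

variable {d : ℕ}

/-- The difference of two periodic Sobolev functions. -/
def sub (v w : PeriodicH1 d) : PeriodicH1 d where
  fn := fun y => v.fn y - w.fn y
  grad := fun y => v.grad y - w.grad y
  periodic_fn := fun i y => by simp only [v.periodic_fn i y, w.periodic_fn i y]
  periodic_grad := fun i y => by simp only [v.periodic_grad i y, w.periodic_grad i y]
  memLp_fn := v.memLp_fn.sub w.memLp_fn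
  memLp_grad := v.memLp_grad.sub w.memLp_grad
  weak_grad := by
    intro φ hφ hc i
    have hdc : Continuous fun y => fderiv ℝ φ y (EuclideanSpace.single i 1) :=
      (hφ.continuous_fderiv (by simp)).clm_apply continuous_const
    have hcd : HasCompactSupport fun y => fderiv ℝ φ y (EuclideanSpace.single i 1) :=
      hc.fderiv_apply (𝕜 := ℝ) _
    have hg : ∀ u : PeriodicH1 d, LocallyIntegrable fun y => u.grad y i := fun u => by
      have := u.locallyIntegrable_inner (EuclideanSpace.single i 1)
      simpa [EuclideanSpace.inner_single_right] using this
    have i1 := fun u : PeriodicH1 d =>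
      u.locallyIntegrable_fn.integrable_smul_right_of_hasCompactSupport hdc hcd
    have i2 := fun u : PeriodicH1 d =>
      (hg u).integrable_smul_right_of_hasCompactSupport hφ.continuous hc
    simp only [smul_eq_mul] at i1 i2
    simp only [sub_mul, PiLp.sub_apply]
    rw [integral_sub (i1 v) (i1 w), integral_sub (i2 v) (i2 w), v.weak_grad φ hφ hc i,
      w.weak_grad φ hφ hc i]
    ring

/-- The gradient as an element of `L²(Y)^d`. -/
noncomputable def gradL (w : PeriodicH1 d) : Lp (E d) 2 (volume.restrict (unitCube d)) :=
  w.memLp_grad.toLp w.grad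

theorem coeFn_gradL (w : PeriodicH1 d) :
    w.gradL =ᵐ[volume.restrict (unitCube d)] w.grad := w.memLp_grad.coeFn_toLp

theorem gradL_sub (v w : PeriodicH1 d) : (v.sub w).gradL = v.gradL - w.gradL :=
  MemLp.toLp_sub v.memLp_grad w.memLp_grad

theorem integral_norm_grad_le (w : PeriodicH1 d) :
    ∫ y in unitCube d, ‖w.grad y‖ ≤ ‖w.gradL‖ := by
  rw [integral_norm_eq_lintegral_enorm w.memLp_grad.1, gradL, Lp.norm_toLp,
    ← eLpNorm_one_eq_lintegral_enorm]
  exact ENNReal.toReal_mono w.memLp_grad.2.ne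
    (eLpNorm_le_eLpNorm_of_exponent_le (by norm_num) w.memLp_grad.1)

end PeriodicH1

/-- Stability of solutions of a coercive problem with respect to the operator and the data. -/
theorem norm_sub_le_of_coercive {L : Type*} [NormedAddCommGroup L] [InnerProductSpace ℝ L]
    {A A' : L →L[ℝ] L} {κ₀ : ℝ} (hA : ∀ f, κ₀ * ‖f‖ ^ 2 ≤ inner ℝ (A f) f)
    {p g g' : L} {r r' ρ : ℝ} (h : inner ℝ (A (p + g)) (g - g') = r)
    (h' : inner ℝ (A' (p + g')) (g - g') = r') (hρ : 0 ≤ ρ) (hr : |r - r'| ≤ ρ * ‖g - g'‖) :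
    κ₀ * ‖g - g'‖ ≤ ρ + ‖A - A'‖ * ‖p + g'‖ := by
  have h1 := hA (g - g')
  have h2 : inner ℝ (A (g - g')) (g - g') = r - r' - inner ℝ ((A - A') (p + g')) (g - g') := by
    rw [← h, ← h', sub_apply, ← inner_sub_left, ← inner_sub_left]
    congr 1
    simp only [map_sub, map_add]; abel
  have h3 : |inner ℝ ((A - A') (p + g')) (g - g')| ≤ ‖A - A'‖ * ‖p + g'‖ * ‖g - g'‖ :=
    (abs_real_inner_le_norm _ _).trans
      (mul_le_mul_of_nonneg_right ((A - A').le_opNorm _) (norm_nonneg _))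
  rcases (norm_nonneg (g - g')).eq_or_lt with h0 | h0
  · rw [← h0, mul_zero]; positivity
  · have h4 : κ₀ * ‖g - g'‖ * ‖g - g'‖ ≤ (ρ + ‖A - A'‖ * ‖p + g'‖) * ‖g - g'‖ := by
      have := abs_le.mp h3
      have := abs_le.mp hr
      nlinarith
    exact le_of_mul_le_mul_right h4 h0

section CellFamily

variable {d : ℕ} {Ω : Set (E d)}

theorem mulL_sub {c c' : E d → ℝ} (hc : MemLp c ∞ (volume.restrict (unitCube d)))
    (hc' : MemLp c' ∞ (volume.restrict (unitCube d))) :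
    mulL (volume.restrict (unitCube d)) (E d) (hc.toLp c)
        - mulL (volume.restrict (unitCube d)) (E d) (hc'.toLp c')
      = mulL (volume.restrict (unitCube d)) (E d) ((hc.sub hc').toLp (c - c')) := by
  rw [MemLp.toLp_sub, map_sub]

theorem norm_mulL_le_of_unitCube {c : E d → ℝ} (hc : MemLp c ∞ (volume.restrict (unitCube d)))
    {K : ℝ} (hK : 0 ≤ K) (h : ∀ y ∈ unitCube d, |c y| ≤ K) :
    ‖mulL (volume.restrict (unitCube d)) (E d) (hc.toLp c)‖ ≤ K := by
  refine ContinuousLinearMap.opNorm_le_bound _ hK fun f => norm_mulL_le hc ?_ f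
  filter_upwards [ae_restrict_mem measurableSet_unitCube] with y hy using h y hy

/-- The family `w(x)` solves the cell problems `div_y (κ (p + ∇_y w)) + r = 0`, whose coefficients
depend on the slow variable `x ∈ Ω`. Both types of cell problems have this form. -/
def IsCellFamily (Ω : Set (E d)) (κ r : E d → E d → ℝ)
    (p : Lp (E d) 2 (volume.restrict (unitCube d))) (w : E d → PeriodicH1 d) : Prop :=
  ∀ x ∈ Ω, ∀ ψ : PeriodicH1 d,
    inner ℝ (mulL (volume.restrict (unitCube d)) (E d) (toLinf (κ x)) (p + (w x).gradL)) ψ.gradL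
      = ∫ y in unitCube d, r x y * ψ.fn y

theorem isCellFamily_gradientCell {κ : E d → E d → ℝ} {w : E d → PeriodicH1 d} {i : Fin d}
    (hκm : ∀ x ∈ Ω, MemLp (κ x) ∞ (volume.restrict (unitCube d)))
    (h : ∀ x ∈ Ω, SolvesGradientCell (κ x) i (w x)) :
    IsCellFamily Ω κ (fun _ _ => 0) (Lp.const 2 _ (EuclideanSpace.single i 1)) w := by
  intro x hx ψ
  simp only [zero_mul, integral_zero]
  rw [toLinf_eq (hκm x hx), inner_mulL, ← h x hx ψ]
  refine integral_congr_ae ?_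
  filter_upwards [Lp.coeFn_add (Lp.const 2 (volume.restrict (unitCube d))
    (EuclideanSpace.single i (1 : ℝ))) (w x).gradL, (w x).coeFn_gradL, ψ.coeFn_gradL,
    Lp.coeFn_const 2 (volume.restrict (unitCube d)) (EuclideanSpace.single i (1 : ℝ))]
    with y h1 h2 h3 h4
  rw [h1, Pi.add_apply, h2, h3, h4]; rfl

theorem isCellFamily_exchangeCell {κ r : E d → E d → ℝ} {w : E d → PeriodicH1 d}
    (hκm : ∀ x ∈ Ω, MemLp (κ x) ∞ (volume.restrict (unitCube d)))
    (h : ∀ x ∈ Ω, SolvesExchangeCell (κ x) (r x) (w x)) : IsCellFamily Ω κ r 0 w := by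
  intro x hx ψ
  rw [toLinf_eq (hκm x hx), inner_mulL, ← h x hx ψ, zero_add]
  refine integral_congr_ae ?_
  filter_upwards [(w x).coeFn_gradL, ψ.coeFn_gradL] with y h2 h3
  rw [h2, h3]

/-- The functional `ψ ↦ ∫_Y R ψ` of a mean-zero weight is controlled by the gradient. -/
theorem exists_poincare_const_gradL (d : ℕ) : ∃ D : ℝ, 0 ≤ D ∧
    ∀ (ψ : PeriodicH1 d) (R : E d → ℝ) (K : ℝ),
    AEStronglyMeasurable R (volume.restrict (unitCube d)) → 0 ≤ K →
    (∀ y ∈ unitCube d, |R y| ≤ K) → ∫ y in unitCube d, R y = 0 →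
    |∫ y in unitCube d, R y * ψ.fn y| ≤ K * D * ‖ψ.gradL‖ := by
  obtain ⟨D, hD0, hD⟩ := exists_poincare_const d
  exact ⟨D, hD0, fun ψ R K h1 h2 h3 h4 => (hD ψ R K h1 h2 h3 h4).trans
    (mul_le_mul_of_nonneg_left ψ.integral_norm_grad_le (by positivity))⟩

theorem integrable_mul_fn {R : E d → ℝ} (hR : MemLp R ∞ (volume.restrict (unitCube d)))
    (ψ : PeriodicH1 d) :
    Integrable (fun y => R y * ψ.fn y) (volume.restrict (unitCube d)) :=
  memLp_one_iff_integrable.mp (ψ.memLp_fn.mul (r := 2) hR |>.mono_exponent (by norm_num))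

variable {κ r : E d → E d → ℝ} {p : Lp (E d) 2 (volume.restrict (unitCube d))}
  {w : E d → PeriodicH1 d}

/-- The gradients of the solutions of a family of cell problems are bounded uniformly in `x`. -/
theorem IsCellFamily.exists_norm_le (hw : IsCellFamily Ω κ r p w)
    (hΩb : Bornology.IsBounded Ω)
    (hκ : ContinuousOn (Function.uncurry κ) (closure Ω ×ˢ univ))
    (hr : ContinuousOn (Function.uncurry r) (closure Ω ×ˢ univ))
    (hr0 : ∀ x ∈ closure Ω, ∫ y in unitCube d, r x y = 0)
    {κ₀ : ℝ} (hκ₀ : 0 < κ₀) (hκpos : ∀ x ∈ closure Ω, ∀ y, κ₀ ≤ κ x y) :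
    ∃ K, 0 ≤ K ∧ ∀ x ∈ Ω, ‖(w x).gradL‖ ≤ K := by
  obtain ⟨D, hD0, hD⟩ := exists_poincare_const_gradL d
  obtain ⟨K₁, hK₁, hκb⟩ := exists_bound_twoScale hΩb hκ
  obtain ⟨K₂, hK₂, hrb⟩ := exists_bound_twoScale hΩb hr
  refine ⟨(K₂ * D + K₁ * ‖p‖) / κ₀, by positivity, fun x hx => ?_⟩
  have hxc := subset_closure hx
  have hκm := memLp_top_slice hΩb hκ hxc
  have h := hw x hx (w x)
  rw [toLinf_eq hκm] at h
  have key := norm_sub_le_of_coercive (A := mulL _ (E d) (hκm.toLp (κ x))) (A' := 0)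
    (le_inner_mulL hκm (Eventually.of_forall (hκpos x hxc))) (p := p) (g := (w x).gradL) (g' := 0)
    (r := ∫ y in unitCube d, r x y * (w x).fn y) (r' := 0) (ρ := K₂ * D)
    (by rw [sub_zero]; exact h) (by simp) (by positivity)
    (by rw [sub_zero, sub_zero]
        exact hD (w x) (r x) K₂ (continuous_slice hr hxc).aestronglyMeasurable hK₂ (hrb x hxc)
          (hr0 x hxc))
  rw [sub_zero, sub_zero, add_zero] at key
  rw [le_div_iff₀ hκ₀, mul_comm]
  exact key.trans (add_le_add le_rfl (mul_le_mul_of_nonneg_right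
    (norm_mulL_le_of_unitCube hκm hK₁ (hκb x hxc)) (norm_nonneg _)))

/-- The gradients of the solutions of a family of cell problems depend continuously on `x`. -/
theorem IsCellFamily.continuousOn (hw : IsCellFamily Ω κ r p w)
    (hΩb : Bornology.IsBounded Ω)
    (hκ : ContinuousOn (Function.uncurry κ) (closure Ω ×ˢ univ))
    (hr : ContinuousOn (Function.uncurry r) (closure Ω ×ˢ univ))
    (hr0 : ∀ x ∈ closure Ω, ∫ y in unitCube d, r x y = 0)
    {κ₀ : ℝ} (hκ₀ : 0 < κ₀) (hκpos : ∀ x ∈ closure Ω, ∀ y, κ₀ ≤ κ x y) :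
    ContinuousOn (fun x => (w x).gradL) Ω := by
  obtain ⟨D, hD0, hD⟩ := exists_poincare_const_gradL d
  intro x₀ hx₀
  rw [ContinuousWithinAt, Metric.tendsto_nhds]
  intro η hη
  set B := D + ‖p + (w x₀).gradL‖ with hB
  have hB0 : 0 ≤ B := by positivity
  set ε := κ₀ * η / (B + 1) with hε
  have hε0 : 0 < ε := by positivity
  filter_upwards [eventually_abs_sub_le_twoScale hΩb hκ hx₀ hε0,
    eventually_abs_sub_le_twoScale hΩb hr hx₀ hε0, self_mem_nhdsWithin] with x h1 h2 hx
  have hxc := subset_closure hx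
  have hxc₀ := subset_closure hx₀
  have hκm := memLp_top_slice hΩb hκ hxc
  have hκm₀ := memLp_top_slice hΩb hκ hxc₀
  have hrm := memLp_top_slice hΩb hr hxc
  have hrm₀ := memLp_top_slice hΩb hr hxc₀
  have e1 := hw x hx ((w x).sub (w x₀))
  have e2 := hw x₀ hx₀ ((w x).sub (w x₀))
  rw [toLinf_eq hκm, PeriodicH1.gradL_sub] at e1
  rw [toLinf_eq hκm₀, PeriodicH1.gradL_sub] at e2
  have key := norm_sub_le_of_coercive (A := mulL _ (E d) (hκm.toLp (κ x)))
    (A' := mulL _ (E d) (hκm₀.toLp (κ x₀)))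
    (le_inner_mulL hκm (Eventually.of_forall (hκpos x hxc))) (p := p) (ρ := ε * D)
    e1 e2 (by positivity) (by
      rw [← integral_sub (integrable_mul_fn hrm _) (integrable_mul_fn hrm₀ _),
        ← PeriodicH1.gradL_sub]
      simp_rw [← sub_mul]
      refine hD _ (fun y => r x y - r x₀ y) ε (hrm.sub hrm₀).1 hε0.le h2 ?_
      rw [integral_sub (hrm.integrable (by simp)) (hrm₀.integrable (by simp)), hr0 x hxc,
        hr0 x₀ hxc₀, sub_zero])
  rw [mulL_sub] at key
  have h3 := norm_mulL_le_of_unitCube (hκm.sub hκm₀) hε0.le h1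
  have h4 : κ₀ * ‖(w x).gradL - (w x₀).gradL‖ ≤ ε * B :=
    key.trans (by
      rw [hB, mul_add]
      exact add_le_add le_rfl (mul_le_mul_of_nonneg_right h3 (norm_nonneg _)))
  have h5 : ε * B < κ₀ * η := by
    rw [hε, div_mul_eq_mul_div, div_lt_iff₀ (by positivity)]
    nlinarith [mul_pos hκ₀ hη]
  rw [dist_eq_norm]
  exact lt_of_mul_lt_mul_left (h4.trans_lt h5) hκ₀.le

/-- Integrals `∫_Y R w` of mean-zero two-scale weights against functions whose gradients depend
continuously on `x` are continuous and bounded. -/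
theorem continuousOn_integral_mul_fn (hΩb : Bornology.IsBounded Ω)
    (hr : ContinuousOn (Function.uncurry r) (closure Ω ×ˢ univ))
    (hr0 : ∀ x ∈ closure Ω, ∫ y in unitCube d, r x y = 0)
    (hw : ContinuousOn (fun x => (w x).gradL) Ω) {K : ℝ} (hK : 0 ≤ K)
    (hwK : ∀ x ∈ Ω, ‖(w x).gradL‖ ≤ K) :
    ContinuousOn (fun x => ∫ y in unitCube d, r x y * (w x).fn y) Ω ∧
      ∃ K', ∀ x ∈ Ω, |∫ y in unitCube d, r x y * (w x).fn y| ≤ K' := by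
  obtain ⟨D, hD0, hD⟩ := exists_poincare_const_gradL d
  obtain ⟨K₂, hK₂, hrb⟩ := exists_bound_twoScale hΩb hr
  constructor
  · intro x₀ hx₀
    rw [ContinuousWithinAt, Metric.tendsto_nhds]
    intro η hη
    have hxc₀ := subset_closure hx₀
    have hrm₀ := memLp_top_slice hΩb hr hxc₀
    set B := D * K + K₂ * D with hB
    have hB0 : 0 ≤ B := by positivity
    set ε := η / (B + 1) with hε
    have hε0 : 0 < ε := by positivity
    have hwx := Metric.tendsto_nhds.mp (hw x₀ hx₀) ε hε0
    filter_upwards [hwx, eventually_abs_sub_le_twoScale hΩb hr hx₀ hε0, self_mem_nhdsWithin]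
      with x h1 h2 hx
    have hxc := subset_closure hx
    have hrm := memLp_top_slice hΩb hr hxc
    have e : (∫ y in unitCube d, r x y * (w x).fn y) - ∫ y in unitCube d, r x₀ y * (w x₀).fn y
        = (∫ y in unitCube d, (r x y - r x₀ y) * (w x).fn y)
          + ∫ y in unitCube d, r x₀ y * ((w x).sub (w x₀)).fn y := by
      simp only [PeriodicH1.sub, sub_mul, mul_sub]
      rw [integral_sub (integrable_mul_fn hrm _) (integrable_mul_fn hrm₀ _),
        integral_sub (integrable_mul_fn hrm₀ _) (integrable_mul_fn hrm₀ _)]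
      ring
    have b1 := hD (w x) (fun y => r x y - r x₀ y) ε (hrm.sub hrm₀).1 hε0.le h2 (by
      rw [integral_sub (hrm.integrable (by simp)) (hrm₀.integrable (by simp)), hr0 x hxc,
        hr0 x₀ hxc₀, sub_zero])
    have b2 := hD ((w x).sub (w x₀)) (r x₀) K₂ hrm₀.1 hK₂ (hrb x₀ hxc₀) (hr0 x₀ hxc₀)
    rw [PeriodicH1.gradL_sub] at b2
    rw [dist_eq_norm] at h1
    rw [Real.dist_eq, e]
    refine (abs_add_le _ _).trans_lt ((add_le_add b1 b2).trans_lt ?_)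
    have b3 : ε * D * ‖(w x).gradL‖ ≤ ε * D * K :=
      mul_le_mul_of_nonneg_left (hwK x hx) (by positivity)
    have b4 : K₂ * D * ‖(w x).gradL - (w x₀).gradL‖ ≤ K₂ * D * ε :=
      mul_le_mul_of_nonneg_left h1.le (by positivity)
    have b5 : ε * (B + 1) = η := by rw [hε]; field_simp
    nlinarith
  · refine ⟨K₂ * D * K, fun x hx => ?_⟩
    have hxc := subset_closure hx
    exact (hD (w x) (r x) K₂ (memLp_top_slice hΩb hr hxc).1 hK₂ (hrb x hxc) (hr0 x hxc)).trans
      (mul_le_mul_of_nonneg_left (hwK x hx) (by positivity))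

/-- Averages of a flux `κ F` with an `L²(Y)`-continuous and bounded field `F` are continuous and
bounded. -/
theorem continuousOn_inner_mulL (hΩb : Bornology.IsBounded Ω)
    (hκ : ContinuousOn (Function.uncurry κ) (closure Ω ×ˢ univ))
    (e : Lp (E d) 2 (volume.restrict (unitCube d)))
    {F : E d → Lp (E d) 2 (volume.restrict (unitCube d))} (hF : ContinuousOn F Ω) {K : ℝ}
    (hFK : ∀ x ∈ Ω, ‖F x‖ ≤ K) :
    ContinuousOn (fun x => inner ℝ (mulL _ (E d) (toLinf (κ x)) e) (F x)) Ω ∧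
      ∃ K', ∀ x ∈ Ω, |inner ℝ (mulL _ (E d) (toLinf (κ x)) e) (F x)| ≤ K' := by
  obtain ⟨K₁, hK₁, hκb⟩ := exists_bound_twoScale hΩb hκ
  constructor
  · exact (((mulL (volume.restrict (unitCube d)) (E d)).continuous.comp_continuousOn
      (continuousOn_toLinf hΩb hκ)).clm_apply continuousOn_const).inner hF
  · refine ⟨K₁ * ‖e‖ * K, fun x hx => (abs_real_inner_le_norm _ _).trans ?_⟩
    have hκm := memLp_top_slice hΩb hκ (subset_closure hx)
    rw [toLinf_eq hκm]
    have := norm_mulL_le_of_unitCube hκm hK₁ (hκb x (subset_closure hx))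
    refine mul_le_mul ?_ (hFK x hx) (norm_nonneg _) (by positivity)
    exact (ContinuousLinearMap.le_opNorm _ _).trans
      (mul_le_mul_of_nonneg_right this (norm_nonneg _))

theorem inner_gradL_const (w : PeriodicH1 d) (ξ : E d) :
    inner ℝ w.gradL (Lp.const 2 (volume.restrict (unitCube d)) ξ) = 0 := by
  have h : inner ℝ w.gradL (Lp.const 2 (volume.restrict (unitCube d)) ξ)
      = ∫ y in unitCube d, ∑ i, ξ i * w.grad y i := by
    rw [L2.inner_def]
    refine integral_congr_ae ?_
    filter_upwards [w.coeFn_gradL, Lp.coeFn_const 2 (volume.restrict (unitCube d)) ξ] with y h1 h2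
    rw [h1, h2, PiLp.inner_apply]
    rfl
  have hg : ∀ i, IntegrableOn (fun y => w.grad y i) (unitCube d) := fun i => by
    have := w.integrableOn_inner (EuclideanSpace.single i 1)
    simpa [EuclideanSpace.inner_single_right] using this
  rw [h, integral_finsetSum _ fun i _ => (hg i).const_mul _]
  refine Finset.sum_eq_zero fun i _ => ?_
  rw [integral_const_mul, w.setIntegral_grad_apply, mul_zero]

theorem inner_const_const (ξ ζ : E d) :
    inner ℝ (Lp.const 2 (volume.restrict (unitCube d)) ξ)
      (Lp.const 2 (volume.restrict (unitCube d)) ζ) = inner ℝ ξ ζ := by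
  rw [L2.inner_def]
  have : ∫ y in unitCube d, inner ℝ ξ ζ = inner ℝ ξ ζ := by simp
  rw [← this]
  refine integral_congr_ae ?_
  filter_upwards [Lp.coeFn_const 2 (volume.restrict (unitCube d)) ξ,
    Lp.coeFn_const 2 (volume.restrict (unitCube d)) ζ] with y h1 h2
  rw [h1, h2]; rfl

end CellFamily

/-! ### The homogenized coefficients -/

section Coefficients

variable {d : ℕ} {Ω : Set (E d)}

theorem memLp_top_of_continuousOn (hΩ : IsOpen Ω) {c : E d → ℝ} (hc : ContinuousOn c Ω) {K : ℝ}
    (hK : ∀ x ∈ Ω, |c x| ≤ K) : MemLp c ∞ (volume.restrict Ω) := by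
  refine memLp_top_of_bound (hc.aestronglyMeasurable hΩ.measurableSet) K ?_
  filter_upwards [ae_restrict_mem hΩ.measurableSet] with x hx using hK x hx

theorem memLp_homCapacity (hΩ : IsOpen Ω) (hΩb : Bornology.IsBounded Ω)
    {C : Fin 2 → E d → E d → ℝ} {k : Fin 2}
    (hC : ContinuousOn (Function.uncurry (C k)) (closure Ω ×ˢ univ)) :
    MemLp (homCapacity C k) ∞ (volume.restrict Ω) := by
  obtain ⟨K, hK0, hK⟩ := exists_bound_twoScale hΩb hC
  have hi : ∀ x ∈ Ω, IntegrableOn (C k x) (unitCube d) := fun x hx =>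
    (memLp_top_slice hΩb hC (subset_closure hx)).integrable (by simp)
  refine memLp_top_of_continuousOn hΩ (K := K) ?_ fun x hx => ?_
  · intro x₀ hx₀
    rw [ContinuousWithinAt, Metric.tendsto_nhds]
    intro ε hε
    filter_upwards [eventually_abs_sub_le_twoScale hΩb hC hx₀ (half_pos hε), self_mem_nhdsWithin]
      with x h1 hx
    rw [Real.dist_eq, homCapacity, homCapacity, ← integral_sub (hi x hx) (hi x₀ hx₀),
      ← Real.norm_eq_abs]
    refine (norm_integral_le_of_norm_le_const (C := ε / 2) ?_).trans_lt ?_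
    · filter_upwards [ae_restrict_mem measurableSet_unitCube] with y hy using h1 y hy
    · simpa using hε
  · rw [homCapacity, ← Real.norm_eq_abs]
    refine (norm_integral_le_of_norm_le_const (C := K) ?_).trans ?_
    · filter_upwards [ae_restrict_mem measurableSet_unitCube] with y hy
      exact hK x (subset_closure hx) y hy
    · simp

theorem le_homCapacity (hΩb : Bornology.IsBounded Ω)
    {C : Fin 2 → E d → E d → ℝ} {k : Fin 2}
    (hC : ContinuousOn (Function.uncurry (C k)) (closure Ω ×ˢ univ)) {c₀ : ℝ}
    (hCpos : ∀ x ∈ closure Ω, ∀ y, c₀ ≤ C k x y) {x : E d} (hx : x ∈ Ω) :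
    c₀ ≤ homCapacity C k x := by
  have h : ∫ _ in unitCube d, c₀ ≤ ∫ y in unitCube d, C k x y :=
    integral_mono (integrable_const _)
      ((memLp_top_slice hΩb hC (subset_closure hx)).integrable (by simp))
      (hCpos x (subset_closure hx))
  simpa [homCapacity] using h

variable {κ : Fin 2 → E d → E d → ℝ} {Q : E d → E d → ℝ}
  {N : Fin 2 → Fin d → E d → PeriodicH1 d} {M : Fin 2 → E d → PeriodicH1 d}

theorem homDiffusion_eq_inner {k : Fin 2} {x : E d}
    (hκm : MemLp (κ k x) ∞ (volume.restrict (unitCube d))) (i j : Fin d) :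
    homDiffusion κ N k i j x = inner ℝ (mulL _ (E d) (toLinf (κ k x))
      (Lp.const 2 (volume.restrict (unitCube d)) (EuclideanSpace.single i (1 : ℝ))))
      (Lp.const 2 _ (EuclideanSpace.single j (1 : ℝ)) + (N k j x).gradL) := by
  rw [toLinf_eq hκm, inner_mulL, homDiffusion]
  refine integral_congr_ae ?_
  filter_upwards [Lp.coeFn_add (Lp.const 2 (volume.restrict (unitCube d))
    (EuclideanSpace.single j (1 : ℝ))) (N k j x).gradL, (N k j x).coeFn_gradL,
    Lp.coeFn_const 2 (volume.restrict (unitCube d)) (EuclideanSpace.single i (1 : ℝ)),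
    Lp.coeFn_const 2 (volume.restrict (unitCube d)) (EuclideanSpace.single j (1 : ℝ))]
    with y h1 h2 h3 h4
  rw [h1, Pi.add_apply, h2, h3, h4]
  simp [EuclideanSpace.inner_single_left]

theorem homDrift_eq_inner {k : Fin 2} {x : E d}
    (hκm : MemLp (κ k x) ∞ (volume.restrict (unitCube d))) (i : Fin d) :
    homDrift κ M k i x = inner ℝ (mulL _ (E d) (toLinf (κ k x))
      (Lp.const 2 (volume.restrict (unitCube d)) (EuclideanSpace.single i (1 : ℝ))))
      (M k x).gradL := by
  rw [toLinf_eq hκm, inner_mulL, homDrift]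
  refine integral_congr_ae ?_
  filter_upwards [(M k x).coeFn_gradL,
    Lp.coeFn_const 2 (volume.restrict (unitCube d)) (EuclideanSpace.single i (1 : ℝ))]
    with y h2 h3
  rw [h2, h3]
  simp [EuclideanSpace.inner_single_left]

/-- The homogenized diffusion matrix is elliptic: with `F_ξ = ∑ ξ_i (e_i + ∇N_i)` one has
`κ* ξ·ξ = ∫_Y κ |F_ξ|²`, and `F_ξ` has mean `ξ`. -/
theorem le_homDiffusion {k : Fin 2} {x : E d}
    (hκm : MemLp (κ k x) ∞ (volume.restrict (unitCube d))) {κ₀ : ℝ} (hκ₀ : 0 < κ₀)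
    (hκpos : ∀ y, κ₀ ≤ κ k x y) (hN : ∀ i, SolvesGradientCell (κ k x) i (N k i x)) (ξ : E d) :
    κ₀ * ‖ξ‖ ^ 2 ≤ ∑ i, ∑ j, homDiffusion κ N k i j x * ξ j * ξ i := by
  set μ : Measure (E d) := volume.restrict (unitCube d) with hμ
  set A := mulL μ (E d) (toLinf (κ k x)) with hA
  set e : Fin d → Lp (E d) 2 μ := fun i => Lp.const 2 μ (EuclideanSpace.single i (1 : ℝ)) with he
  set F : Fin d → Lp (E d) 2 μ := fun i => e i + (N k i x).gradL with hF
  set Fξ : Lp (E d) 2 μ := ∑ i, ξ i • F i with hFξ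
  have hcell : ∀ j (ψ : PeriodicH1 d), inner ℝ (A (F j)) ψ.gradL = 0 := by
    intro j ψ
    have := isCellFamily_gradientCell (Ω := {x}) (κ := κ k) (w := N k j) (i := j)
      (fun z hz => by rw [mem_singleton_iff.mp hz]; exact hκm)
      (fun z hz => by rw [mem_singleton_iff.mp hz]; exact hN j) x rfl ψ
    exact this.trans (by simp)
  have hsymm : ∀ f g, inner ℝ (A f) g = inner ℝ f (A g) := fun f g => by
    rw [hA, toLinf_eq hκm]; exact mulL_comm hκm f g
  have hij : ∀ i j, homDiffusion κ N k i j x = inner ℝ (A (F i)) (F j) := by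
    intro i j
    have h0 : inner ℝ (A (N k i x).gradL) (F j) = 0 := by
      rw [hsymm, real_inner_comm]; exact hcell j _
    rw [homDiffusion_eq_inner hκm, show F i = e i + (N k i x).gradL from rfl, map_add,
      inner_add_left, h0, add_zero]
  have hsum : ∑ i, ∑ j, homDiffusion κ N k i j x * ξ j * ξ i = inner ℝ (A Fξ) Fξ := by
    rw [hFξ, map_sum, sum_inner]
    refine Finset.sum_congr rfl fun i _ => ?_
    rw [inner_sum]
    refine Finset.sum_congr rfl fun j _ => ?_
    rw [hij, map_smul, inner_smul_left, inner_smul_right]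
    simp only [conj_trivial]; ring
  have hmean : inner ℝ Fξ (Lp.const 2 μ ξ) = ‖ξ‖ ^ 2 := by
    rw [hFξ, sum_inner, EuclideanSpace.real_norm_sq_eq]
    refine Finset.sum_congr rfl fun i _ => ?_
    rw [inner_smul_left, hF, inner_add_left, inner_gradL_const, inner_const_const,
      EuclideanSpace.inner_single_left]
    simp [sq]
  have hnorm : ‖Lp.const 2 μ ξ‖ = ‖ξ‖ := by
    rw [← sq_eq_sq₀ (norm_nonneg _) (norm_nonneg _), ← real_inner_self_eq_norm_sq,
      inner_const_const, real_inner_self_eq_norm_sq]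
  have hle : ‖ξ‖ ≤ ‖Fξ‖ := by
    have h := real_inner_le_norm Fξ (Lp.const 2 μ ξ)
    rw [hmean, hnorm, sq] at h
    rcases (norm_nonneg ξ).eq_or_lt with h0 | h0
    · rw [← h0]; exact norm_nonneg _
    · exact le_of_mul_le_mul_right h h0
  rw [hsum, hA, toLinf_eq hκm]
  refine le_trans ?_ (le_inner_mulL hκm (Eventually.of_forall hκpos) Fξ)
  gcongr

/-- The homogenized coefficients are essentially bounded on `Ω`. -/
structure BoundedCoefficients (Ω : Set (E d)) (κ : Fin 2 → E d → E d → ℝ) (Q : E d → E d → ℝ)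
    (N : Fin 2 → Fin d → E d → PeriodicH1 d) (M : Fin 2 → E d → PeriodicH1 d) : Prop where
  diffusion : ∀ k i j, MemLp (homDiffusion κ N k i j) ∞ (volume.restrict Ω)
  drift : ∀ k i, MemLp (homDrift κ M k i) ∞ (volume.restrict Ω)
  convection : ∀ k i, MemLp (homConvection Q N k i) ∞ (volume.restrict Ω)
  exchange : MemLp (homExchange Q M) ∞ (volume.restrict Ω)

theorem boundedCoefficients (hΩ : IsOpen Ω) (hΩb : Bornology.IsBounded Ω)
    (hκ : ∀ k, ContinuousOn (Function.uncurry (κ k)) (closure Ω ×ˢ univ))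
    (hQ : ContinuousOn (Function.uncurry Q) (closure Ω ×ˢ univ))
    (hQavg : ∀ x ∈ closure Ω, ∫ y in unitCube d, Q x y = 0)
    {κ₀ : ℝ} (hκ₀ : 0 < κ₀) (hκpos : ∀ k, ∀ x ∈ closure Ω, ∀ y, κ₀ ≤ κ k x y)
    (hN : ∀ k i, ∀ x ∈ Ω, SolvesGradientCell (κ k x) i (N k i x))
    (hM : ∀ k, ∀ x ∈ Ω, SolvesExchangeCell (κ k x) (Q x) (M k x)) :
    BoundedCoefficients Ω κ Q N M := by
  have hκm : ∀ k, ∀ x ∈ Ω, MemLp (κ k x) ∞ (volume.restrict (unitCube d)) := fun k x hx =>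
    memLp_top_slice hΩb (hκ k) (subset_closure hx)
  have h0 : ContinuousOn (Function.uncurry fun _ _ : E d => (0 : ℝ)) (closure Ω ×ˢ univ) :=
    continuousOn_const
  have h0i : ∀ x ∈ closure Ω, ∫ _ in unitCube d, (0 : ℝ) = 0 := fun _ _ => by simp
  have cN := fun k i => isCellFamily_gradientCell (hκm k) (hN k i)
  have cM := fun k => isCellFamily_exchangeCell (hκm k) (hM k)
  have kN := fun k i => (cN k i).continuousOn hΩb (hκ k) h0 h0i hκ₀ (hκpos k)
  have kM := fun k => (cM k).continuousOn hΩb (hκ k) hQ hQavg hκ₀ (hκpos k)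
  have bN := fun k i => (cN k i).exists_norm_le hΩb (hκ k) h0 h0i hκ₀ (hκpos k)
  have bM := fun k => (cM k).exists_norm_le hΩb (hκ k) hQ hQavg hκ₀ (hκpos k)
  refine ⟨fun k i j => ?_, fun k i => ?_, fun k i => ?_, ?_⟩
  · obtain ⟨K, hK0, hK⟩ := bN k j
    obtain ⟨hc, K', hK'⟩ := continuousOn_inner_mulL hΩb (hκ k)
      (Lp.const 2 (volume.restrict (unitCube d)) (EuclideanSpace.single i (1 : ℝ)))
      (F := fun x => Lp.const 2 _ (EuclideanSpace.single j (1 : ℝ)) + (N k j x).gradL)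
      (continuousOn_const.add (kN k j))
      (K := ‖Lp.const 2 (volume.restrict (unitCube d)) (EuclideanSpace.single j (1 : ℝ))‖ + K)
      (fun x hx => (norm_add_le _ _).trans (add_le_add le_rfl (hK x hx)))
    have he := fun x hx => homDiffusion_eq_inner (N := N) (hκm k x hx) i j
    exact memLp_top_of_continuousOn hΩ (hc.congr he) fun x hx => by rw [he x hx]; exact hK' x hx
  · obtain ⟨K, hK0, hK⟩ := bM k
    obtain ⟨hc, K', hK'⟩ := continuousOn_inner_mulL hΩb (hκ k)
      (Lp.const 2 (volume.restrict (unitCube d)) (EuclideanSpace.single i (1 : ℝ))) (kM k) hK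
    have he := fun x hx => homDrift_eq_inner (M := M) (hκm k x hx) i
    exact memLp_top_of_continuousOn hΩ (hc.congr he) fun x hx => by rw [he x hx]; exact hK' x hx
  · obtain ⟨K, hK0, hK⟩ := bN k i
    obtain ⟨hc, K', hK'⟩ := continuousOn_integral_mul_fn hΩb hQ hQavg (kN k i) hK0 hK
    exact memLp_top_of_continuousOn hΩ hc hK'
  · have hm : ∀ k, MemLp (fun x => ∫ y in unitCube d, Q x y * (M k x).fn y) ∞
        (volume.restrict Ω) := fun k => by
      obtain ⟨K, hK0, hK⟩ := bM k
      obtain ⟨hc, K', hK'⟩ := continuousOn_integral_mul_fn hΩb hQ hQavg (kM k) hK0 hK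
      exact memLp_top_of_continuousOn hΩ hc hK'
    refine ((hm 0).add (hm 1)).ae_eq ?_
    filter_upwards [ae_restrict_mem hΩ.measurableSet] with x hx
    have hQm := memLp_top_slice hΩb hQ (subset_closure hx)
    simp only [Pi.add_apply, homExchange, mul_add]
    rw [integral_add (integrable_mul_fn hQm _) (integrable_mul_fn hQm _)]

end Coefficients


/-! ### The spatial operator of the homogenized system -/

section Operators

variable {d : ℕ} {Ω : Set (E d)}

/-- The embedding `H^1_0(Ω) → L²(Ω)`. -/
noncomputable def fnL (Ω : Set (E d)) : H10 Ω →L[ℝ] L2 Ω :=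
  (WithLp.fstL 2 ℝ (L2 Ω) (L2Vec Ω)) ∘L (testPairs Ω).topologicalClosure.subtypeL

/-- The weak partial derivative `H^1_0(Ω) → L²(Ω)`. -/
noncomputable def partialL (Ω : Set (E d)) (i : Fin d) : H10 Ω →L[ℝ] L2 Ω :=
  ((EuclideanSpace.proj i : E d →L[ℝ] ℝ).compLpL 2 (volume.restrict Ω)) ∘L
    (WithLp.sndL 2 ℝ (L2 Ω) (L2Vec Ω)) ∘L (testPairs Ω).topologicalClosure.subtypeL

theorem fnL_apply (v : H10 Ω) : fnL Ω v = v.fn := rfl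

theorem coeFn_partialL (v : H10 Ω) (i : Fin d) :
    partialL Ω i v =ᵐ[volume.restrict Ω] fun x => v.grad x i :=
  (EuclideanSpace.proj i : E d →L[ℝ] ℝ).coeFn_compLp v.grad

theorem norm_sq_H10 (v : H10 Ω) : ‖v‖ ^ 2 = ‖v.fn‖ ^ 2 + ‖v.grad‖ ^ 2 := by
  rw [Submodule.coe_norm, WithLp.prod_norm_sq_eq_of_L2]; rfl

section Weighted

variable {X : Type*} [MeasurableSpace X] {μ : Measure X}

theorem inner_mulL_real {c : X → ℝ} (hc : MemLp c ∞ μ) (f g : Lp ℝ 2 μ) :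
    inner ℝ (mulL μ ℝ (hc.toLp c) f) g = ∫ x, c x * f x * g x ∂μ := by
  rw [inner_mulL]
  congr 1; ext x
  change c x * (g x * f x) = _
  ring

theorem integrable_mul_mul {c : X → ℝ} (hc : MemLp c ∞ μ) (f g : Lp ℝ 2 μ) :
    Integrable (fun x => c x * f x * g x) μ := by
  refine (L2.integrable_inner (𝕜 := ℝ) (mulL μ ℝ (hc.toLp c) f) g).congr ?_
  filter_upwards [coeFn_mulL hc f] with x hx
  rw [hx]
  change g x * (c x * f x) = _
  ring

end Weighted

/-- The product space `V × V` of the pairs `(u₁, u₂)`. -/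
abbrev VV (Ω : Set (E d)) : Type := PiLp 2 fun _ : Fin 2 => H10 Ω

/-- The product space `H × H`. -/
abbrev HH (Ω : Set (E d)) : Type := PiLp 2 fun _ : Fin 2 => L2 Ω

-- Shortcut instances: the search through `PiLp` over a closed subspace of `Lp` is slow.
noncomputable instance : InnerProductSpace ℝ (H10 Ω) := Submodule.innerProductSpace _

noncomputable instance : NormedAddCommGroup (VV Ω) := PiLp.normedAddCommGroup 2 _

noncomputable instance : InnerProductSpace ℝ (VV Ω) := PiLp.innerProductSpace _

noncomputable instance : NormedAddCommGroup (HH Ω) := PiLp.normedAddCommGroup 2 _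

noncomputable instance : InnerProductSpace ℝ (HH Ω) := PiLp.innerProductSpace _

noncomputable instance : NormedSpace ℝ (VV Ω) := InnerProductSpace.toNormedSpace

noncomputable instance : NormedSpace ℝ (HH Ω) := InnerProductSpace.toNormedSpace

section PiLpMaps

variable {X Z : Type*} [NormedAddCommGroup X] [InnerProductSpace ℝ X]
  [NormedAddCommGroup Z] [InnerProductSpace ℝ Z]

/-- The coordinates of a pair. -/
noncomputable def prL (X : Type*) [NormedAddCommGroup X] [InnerProductSpace ℝ X] (k : Fin 2) :
    PiLp 2 (fun _ : Fin 2 => X) →L[ℝ] X := PiLp.proj 2 (fun _ : Fin 2 => X) k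

/-- The map into a product with given coordinates. -/
noncomputable def pairL (f : Fin 2 → Z →L[ℝ] X) : Z →L[ℝ] PiLp 2 (fun _ : Fin 2 => X) :=
  ((PiLp.continuousLinearEquiv 2 ℝ (fun _ : Fin 2 => X)).symm :
    (Fin 2 → X) →L[ℝ] PiLp 2 (fun _ : Fin 2 => X)) ∘L ContinuousLinearMap.pi f

theorem prL_apply (k : Fin 2) (v : PiLp 2 (fun _ : Fin 2 => X)) : prL X k v = v k := rfl

theorem pairL_apply (f : Fin 2 → Z →L[ℝ] X) (z : Z) (k : Fin 2) : pairL f z k = f k z := rfl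

/-- The inclusion of the `k`-th factor. -/
noncomputable def inclL (X : Type*) [NormedAddCommGroup X] [InnerProductSpace ℝ X] (k : Fin 2) :
    X →L[ℝ] PiLp 2 (fun _ : Fin 2 => X) :=
  pairL fun l => if l = k then ContinuousLinearMap.id ℝ X else 0

theorem inclL_apply (k l : Fin 2) (x : X) : inclL X k x l = if l = k then x else 0 := by
  rw [inclL, pairL_apply]; split_ifs <;> rfl

theorem inner_inclL (k : Fin 2) (u : PiLp 2 (fun _ : Fin 2 => X)) (x : X) :
    inner ℝ u (inclL X k x) = inner ℝ (u k) x := by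
  rw [PiLp.inner_apply, Finset.sum_eq_single k]
  · rw [inclL_apply, if_pos rfl]
  · intro l _ hl
    rw [inclL_apply, if_neg hl, inner_zero_right]
  · simp

end PiLpMaps

/-- The embedding `V × V → H × H`. -/
noncomputable def embL (Ω : Set (E d)) : VV Ω →L[ℝ] HH Ω :=
  pairL fun k => fnL Ω ∘L prL (H10 Ω) k

theorem embL_apply (u : VV Ω) (k : Fin 2) : embL Ω u k = (u k).fn := rfl

theorem embL_inclL (k : Fin 2) (v : H10 Ω) : embL Ω (inclL _ k v) = inclL _ k v.fn := by
  ext1 l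
  change (inclL (H10 Ω) k v l).fn = inclL (L2 Ω) k v.fn l
  rw [inclL_apply, inclL_apply]
  split_ifs
  · rfl
  · exact (fnL Ω).map_zero

variable {κ : Fin 2 → E d → E d → ℝ} {Q : E d → E d → ℝ}
  {N : Fin 2 → Fin d → E d → PeriodicH1 d} {M : Fin 2 → E d → PeriodicH1 d}

/-- Multiplication on `L²(Ω)` by an essentially bounded coefficient. -/
noncomputable abbrev coefL {c : E d → ℝ} (hc : MemLp c ∞ (volume.restrict Ω)) :
    L2 Ω →L[ℝ] L2 Ω := mulL (volume.restrict Ω) ℝ (hc.toLp c)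

/-- The diffusion operator `-div(κ* ∇·)`. -/
noncomputable def diffusionOp (h : BoundedCoefficients Ω κ Q N M) (k : Fin 2) :
    H10 Ω →L[ℝ] H10 Ω :=
  ∑ i, ∑ j, ContinuousLinearMap.adjoint (partialL Ω i) ∘L coefL (h.diffusion k i j) ∘L partialL Ω j

/-- The drift operator, which is of order zero in the unknown. -/
noncomputable def driftOp (h : BoundedCoefficients Ω κ Q N M) (k : Fin 2) : HH Ω →L[ℝ] H10 Ω :=
  ∑ i, ContinuousLinearMap.adjoint (partialL Ω i) ∘L coefL (h.drift k i) ∘L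
    (prL (L2 Ω) k.rev - prL (L2 Ω) k)

/-- The convection and exchange terms, which take values in `L²(Ω)`. -/
noncomputable def lowerOp (h : BoundedCoefficients Ω κ Q N M) (k : Fin 2) : VV Ω →L[ℝ] L2 Ω :=
  (∑ i, (coefL (h.convection k i) ∘L partialL Ω i ∘L prL (H10 Ω) k
    - coefL (h.convection k.rev i) ∘L partialL Ω i ∘L prL (H10 Ω) k.rev))
  - coefL h.exchange ∘L fnL Ω ∘L (prL (H10 Ω) k - prL (H10 Ω) k.rev)

/-- The spatial operator of the `k`-th equation. -/
noncomputable def spatialOp (h : BoundedCoefficients Ω κ Q N M) (k : Fin 2) : VV Ω →L[ℝ] H10 Ω :=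
  diffusionOp h k ∘L prL (H10 Ω) k + driftOp h k ∘L embL Ω
    + ContinuousLinearMap.adjoint (fnL Ω) ∘L lowerOp h k

theorem inner_diffusionOp (h : BoundedCoefficients Ω κ Q N M) (k : Fin 2) (u φ : H10 Ω) :
    inner ℝ (diffusionOp h k u) φ
      = ∫ x in Ω, ∑ i, ∑ j, homDiffusion κ N k i j x * u.grad x j * φ.grad x i := by
  have hi := fun i j => integrable_mul_mul (h.diffusion k i j) (partialL Ω j u) (partialL Ω i φ)
  have e1 : ∫ x in Ω, ∑ i, ∑ j, homDiffusion κ N k i j x * u.grad x j * φ.grad x i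
      = ∫ x in Ω, ∑ i, ∑ j, homDiffusion κ N k i j x * partialL Ω j u x * partialL Ω i φ x := by
    refine integral_congr_ae ?_
    filter_upwards [ae_all_iff.mpr (coeFn_partialL u), ae_all_iff.mpr (coeFn_partialL φ)]
      with x h1 h2
    simp only [h1, h2]
  rw [e1, integral_finsetSum _ fun i _ => integrable_finsetSum _ fun j _ => hi i j]
  simp_rw [integral_finsetSum _ fun j _ => hi _ j]
  simp only [diffusionOp, sum_apply, sum_inner, ContinuousLinearMap.comp_apply,
    ContinuousLinearMap.adjoint_inner_left]
  refine Finset.sum_congr rfl fun i _ => Finset.sum_congr rfl fun j _ => ?_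
  exact inner_mulL_real (h.diffusion k i j) (partialL Ω j u) (partialL Ω i φ)

theorem inner_driftOp (h : BoundedCoefficients Ω κ Q N M) (k : Fin 2) (u : VV Ω) (φ : H10 Ω) :
    inner ℝ (driftOp h k (embL Ω u)) φ
      = ∫ x in Ω, (∑ i, homDrift κ M k i x * φ.grad x i) * ((u k.rev).fn x - (u k).fn x) := by
  have hi := fun i => integrable_mul_mul (h.drift k i) ((u k.rev).fn - (u k).fn) (partialL Ω i φ)
  have e1 : ∫ x in Ω, (∑ i, homDrift κ M k i x * φ.grad x i) * ((u k.rev).fn x - (u k).fn x)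
      = ∫ x in Ω, ∑ i, homDrift κ M k i x * ((u k.rev).fn - (u k).fn : L2 Ω) x
        * partialL Ω i φ x := by
    refine integral_congr_ae ?_
    filter_upwards [ae_all_iff.mpr (coeFn_partialL φ), Lp.coeFn_sub (u k.rev).fn (u k).fn]
      with x h1 h2
    simp only [h1, h2, Pi.sub_apply, Finset.sum_mul]
    exact Finset.sum_congr rfl fun i _ => by ring
  rw [e1, integral_finsetSum _ fun i _ => hi i]
  simp only [driftOp, sum_apply, sum_inner, ContinuousLinearMap.comp_apply,
    ContinuousLinearMap.adjoint_inner_left]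
  refine Finset.sum_congr rfl fun i _ => ?_
  exact inner_mulL_real (h.drift k i) ((u k.rev).fn - (u k).fn) (partialL Ω i φ)

theorem inner_lowerOp (h : BoundedCoefficients Ω κ Q N M) (k : Fin 2) (u : VV Ω) (φ : H10 Ω) :
    inner ℝ (lowerOp h k u) φ.fn
      = (∫ x in Ω, (∑ i, (homConvection Q N k i x * (u k).grad x i
          - homConvection Q N k.rev i x * (u k.rev).grad x i)) * φ.fn x)
        - ∫ x in Ω, homExchange Q M x * ((u k).fn x - (u k.rev).fn x) * φ.fn x := by
  have hi := fun l i => integrable_mul_mul (h.convection l i) (partialL Ω i (u l)) φ.fn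
  have hi' : ∀ i, Integrable (fun x => homConvection Q N k i x * partialL Ω i (u k) x * φ.fn x
      - homConvection Q N k.rev i x * partialL Ω i (u k.rev) x * φ.fn x) (volume.restrict Ω) :=
    fun i => (hi k i).sub (hi k.rev i)
  have e1 : ∫ x in Ω, (∑ i, (homConvection Q N k i x * (u k).grad x i
          - homConvection Q N k.rev i x * (u k.rev).grad x i)) * φ.fn x
      = ∫ x in Ω, ∑ i, (homConvection Q N k i x * partialL Ω i (u k) x * φ.fn x
          - homConvection Q N k.rev i x * partialL Ω i (u k.rev) x * φ.fn x) := by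
    refine integral_congr_ae ?_
    filter_upwards [ae_all_iff.mpr (coeFn_partialL (u k)),
      ae_all_iff.mpr (coeFn_partialL (u k.rev))] with x h1 h2
    simp only [h1, h2, Finset.sum_mul, sub_mul]
  have e2 : ∫ x in Ω, homExchange Q M x * ((u k).fn x - (u k.rev).fn x) * φ.fn x
      = inner ℝ (coefL h.exchange ((u k).fn - (u k.rev).fn)) φ.fn := by
    rw [inner_mulL_real]
    refine integral_congr_ae ?_
    filter_upwards [Lp.coeFn_sub (u k).fn (u k.rev).fn] with x h2
    simp only [h2, Pi.sub_apply]
  rw [e1, e2, integral_finsetSum _ fun i _ => hi' i]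
  rw [Finset.sum_congr rfl fun i _ => integral_sub (hi k i) (hi k.rev i)]
  simp_rw [← inner_mulL_real (h.convection _ _)]
  simp only [lowerOp, sub_apply, sum_apply, inner_sub_left, sum_inner,
    ContinuousLinearMap.comp_apply, prL_apply, map_sub, fnL_apply]

/-- The spatial operator represents the variational form of the system. -/
theorem inner_spatialOp (h : BoundedCoefficients Ω κ Q N M) (k : Fin 2) (u : VV Ω) (φ : H10 Ω) :
    inner ℝ (spatialOp h k u) φ = homForm κ Q N M k (fun l => u l) φ := by
  have e : inner ℝ (spatialOp h k u) φ = inner ℝ (diffusionOp h k (u k)) φ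
      + inner ℝ (driftOp h k (embL Ω u)) φ + inner ℝ (lowerOp h k u) φ.fn := by
    rw [← fnL_apply, ← ContinuousLinearMap.adjoint_inner_left, ← inner_add_left, ← inner_add_left]
    rfl
  rw [e, inner_diffusionOp, inner_driftOp, inner_lowerOp, homForm]
  ring

theorem le_inner_diffusionOp (h : BoundedCoefficients Ω κ Q N M) (hΩ : IsOpen Ω) (k : Fin 2)
    {κ₀ : ℝ}
    (hell : ∀ x ∈ Ω, ∀ ξ : E d, κ₀ * ‖ξ‖ ^ 2 ≤ ∑ i, ∑ j, homDiffusion κ N k i j x * ξ j * ξ i)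
    (u : H10 Ω) : κ₀ * ‖u.grad‖ ^ 2 ≤ inner ℝ (diffusionOp h k u) u := by
  have hi := fun i j => integrable_mul_mul (h.diffusion k i j) (partialL Ω j u) (partialL Ω i u)
  have hi2 : Integrable (fun x => ∑ i, ∑ j, homDiffusion κ N k i j x * u.grad x j * u.grad x i)
      (volume.restrict Ω) := by
    refine (integrable_finsetSum Finset.univ fun i _ =>
      integrable_finsetSum Finset.univ fun j _ => hi i j).congr ?_
    filter_upwards [ae_all_iff.mpr (coeFn_partialL u)] with x h1
    simp only [h1]
  rw [inner_diffusionOp, ← real_inner_self_eq_norm_sq, L2.inner_def, ← integral_const_mul]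
  refine integral_mono_ae ((L2.integrable_inner (𝕜 := ℝ) u.grad u.grad).const_mul _) hi2 ?_
  filter_upwards [ae_restrict_mem hΩ.measurableSet] with x hx
  rw [real_inner_self_eq_norm_sq]
  exact hell x hx _

/-- The spatial operator of the whole system. -/
noncomputable def systemOp (h : BoundedCoefficients Ω κ Q N M) : VV Ω →L[ℝ] VV Ω :=
  pairL (spatialOp h)

/-- The Gårding inequality: all terms except the diffusion are controlled by the product of the
norms in `V × V` and in `H × H`. -/
theorem exists_garding (h : BoundedCoefficients Ω κ Q N M) (hΩ : IsOpen Ω) {κ₀ : ℝ} (hκ₀ : 0 < κ₀)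
    (hell : ∀ k, ∀ x ∈ Ω, ∀ ξ : E d,
      κ₀ * ‖ξ‖ ^ 2 ≤ ∑ i, ∑ j, homDiffusion κ N k i j x * ξ j * ξ i) :
    ∃ lam, 0 ≤ lam ∧ ∀ u : VV Ω,
      κ₀ / 2 * ‖u‖ ^ 2 ≤ inner ℝ (systemOp h u) u + lam * ‖embL Ω u‖ ^ 2 := by
  set K : ℝ := ∑ k, (‖driftOp h k‖ + ‖lowerOp h k‖) with hK
  have hK0 : 0 ≤ K := Finset.sum_nonneg fun k _ =>
    add_nonneg (ContinuousLinearMap.opNorm_nonneg _) (ContinuousLinearMap.opNorm_nonneg _)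
  -- `κ₀` restores the full norm from the gradient, and Young's inequality, which costs half of the
  -- coercivity, produces the other summand
  refine ⟨κ₀ + K ^ 2 / (2 * κ₀), by positivity, fun u => ?_⟩
  have hlow : ∀ k, -((‖driftOp h k‖ + ‖lowerOp h k‖) * (‖embL Ω u‖ * ‖u‖))
      ≤ inner ℝ (driftOp h k (embL Ω u)) (u k) + inner ℝ (lowerOp h k u) (u k).fn := by
    intro k
    have a1 := (abs_real_inner_le_norm (driftOp h k (embL Ω u)) (u k)).trans
      (mul_le_mul ((driftOp h k).le_opNorm (embL Ω u)) (PiLp.norm_apply_le u k)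
        (norm_nonneg _) (mul_nonneg (ContinuousLinearMap.opNorm_nonneg _) (norm_nonneg _)))
    have a2 := (abs_real_inner_le_norm (lowerOp h k u) (u k).fn).trans
      (mul_le_mul ((lowerOp h k).le_opNorm u) (PiLp.norm_apply_le (embL Ω u) k)
        (norm_nonneg _) (mul_nonneg (ContinuousLinearMap.opNorm_nonneg _) (norm_nonneg _)))
    have b1 := (abs_le.mp a1).1
    have b2 := (abs_le.mp a2).1
    linarith
  have hexp : inner ℝ (systemOp h u) u = ∑ k, (inner ℝ (diffusionOp h k (u k)) (u k)
      + (inner ℝ (driftOp h k (embL Ω u)) (u k) + inner ℝ (lowerOp h k u) (u k).fn)) := by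
    rw [PiLp.inner_apply]
    refine Finset.sum_congr rfl fun k _ => ?_
    rw [← add_assoc, ← fnL_apply, ← ContinuousLinearMap.adjoint_inner_left, ← inner_add_left,
      ← inner_add_left]
    rfl
  have hsum : κ₀ * (‖u‖ ^ 2 - ‖embL Ω u‖ ^ 2) - K * (‖embL Ω u‖ * ‖u‖)
      ≤ inner ℝ (systemOp h u) u := by
    have e : κ₀ * (‖u‖ ^ 2 - ‖embL Ω u‖ ^ 2) - K * (‖embL Ω u‖ * ‖u‖)
        = ∑ k, (κ₀ * ‖(u k).grad‖ ^ 2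
          + -((‖driftOp h k‖ + ‖lowerOp h k‖) * (‖embL Ω u‖ * ‖u‖))) := by
      rw [Finset.sum_add_distrib, Finset.sum_neg_distrib, ← Finset.sum_mul, ← hK,
        ← Finset.mul_sum, PiLp.norm_sq_eq_of_L2, PiLp.norm_sq_eq_of_L2, ← Finset.sum_sub_distrib,
        sub_eq_add_neg]
      congr 2
      refine Finset.sum_congr rfl fun k _ => ?_
      rw [norm_sq_H10, embL_apply, add_sub_cancel_left]
    rw [e, hexp]
    exact Finset.sum_le_sum fun k _ =>
      add_le_add (le_inner_diffusionOp h hΩ k (hell k) (u k)) (hlow k)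
  have hy : K * (‖embL Ω u‖ * ‖u‖) ≤ κ₀ / 2 * ‖u‖ ^ 2 + K ^ 2 / (2 * κ₀) * ‖embL Ω u‖ ^ 2 := by
    have h1 : 0 ≤ (κ₀ * ‖u‖ - K * ‖embL Ω u‖) ^ 2 / (2 * κ₀) := by positivity
    have h2 : (κ₀ * ‖u‖ - K * ‖embL Ω u‖) ^ 2 / (2 * κ₀)
        = κ₀ / 2 * ‖u‖ ^ 2 + K ^ 2 / (2 * κ₀) * ‖embL Ω u‖ ^ 2 - K * (‖embL Ω u‖ * ‖u‖) := by
      field_simp; ring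
    linarith
  linarith

/-- A smooth function with compact support in `Ω`, as an element of `H^1_0(Ω)`. -/
theorem exists_H10_of_test {φ : E d → ℝ} (hφ : ContDiff ℝ ∞ φ)
    (hc : HasCompactSupport φ) (hs : tsupport φ ⊆ Ω) :
    ∃ v : H10 Ω, v.fn =ᵐ[volume.restrict Ω] φ ∧ v.grad =ᵐ[volume.restrict Ω] gradient φ := by
  have hg : Continuous (gradient φ) :=
    (InnerProductSpace.toDual ℝ (E d)).symm.continuous.comp (hφ.continuous_fderiv (by simp))
  have hgc : HasCompactSupport (gradient φ) :=
    (hc.fderiv (𝕜 := ℝ)).comp_left (map_zero (InnerProductSpace.toDual ℝ (E d)).symm)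
  have m1 : MemLp φ 2 (volume.restrict Ω) :=
    (hφ.continuous.memLp_of_hasCompactSupport hc).restrict _
  have m2 : MemLp (gradient φ) 2 (volume.restrict Ω) :=
    (hg.memLp_of_hasCompactSupport hgc).restrict _
  refine ⟨⟨WithLp.toLp 2 (m1.toLp φ, m2.toLp _), subset_closure ?_⟩, m1.coeFn_toLp, m2.coeFn_toLp⟩
  exact ⟨φ, hφ, hc, hs, m1.coeFn_toLp, m2.coeFn_toLp⟩

/-- `H^1_0(Ω)` is dense in `L²(Ω)`. -/
theorem eq_zero_of_forall_inner_fn (hΩ : IsOpen Ω) {h : L2 Ω}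
    (hz : ∀ v : H10 Ω, inner ℝ v.fn h = 0) : h = 0 := by
  have hae : ∀ᵐ x, x ∈ Ω → h x = 0 := by
    refine hΩ.ae_eq_zero_of_integral_contDiff_smul_eq_zero ?_ fun φ hφ hc hs => ?_
    · intro x hx
      obtain ⟨K, hK, hxK⟩ := exists_compact_subset hΩ hx
      refine ⟨K, mem_nhdsWithin_of_mem_nhds (mem_interior_iff_mem_nhds.mp hxK.1), ?_⟩
      have hm : MemLp h 2 (volume.restrict K) :=
        (Lp.memLp h).mono_measure (Measure.restrict_mono hxK.2 le_rfl)
      have : IsFiniteMeasure ((volume : Measure (E d)).restrict K) :=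
        ⟨by rw [Measure.restrict_apply_univ]; exact hK.measure_lt_top⟩
      exact hm.integrable (by norm_num)
    · obtain ⟨v, hv, -⟩ := exists_H10_of_test hφ hc hs
      rw [← hz v, L2.inner_def, ← setIntegral_eq_integral_of_forall_compl_eq_zero (s := Ω)]
      · refine integral_congr_ae ?_
        filter_upwards [hv] with x hx
        rw [hx, smul_eq_mul, mul_comm]; rfl
      · intro x hx
        rw [image_eq_zero_of_notMem_tsupport (fun hh => hx (hs hh)), zero_smul]
  refine Lp.ext ?_
  filter_upwards [(ae_restrict_iff' hΩ.measurableSet).mpr hae,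
    Lp.coeFn_zero ℝ 2 (volume.restrict Ω)] with x h1 h2
  exact h1.trans h2.symm

/-- Multiplication by the two weights. -/
noncomputable def weightOp {c : Fin 2 → E d → ℝ} (hc : ∀ k, MemLp (c k) ∞ (volume.restrict Ω)) :
    HH Ω →L[ℝ] HH Ω := pairL fun k => coefL (hc k) ∘L prL (L2 Ω) k

/-- The homogenized system as an abstract parabolic problem on `V × V` and `H × H`. -/
theorem exists_parabolicOperator (h : BoundedCoefficients Ω κ Q N M) (hΩ : IsOpen Ω) {κ₀ : ℝ}
    (hκ₀ : 0 < κ₀)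
    (hell : ∀ k, ∀ x ∈ Ω, ∀ ξ : E d,
      κ₀ * ‖ξ‖ ^ 2 ≤ ∑ i, ∑ j, homDiffusion κ N k i j x * ξ j * ξ i)
    {c : Fin 2 → E d → ℝ} (hc : ∀ k, MemLp (c k) ∞ (volume.restrict Ω)) {c₀ : ℝ} (hc₀ : 0 < c₀)
    (hcpos : ∀ k, ∀ x ∈ Ω, c₀ ≤ c k x) :
    ∃ P : ParabolicOperator (VV Ω) (HH Ω), P.ι = embL Ω ∧ P.m = weightOp hc ∧ P.A = systemOp h := by
  obtain ⟨lam, hlam, hG⟩ := exists_garding h hΩ hκ₀ hell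
  have hcoer : ∀ x : HH Ω, c₀ * ‖x‖ ^ 2 ≤ inner ℝ (weightOp hc x) x := by
    intro x
    rw [PiLp.inner_apply, PiLp.norm_sq_eq_of_L2, Finset.mul_sum]
    refine Finset.sum_le_sum fun k _ => le_inner_mulL (hc k) ?_ (x k)
    filter_upwards [ae_restrict_mem hΩ.measurableSet] with y hy using hcpos k y hy
  refine ⟨{ ι := embL Ω
            m := weightOp hc
            A := systemOp h
            ν := c₀
            α := κ₀ / 2
            lam := lam / c₀
            ν_pos := hc₀
            α_pos := by positivity
            lam_nonneg := by positivity
            dense := ?_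
            m_symm := ?_
            m_coercive := hcoer
            garding := ?_ }, rfl, rfl, rfl⟩
  · intro y hy
    ext1 k
    refine eq_zero_of_forall_inner_fn hΩ fun v => ?_
    have := hy (inclL _ k v)
    rwa [embL_inclL, real_inner_comm, inner_inclL, real_inner_comm] at this
  · intro x y
    rw [PiLp.inner_apply, PiLp.inner_apply]
    exact Finset.sum_congr rfl fun k _ => mulL_comm (hc k) (x k) (y k)
  · intro u
    refine (hG u).trans (add_le_add le_rfl ?_)
    rw [div_mul_eq_mul_div, le_div_iff₀ hc₀, mul_assoc, mul_comm _ c₀]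
    exact mul_le_mul_of_nonneg_left (hcoer _) hlam

end Operators


/-! ### Slices of square integrable functions on a product -/

section Slices

/-- A map into a separable metric space is measurable as soon as its distance to every point is
measurable. -/
theorem measurable_of_measurable_edist {X α : Type*} [MeasurableSpace X] [PseudoEMetricSpace α]
    [SecondCountableTopology α] [MeasurableSpace α] [BorelSpace α] {f : X → α}
    (h : ∀ z, Measurable fun t => edist (f t) z) : Measurable f := by
  refine measurable_of_isClosed fun s hs => ?_
  obtain ⟨D, hDs, hDc, hDd⟩ :=
    (TopologicalSpace.IsSeparable.of_separableSpace s).exists_countable_dense_subset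
  have e : f ⁻¹' s = {t | ⨅ z ∈ D, edist (f t) z = 0} := by
    ext t
    have hcl : closure D = s := (closure_minimal hDs hs).antisymm hDd
    rw [mem_preimage, mem_ofPred_eq, ← hcl, Metric.mem_closure_iff_infEDist_zero]
    rfl
  rw [e]
  exact measurableSet_eq_fun (Measurable.biInf D hDc fun z _ => h z) measurable_const

theorem eLpNorm_two_eq {Y : Type*} [MeasurableSpace Y] {ν : Measure Y} {F : Type*}
    [NormedAddCommGroup F] (f : Y → F) :
    eLpNorm f 2 ν = (∫⁻ y, ‖f y‖ₑ ^ (2 : ℝ) ∂ν) ^ (1 / 2 : ℝ) := by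
  rw [eLpNorm_eq_lintegral_rpow_enorm_toReal (by norm_num) (by norm_num)]
  norm_num

/-- A square integrable function on a product is a square integrable function with values in
`L²`. -/
theorem exists_slices {X Y : Type*} [MeasurableSpace X] [MeasurableSpace Y] {μ : Measure X}
    {ν : Measure Y} [SFinite μ] [SFinite ν] [SecondCountableTopology (Lp ℝ 2 ν)] {q : X × Y → ℝ}
    (hq : MemLp q 2 (μ.prod ν)) :
    ∃ f : Lp (Lp ℝ 2 ν) 2 μ, ∀ᵐ t ∂μ, f t =ᵐ[ν] fun y => q (t, y) := by
  classical
  set q' : X × Y → ℝ := hq.1.mk q with hq'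
  have hqm : Measurable q' := hq.1.stronglyMeasurable_mk.measurable
  have hqq : q =ᵐ[μ.prod ν] q' := hq.1.ae_eq_mk
  have hq2 : MemLp q' 2 (μ.prod ν) := (memLp_congr_ae hqq).mp hq
  set a : X → ℝ≥0∞ := fun t => ∫⁻ y, ‖q' (t, y)‖ₑ ^ (2 : ℝ) ∂ν with ha
  have ham : Measurable a := (hqm.enorm.pow_const _).lintegral_prod_right'
  have hat : ∫⁻ t, a t ∂μ < ⊤ := by
    rw [← lintegral_prod _ (hqm.enorm.pow_const _).aemeasurable]
    have := (eLpNorm_lt_top_iff_lintegral_rpow_enorm_lt_top (f := q') (μ := μ.prod ν)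
      (p := 2) (by norm_num) (by norm_num)).mp hq2.2
    simpa using this
  have hmem : ∀ t, a t < ⊤ → MemLp (fun y => q' (t, y)) 2 ν := fun t ht => by
    refine ⟨(hqm.comp measurable_prodMk_left).aestronglyMeasurable, ?_⟩
    rw [eLpNorm_two_eq]
    exact ENNReal.rpow_lt_top_of_nonneg (by norm_num) ht.ne
  set G : X → Lp ℝ 2 ν := fun t => if h : a t < ⊤ then (hmem t h).toLp _ else 0 with hG
  have hGt : ∀ t (h : a t < ⊤), G t = (hmem t h).toLp _ := fun t h => dif_pos h
  have hS : MeasurableSet {t | a t < ⊤} := measurableSet_lt ham measurable_const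
  borelize ↥(Lp ℝ 2 ν)
  have hGm : Measurable G := by
    refine measurable_of_measurable_edist fun z => ?_
    have e : (fun t => edist (G t) z) = fun t => if t ∈ {t | a t < ⊤} then
        (∫⁻ y, ‖q' (t, y) - z y‖ₑ ^ (2 : ℝ) ∂ν) ^ (1 / 2 : ℝ) else edist 0 z := by
      funext t
      by_cases h : a t < ⊤
      · rw [hGt t h, if_pos (show t ∈ {t | a t < ⊤} from h), Lp.edist_def, eLpNorm_two_eq]
        congr 1
        refine lintegral_congr_ae ?_
        filter_upwards [(hmem t h).coeFn_toLp] with y hy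
        rw [Pi.sub_apply, hy]
      · rw [if_neg (show ¬ t ∈ {t | a t < ⊤} from h), hG]
        simp only [dif_neg h]
    rw [e]
    refine Measurable.ite hS (Measurable.pow_const ?_ _) measurable_const
    exact ((hqm.sub ((Lp.stronglyMeasurable z).measurable.comp
      measurable_snd)).enorm.pow_const _).lintegral_prod_right'
  have hafin : ∀ᵐ t ∂μ, a t < ⊤ := ae_lt_top ham hat.ne
  have hGL : MemLp G 2 μ := by
    refine ⟨hGm.stronglyMeasurable.aestronglyMeasurable, ?_⟩
    rw [eLpNorm_two_eq]
    refine ENNReal.rpow_lt_top_of_nonneg (by norm_num) (ne_of_lt ?_)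
    refine lt_of_eq_of_lt (lintegral_congr_ae ?_) hat
    filter_upwards [hafin] with t ht
    rw [hGt t ht, Lp.enorm_def, eLpNorm_congr_ae (hmem t ht).coeFn_toLp, eLpNorm_two_eq,
      ← ENNReal.rpow_mul]
    norm_num [ha]
  refine ⟨hGL.toLp G, ?_⟩
  filter_upwards [hGL.coeFn_toLp, hafin, Measure.ae_ae_of_ae_prod hqq] with t h1 h2 h3
  rw [h1, hGt t h2]
  filter_upwards [(hmem t h2).coeFn_toLp, h3] with y h4 h5
  rw [h4, h5]

end Slices


/-! ### The weak formulation and the abstract problem -/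

section Translation

/-- The functionals `⟪x, ·⟫`. -/
noncomputable def rieszL (X : Type*) [NormedAddCommGroup X] [InnerProductSpace ℝ X] :
    X →L[ℝ] StrongDual ℝ X :=
  (innerₗ X).mkContinuous₂ 1 fun x y => by
    rw [one_mul]; exact abs_real_inner_le_norm x y

theorem rieszL_apply {X : Type*} [NormedAddCommGroup X] [InnerProductSpace ℝ X] (x y : X) :
    rieszL X x y = inner ℝ x y := rfl

/-- A function with values in `X`, as a function with values in the dual of `X`. -/
noncomputable def rieszLp {S X : Type*} [MeasurableSpace S] {μ : Measure S} [NormedAddCommGroup X]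
    [InnerProductSpace ℝ X] (f : Lp X 2 μ) : Lp (StrongDual ℝ X) 2 μ := (rieszL X).compLp f

theorem coeFn_rieszLp {S X : Type*} [MeasurableSpace S] {μ : Measure S} [NormedAddCommGroup X]
    [InnerProductSpace ℝ X] (f : Lp X 2 μ) : ∀ᵐ t ∂μ, ∀ w, rieszLp f t w = inner ℝ (f t) w := by
  filter_upwards [(rieszL X).coeFn_compLp f] with t ht w
  rw [rieszLp, ht, rieszL_apply]

/-- Testing with `η(t) v`, as a weak integral: both sides of the distributional equation are the
values at `v` of a vector that does not depend on `v`. -/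
theorem integral_mul_inner_eq_inner_integral {X : Type*} [NormedAddCommGroup X]
    [InnerProductSpace ℝ X] [CompleteSpace X] {T : ℝ} {η : ℝ → ℝ} (hη : Continuous η) (v : X)
    (f : Lp X 2 (volume.restrict (Ioo 0 T))) :
    ∫ t in Ioo 0 T, η t * inner ℝ (f t) v = inner ℝ (∫ t in Ioo 0 T, η t • f t) v := by
  have hi : IntegrableOn (fun t => η t • f t) (Icc 0 T) :=
    ((integrableOn_Icc_iff_integrableOn_Ioo).mpr (integrableOn_of_Lp f)).continuousOn_smul
      hη.continuousOn isCompact_Icc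
  rw [real_inner_comm, ← integral_inner (hi.mono_set Ioo_subset_Icc_self)]
  refine integral_congr_ae (ae_of_all _ fun t => ?_)
  simp only [inner_smul_right, real_inner_comm]

variable {d : ℕ} {Ω : Set (E d)} {κ : Fin 2 → E d → E d → ℝ} {Q : E d → E d → ℝ}
  {N : Fin 2 → Fin d → E d → PeriodicH1 d} {M : Fin 2 → E d → PeriodicH1 d} {T : ℝ}

theorem eq_of_forall_inner_inclL {X : Type*} [NormedAddCommGroup X] [InnerProductSpace ℝ X]
    {x y : PiLp 2 (fun _ : Fin 2 => X)}
    (h : ∀ k w, inner ℝ x (inclL X k w) = inner ℝ y (inclL X k w)) : x = y := by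
  ext1 k
  refine ext_inner_right ℝ fun w => ?_
  rw [← inner_inclL, ← inner_inclL, h]

/-- It suffices to test the abstract equation with the elements of the two factors. -/
theorem isDistribSolution_iff_inclL (P : ParabolicOperator (VV Ω) (HH Ω))
    (U F : Lp (VV Ω) 2 (volume.restrict (Ioo 0 T))) :
    P.IsDistribSolution U F ↔ ∀ (k : Fin 2) (η : ℝ → ℝ), ContDiff ℝ ∞ η → HasCompactSupport η →
      tsupport η ⊆ Ioo 0 T → ∀ w : H10 Ω,
      ∫ t in Ioo 0 T, deriv η t * inner ℝ (P.S (U t)) (inclL _ k w)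
        = - ∫ t in Ioo 0 T, η t * inner ℝ ((F - P.A.compLp U : Lp (VV Ω) 2 _) t) (inclL _ k w) := by
  have e1 : ∀ (η : ℝ → ℝ) (v : VV Ω), ∫ t in Ioo 0 T, deriv η t * inner ℝ (P.S.compLp U t) v
      = ∫ t in Ioo 0 T, deriv η t * inner ℝ (P.S (U t)) v := fun η v => by
    refine integral_congr_ae ?_
    filter_upwards [P.S.coeFn_compLp U] with t ht
    rw [ht]
  rw [P.isDistribSolution_iff]
  constructor
  · intro h k η hη hc hs w
    rw [← e1]
    exact h η hη hc hs _
  · intro h η hη hc hs v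
    rw [integral_mul_inner_eq_inner_integral (hη.continuous_deriv (by simp)),
      integral_mul_inner_eq_inner_integral hη.continuous, ← inner_neg_left]
    congr 1
    refine eq_of_forall_inner_inclL fun k w => ?_
    rw [inner_neg_left, ← integral_mul_inner_eq_inner_integral (hη.continuous_deriv (by simp)),
      ← integral_mul_inner_eq_inner_integral hη.continuous, e1]
    exact h k η hη hc hs w

/-- A source in `L²(Ω)` acting on both equations, as an element of `V × V`. -/
noncomputable def sourceL (Ω : Set (E d)) : L2 Ω →L[ℝ] VV Ω :=
  pairL fun _ => ContinuousLinearMap.adjoint (fnL Ω)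

theorem inner_sourceL (f : L2 Ω) (k : Fin 2) (w : H10 Ω) :
    inner ℝ (sourceL Ω f) (inclL _ k w) = ∫ x in Ω, f x * w.fn x := by
  rw [inner_inclL]
  change inner ℝ (ContinuousLinearMap.adjoint (fnL Ω) f) w = _
  rw [ContinuousLinearMap.adjoint_inner_left, fnL_apply, L2.inner_def]
  refine integral_congr_ae (ae_of_all _ fun x => ?_)
  exact mul_comm _ _

variable {c : Fin 2 → E d → ℝ} (hc : ∀ k, MemLp (c k) ∞ (volume.restrict Ω))

theorem inner_S_inclL {P : ParabolicOperator (VV Ω) (HH Ω)} (hι : P.ι = embL Ω)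
    (hm : P.m = weightOp hc) (u : VV Ω) (k : Fin 2) (w : H10 Ω) :
    inner ℝ (P.S u) (inclL _ k w) = ∫ x in Ω, c k x * (u k).fn x * w.fn x := by
  rw [P.inner_S, hι, hm, embL_inclL, inner_inclL]
  exact inner_mulL_real (hc k) (u k).fn w.fn

theorem inner_systemOp_inclL (h : BoundedCoefficients Ω κ Q N M) (u : VV Ω) (k : Fin 2)
    (w : H10 Ω) : inner ℝ (systemOp h u) (inclL _ k w) = homForm κ Q N M k (fun l => u l) w := by
  rw [inner_inclL]
  exact inner_spatialOp h k u w

/-- The spatial form and the source, integrated in time, as inner products in `L²(0,T;V × V)`. -/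
theorem integral_homForm_eq_inner (h : BoundedCoefficients Ω κ Q N M) {u : Fin 2 → L2V Ω T}
    {U : Lp (VV Ω) 2 (volume.restrict (Ioo 0 T))}
    (hU : ∀ᵐ t ∂(volume.restrict (Ioo 0 T)), ∀ k, U t k = u k t) (k : Fin 2) (φ : L2V Ω T) :
    ∫ t in Ioo 0 T, homForm κ Q N M k (fun l => u l t) (φ t)
      = inner ℝ ((systemOp h).compLp U) ((inclL _ k).compLp φ) := by
  rw [L2.inner_def]
  refine integral_congr_ae ?_
  filter_upwards [hU, (systemOp h).coeFn_compLp U, (inclL (H10 Ω) k).coeFn_compLp φ]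
    with t h1 h2 h3
  rw [h2, h3, inner_systemOp_inclL]
  simp only [h1]

theorem integral_source_eq_inner {q : ℝ × E d → ℝ}
    {q' : Lp (L2 Ω) 2 (volume.restrict (Ioo 0 T))}
    (hq' : ∀ᵐ t ∂(volume.restrict (Ioo 0 T)), q' t =ᵐ[volume.restrict Ω] fun x => q (t, x))
    (k : Fin 2) (φ : L2V Ω T) :
    ∫ t in Ioo 0 T, ∫ x in Ω, q (t, x) * (φ t).fn x
      = inner ℝ ((sourceL Ω).compLp q') ((inclL _ k).compLp φ) := by
  rw [L2.inner_def]
  refine integral_congr_ae ?_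
  filter_upwards [hq', (sourceL Ω).coeFn_compLp q', (inclL (H10 Ω) k).coeFn_compLp φ]
    with t h1 h2 h3
  rw [h2, h3, inner_sourceL]
  refine integral_congr_ae ?_
  filter_upwards [h1] with x hx
  rw [hx]

theorem integral_inner_S_inclL {C : Fin 2 → E d → E d → ℝ}
    (hc : ∀ k, MemLp (homCapacity C k) ∞ (volume.restrict Ω))
    {P : ParabolicOperator (VV Ω) (HH Ω)} (hι : P.ι = embL Ω) (hm : P.m = weightOp hc)
    {u : Fin 2 → L2V Ω T} {U : Lp (VV Ω) 2 (volume.restrict (Ioo 0 T))}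
    (hU : ∀ᵐ t ∂(volume.restrict (Ioo 0 T)), ∀ k, U t k = u k t)
    (k : Fin 2) (η : ℝ → ℝ) (w : H10 Ω) :
    ∫ t in Ioo 0 T, deriv η t * inner ℝ (P.S (U t)) (inclL _ k w)
      = ∫ t in Ioo 0 T, deriv η t * (∫ x in Ω, homCapacity C k x * (u k t).fn x * w.fn x) := by
  refine integral_congr_ae ?_
  filter_upwards [hU] with t ht
  rw [inner_S_inclL hc hι hm, ht]

/-- The variational identity of the `k`-th equation, in terms of inner products in
`L²(0,T;V × V)`. -/
theorem variational_iff (h : BoundedCoefficients Ω κ Q N M)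
    {q : ℝ × E d → ℝ} {q' : Lp (L2 Ω) 2 (volume.restrict (Ioo 0 T))}
    (hq' : ∀ᵐ t ∂(volume.restrict (Ioo 0 T)), q' t =ᵐ[volume.restrict Ω] fun x => q (t, x))
    {u : Fin 2 → L2V Ω T} {U : Lp (VV Ω) 2 (volume.restrict (Ioo 0 T))}
    (hU : ∀ᵐ t ∂(volume.restrict (Ioo 0 T)), ∀ k, U t k = u k t) (k : Fin 2) (φ : L2V Ω T)
    (a : ℝ) :
    a + (∫ t in Ioo 0 T, homForm κ Q N M k (fun l => u l t) (φ t))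
        = ∫ t in Ioo 0 T, ∫ x in Ω, q (t, x) * (φ t).fn x ↔
      a = inner ℝ ((sourceL Ω).compLp q' - (systemOp h).compLp U) ((inclL _ k).compLp φ) := by
  rw [integral_homForm_eq_inner h hU, integral_source_eq_inner hq' k, inner_sub_left,
    eq_sub_iff_add_eq]

theorem integral_mul_inner_inclL (R : Lp (VV Ω) 2 (volume.restrict (Ioo 0 T))) (k : Fin 2)
    {η : ℝ → ℝ} (hη : Continuous η) (w : H10 Ω) :
    ∫ t in Ioo 0 T, η t * inner ℝ (R t) (inclL _ k w) = inner ℝ R ((inclL _ k).compLp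
      ((memLp_of_continuous_Ioo (f := fun t => η t • w) (by fun_prop) T).toLp _)) := by
  rw [ParabolicOperator.integral_mul_inner_eq_inner hη]
  congr 1
  refine Lp.ext ?_
  filter_upwards [(inclL (H10 Ω) k).coeFn_compLp
      ((memLp_of_continuous_Ioo (f := fun t => η t • w) (by fun_prop) T).toLp _),
    (memLp_of_continuous_Ioo (f := fun t => η t • w) (by fun_prop) T).coeFn_toLp,
    (memLp_of_continuous_Ioo (f := fun t => η t • inclL (H10 Ω) k w)
      (by fun_prop) T).coeFn_toLp] with t h1 h2 h3
  rw [h1, h2, h3, map_smul]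

/-- The `k`-th component of `R ∈ L²(0,T;V × V)`, as an element of `L²(0,T;V')`. -/
noncomputable def coordFunctional (R : Lp (VV Ω) 2 (volume.restrict (Ioo 0 T))) (k : Fin 2) :
    L2V' Ω T := rieszLp ((prL (H10 Ω) k).compLp R)

theorem coeFn_coordFunctional (R : Lp (VV Ω) 2 (volume.restrict (Ioo 0 T))) (k : Fin 2) :
    ∀ᵐ t ∂(volume.restrict (Ioo 0 T)), ∀ w,
      coordFunctional R k t w = inner ℝ (R t) (inclL _ k w) := by
  filter_upwards [coeFn_rieszLp ((prL (H10 Ω) k).compLp R),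
    (prL (H10 Ω) k).coeFn_compLp R] with t h1 h2 w
  rw [coordFunctional, h1, h2, inner_inclL, prL_apply]

theorem integral_coordFunctional (R : Lp (VV Ω) 2 (volume.restrict (Ioo 0 T))) (k : Fin 2)
    (φ : L2V Ω T) : ∫ t in Ioo 0 T, coordFunctional R k t (φ t)
      = inner ℝ R ((inclL _ k).compLp φ) := by
  rw [L2.inner_def]
  refine integral_congr_ae ?_
  filter_upwards [coeFn_coordFunctional R k, (inclL (H10 Ω) k).coeFn_compLp φ] with t h1 h2
  rw [h1, h2]

/-- A weak solution of the homogenized system solves the abstract problem. -/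
theorem isDistribSolution_of_isWeakSolution {C : Fin 2 → E d → E d → ℝ}
    (hc : ∀ k, MemLp (homCapacity C k) ∞ (volume.restrict Ω))
    (h : BoundedCoefficients Ω κ Q N M) {P : ParabolicOperator (VV Ω) (HH Ω)}
    (hι : P.ι = embL Ω) (hm : P.m = weightOp hc) (hA : P.A = systemOp h)
    {q : ℝ × E d → ℝ} {q' : Lp (L2 Ω) 2 (volume.restrict (Ioo 0 T))}
    (hq' : ∀ᵐ t ∂(volume.restrict (Ioo 0 T)), q' t =ᵐ[volume.restrict Ω] fun x => q (t, x))
    {g : Fin 2 → L2 Ω} {u : Fin 2 → L2V Ω T} {U : Lp (VV Ω) 2 (volume.restrict (Ioo 0 T))}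
    (hU : ∀ᵐ t ∂(volume.restrict (Ioo 0 T)), ∀ k, U t k = u k t)
    (hw : IsWeakSolution Ω T C κ Q N M q g u) :
    (∃ W : ℝ → HH Ω, ContinuousOn W (Icc 0 T) ∧
        (∀ᵐ t ∂(volume.restrict (Ioo 0 T)), W t = P.ι (U t)) ∧ W 0 = WithLp.toLp 2 g) ∧
      P.IsDistribSolution U ((sourceL Ω).compLp q') := by
  refine ⟨?_, (isDistribSolution_iff_inclL P _ _).mpr ?_⟩
  · choose w hw1 hw2 hw3 using fun k => (hw k).1
    refine ⟨fun t => WithLp.toLp 2 fun k => w k t, ?_, ?_, ?_⟩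
    · exact (PiLp.continuous_toLp 2 _).comp_continuousOn (continuousOn_pi.mpr hw1)
    · filter_upwards [ae_all_iff.mpr hw2, hU] with t h1 h2
      ext1 k
      rw [hι, embL_apply, h2]
      exact h1 k
    · ext1 k
      exact hw3 k
  · intro k η hη hcs hs w
    obtain ⟨-, f, hf, hvar⟩ := hw k
    have hm1 := memLp_of_continuous_Ioo (f := fun t => η t • w)
      (hη.continuous.smul continuous_const) T
    have e : ∫ t in Ioo 0 T, η t * f t w = ∫ t in Ioo 0 T, f t (hm1.toLp _ t) := by
      refine integral_congr_ae ?_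
      filter_upwards [hm1.coeFn_toLp] with t h1
      rw [h1, map_smul, smul_eq_mul]
    have hv := (variational_iff h hq' hU k _ _).mp (hvar (hm1.toLp _))
    rw [hA]
    exact (integral_inner_S_inclL hc hι hm hU k η w).trans ((hf η hη hcs hs w).trans
      (congrArg Neg.neg (e.trans (hv.trans (integral_mul_inner_inclL _ k hη.continuous w).symm))))

/-- A solution of the abstract problem is a weak solution of the homogenized system. -/
theorem isWeakSolution_of_isDistribSolution {C : Fin 2 → E d → E d → ℝ}
    (hc : ∀ k, MemLp (homCapacity C k) ∞ (volume.restrict Ω))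
    (h : BoundedCoefficients Ω κ Q N M) {P : ParabolicOperator (VV Ω) (HH Ω)}
    (hι : P.ι = embL Ω) (hm : P.m = weightOp hc) (hA : P.A = systemOp h)
    {q : ℝ × E d → ℝ} {q' : Lp (L2 Ω) 2 (volume.restrict (Ioo 0 T))}
    (hq' : ∀ᵐ t ∂(volume.restrict (Ioo 0 T)), q' t =ᵐ[volume.restrict Ω] fun x => q (t, x))
    {g : Fin 2 → L2 Ω} {u : Fin 2 → L2V Ω T} {U : Lp (VV Ω) 2 (volume.restrict (Ioo 0 T))}
    (hU : ∀ᵐ t ∂(volume.restrict (Ioo 0 T)), ∀ k, U t k = u k t)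
    {W : ℝ → HH Ω} (hW1 : ContinuousOn W (Icc 0 T))
    (hW2 : ∀ᵐ t ∂(volume.restrict (Ioo 0 T)), W t = P.ι (U t)) (hW3 : W 0 = WithLp.toLp 2 g)
    (hd : P.IsDistribSolution U ((sourceL Ω).compLp q')) :
    IsWeakSolution Ω T C κ Q N M q g u := by
  rw [isDistribSolution_iff_inclL, hA] at hd
  intro k
  refine ⟨⟨fun t => W t k, ?_, ?_, ?_⟩,
    coordFunctional ((sourceL Ω).compLp q' - (systemOp h).compLp U) k, ?_, ?_⟩
  · exact (prL (L2 Ω) k).continuous.comp_continuousOn hW1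
  · filter_upwards [hW2, hU] with t h1 h2
    rw [h1, hι, embL_apply, h2]
  · change W 0 k = g k
    rw [hW3]
  · intro η hη hcs hs w
    refine (integral_inner_S_inclL hc hι hm hU k η w).symm.trans ((hd k η hη hcs hs w).trans
      (congrArg Neg.neg ?_))
    refine integral_congr_ae ?_
    filter_upwards [coeFn_coordFunctional ((sourceL Ω).compLp q' - (systemOp h).compLp U) k]
      with t h1
    rw [h1]
  · exact fun φ => (variational_iff h hq' hU k φ _).mpr (integral_coordFunctional _ k φ)

/-- The pair `(u₁, u₂)` as an element of `L²(0,T;V × V)`. -/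
theorem exists_combine (u : Fin 2 → L2V Ω T) :
    ∃ U : Lp (VV Ω) 2 (volume.restrict (Ioo 0 T)),
      ∀ᵐ t ∂(volume.restrict (Ioo 0 T)), ∀ k, U t k = u k t := by
  refine ⟨(inclL (H10 Ω) 0).compLp (u 0) + (inclL (H10 Ω) 1).compLp (u 1), ?_⟩
  filter_upwards [Lp.coeFn_add ((inclL (H10 Ω) 0).compLp (u 0)) ((inclL (H10 Ω) 1).compLp (u 1)),
    (inclL (H10 Ω) 0).coeFn_compLp (u 0), (inclL (H10 Ω) 1).coeFn_compLp (u 1)] with t h1 h2 h3 k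
  rw [h1, Pi.add_apply, h2, h3, PiLp.add_apply, inclL_apply, inclL_apply]
  fin_cases k <;> simp

/-- Well-posedness of the homogenized system, given its representation as an abstract problem. -/
theorem existsUnique_isWeakSolution (hT : 0 < T) {C : Fin 2 → E d → E d → ℝ}
    (hc : ∀ k, MemLp (homCapacity C k) ∞ (volume.restrict Ω))
    (h : BoundedCoefficients Ω κ Q N M) {P : ParabolicOperator (VV Ω) (HH Ω)}
    (hι : P.ι = embL Ω) (hm : P.m = weightOp hc) (hA : P.A = systemOp h)
    {q : ℝ × E d → ℝ} (hq : MemLp q 2 ((volume.restrict (Ioo 0 T)).prod (volume.restrict Ω)))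
    (g : Fin 2 → L2 Ω) : ∃! u : Fin 2 → L2V Ω T, IsWeakSolution Ω T C κ Q N M q g u := by
  have : Fact ((2 : ℝ≥0∞) ≠ ⊤) := ⟨by norm_num⟩
  obtain ⟨q', hq'⟩ := exists_slices hq
  obtain ⟨U, W, hW1, hW2, hW3, hUd⟩ :=
    P.exists_distribSolution hT (WithLp.toLp 2 g) ((sourceL Ω).compLp q')
  have hU : ∀ᵐ t ∂(volume.restrict (Ioo 0 T)), ∀ k, U t k = (prL (H10 Ω) k).compLp U t := by
    filter_upwards [ae_all_iff.mpr fun k => (prL (H10 Ω) k).coeFn_compLp U] with t ht k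
    rw [ht, prL_apply]
  refine ⟨fun k => (prL (H10 Ω) k).compLp U,
    isWeakSolution_of_isDistribSolution hc h hι hm hA hq' hU hW1 hW2 hW3 hUd, fun u hu => ?_⟩
  obtain ⟨U', hU'⟩ := exists_combine u
  obtain ⟨⟨W', hW1', hW2', hW3'⟩, hUd'⟩ := 
    isDistribSolution_of_isWeakSolution hc h hι hm hA hq' hU' hu
  have hz : U' - U = 0 := by
    refine P.eq_zero_of_isDistribSolution hT (W := fun t => W' t - W t) ?_ (hW1'.sub hW1) ?_ ?_
    · rw [P.isDistribSolution_iff] at hUd hUd' ⊢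
      intro η hη hcs hs v
      have a := hUd η hη hcs hs v
      have b := hUd' η hη hcs hs v
      simp_rw [ParabolicOperator.integral_mul_inner_eq_inner (hη.continuous_deriv (by simp)) v,
        ParabolicOperator.integral_mul_inner_eq_inner hη.continuous v] at a b ⊢
      have e1 : P.S.compLp (U' - U) = P.S.compLp U' - P.S.compLp U :=
        (P.S.compLpL 2 (volume.restrict (Ioo 0 T))).map_sub U' U
      have e2 : P.A.compLp (U' - U) = P.A.compLp U' - P.A.compLp U :=
        (P.A.compLpL 2 (volume.restrict (Ioo 0 T))).map_sub U' U
      rw [e1, e2]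
      simp only [inner_sub_left, inner_zero_left] at a b ⊢
      linarith
    · filter_upwards [hW2, hW2', Lp.coeFn_sub U' U] with t h1 h2 h3
      rw [h1, h2, h3, Pi.sub_apply, map_sub]
    · simp only [hW3, hW3', sub_self]
  rw [sub_eq_zero.mp hz] at hU'
  funext k
  refine Lp.ext ?_
  filter_upwards [hU, hU'] with t h1 h2
  rw [← h1, ← h2]

end Translation


/-! ### Lipschitz multipliers of `H^1_0(Ω)` -/

section Multipliers

variable {d : ℕ} {Ω : Set (E d)}

theorem norm_gradient (f : E d → ℝ) (x : E d) : ‖gradient f x‖ = ‖fderiv ℝ f x‖ :=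
  (InnerProductSpace.toDual ℝ (E d)).symm.norm_map _

/-- Mollifications of a Lipschitz function converge uniformly, with the same bound on the
gradients. -/
theorem exists_smooth_approx {g : E d → ℝ} {L : ℝ≥0} (hg : LipschitzWith L g) :
    ∃ θ : ℕ → E d → ℝ, (∀ n, ContDiff ℝ ∞ (θ n)) ∧ (∀ n x, ‖gradient (θ n) x‖ ≤ L) ∧
      ∀ n x, |θ n x - g x| ≤ L * (1 / ((n : ℝ) + 1)) := by
  let φ : ℕ → ContDiffBump (0 : E d) := fun n =>
    { rIn := 1 / ((n : ℝ) + 1) / 2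
      rOut := 1 / ((n : ℝ) + 1)
      rIn_pos := by positivity
      rIn_lt_rOut := half_lt_self (by positivity) }
  have hgi : LocallyIntegrable g volume := hg.continuous.locallyIntegrable
  refine ⟨fun n => convolution ((φ n).normed volume) g (ContinuousLinearMap.lsmul ℝ ℝ) volume,
    fun n => ?_, fun n x => ?_, fun n x => ?_⟩
  · exact ((φ n).hasCompactSupport_normed (μ := volume)).contDiff_convolution_left _
      (φ n).contDiff_normed hgi
  · rw [norm_gradient]
    refine norm_fderiv_le_of_lipschitz ℝ (LipschitzWith.of_dist_le_mul fun x y => ?_)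
    have hex := ((φ n).hasCompactSupport_normed (μ := volume)).convolutionExists_left
      (ContinuousLinearMap.lsmul ℝ ℝ) (φ n).continuous_normed hgi
    simp only [dist_eq_norm, convolution_def]
    rw [← dist_eq_norm x y, ← integral_sub (hex x) (hex y)]
    have hb : ∀ t, ‖ContinuousLinearMap.lsmul ℝ ℝ ((φ n).normed volume t) (g (x - t))
        - ContinuousLinearMap.lsmul ℝ ℝ ((φ n).normed volume t) (g (y - t))‖
        ≤ (φ n).normed volume t * (L * dist x y) := fun t => by
      rw [← map_sub, ContinuousLinearMap.lsmul_apply, norm_smul,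
        Real.norm_of_nonneg ((φ n).nonneg_normed t), ← dist_eq_norm]
      refine mul_le_mul_of_nonneg_left ?_ ((φ n).nonneg_normed t)
      simpa using hg.dist_le_mul (x - t) (y - t)
    refine (norm_integral_le_of_norm_le ((φ n).integrable_normed.mul_const _)
      (Eventually.of_forall hb)).trans ?_
    rw [integral_mul_const, (φ n).integral_normed, one_mul]
  · rw [← Real.dist_eq]
    refine (φ n).dist_normed_convolution_le hg.continuous.aestronglyMeasurable fun y hy => ?_
    exact (hg.dist_le_mul y x).trans
      (mul_le_mul_of_nonneg_left (Metric.mem_ball.mp hy).le L.coe_nonneg)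

/-- Multiplication by a smooth function acts on `H^1_0(Ω)`, with a bound that depends only on the
suprema of the function and of its gradient. -/
theorem exists_smoothMultiplier (hΩ : IsOpen Ω) {θ : E d → ℝ} (hθ : ContDiff ℝ ∞ θ) {B L : ℝ}
    (hB0 : 0 ≤ B) (hL0 : 0 ≤ L) (hB : ∀ x ∈ Ω, |θ x| ≤ B) (hL : ∀ x, ‖gradient θ x‖ ≤ L) :
    ∃ P : H10 Ω →L[ℝ] H10 Ω, (∀ v, (P v).fn =ᵐ[volume.restrict Ω] fun x => θ x * v.fn x) ∧
      ∀ v, ‖P v‖ ≤ (2 * B + L) * ‖v‖ := by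
  set μ : Measure (E d) := volume.restrict Ω with hμ
  have hBae : ∀ᵐ x ∂μ, |θ x| ≤ B := by
    filter_upwards [ae_restrict_mem hΩ.measurableSet] with x hx using hB x hx
  have hgc : Continuous (gradient θ) :=
    (InnerProductSpace.toDual ℝ (E d)).symm.continuous.comp (hθ.continuous_fderiv (by simp))
  have m1 : MemLp θ ∞ μ := memLp_top_of_bound hθ.continuous.aestronglyMeasurable B hBae
  have m2 : MemLp (gradient θ) ∞ μ :=
    memLp_top_of_bound hgc.aestronglyMeasurable L (Eventually.of_forall hL)
  set D : L2 Ω →L[ℝ] L2Vec Ω :=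
    (ContinuousLinearMap.lsmul ℝ ℝ : ℝ →L[ℝ] E d →L[ℝ] E d).flip.holderL μ ∞ 2 2 (m2.toLp _)
    with hD
  have hDf : ∀ f : L2 Ω, D f =ᵐ[μ] fun x => f x • gradient θ x := fun f => by
    filter_upwards [(ContinuousLinearMap.lsmul ℝ ℝ : ℝ →L[ℝ] E d →L[ℝ] E d).flip.coeFn_holder
      (p := ∞) (q := 2) (r := 2) (m2.toLp _) f, m2.coeFn_toLp] with x h1 h2
    refine h1.trans ?_
    rw [h2]; rfl
  set A : WithLp 2 (L2 Ω × L2Vec Ω) →L[ℝ] WithLp 2 (L2 Ω × L2Vec Ω) :=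
    ((WithLp.prodContinuousLinearEquiv 2 ℝ (L2 Ω) (L2Vec Ω)).symm :
      L2 Ω × L2Vec Ω →L[ℝ] WithLp 2 (L2 Ω × L2Vec Ω)) ∘L
    ((mulL μ ℝ (m1.toLp θ) ∘L WithLp.fstL 2 ℝ (L2 Ω) (L2Vec Ω)).prod
      (mulL μ (E d) (m1.toLp θ) ∘L WithLp.sndL 2 ℝ (L2 Ω) (L2Vec Ω)
        + D ∘L WithLp.fstL 2 ℝ (L2 Ω) (L2Vec Ω))) with hA
  have hA1 : ∀ p, (A p).fst = mulL μ ℝ (m1.toLp θ) p.fst := fun p => rfl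
  have hA2 : ∀ p, (A p).snd = mulL μ (E d) (m1.toLp θ) p.snd + D p.fst := fun p => rfl
  -- the product rule, for the generators of `H^1_0(Ω)`
  have hmaps : MapsTo A (testPairs Ω) (testPairs Ω) := by
    rintro p ⟨φ, hφ, hc, hs, h1, h2⟩
    refine ⟨θ * φ, hθ.mul hφ, hc.mul_left, (tsupport_mul_subset_right).trans hs, ?_, ?_⟩
    · rw [hA1]
      filter_upwards [coeFn_mulL m1 p.fst, h1] with x a b
      rw [a, b]; rfl
    · rw [hA2]
      filter_upwards [coeFn_mulL m1 p.snd, hDf p.fst, h1, h2,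
        Lp.coeFn_add (mulL μ (E d) (m1.toLp θ) p.snd) (D p.fst)] with x a b c e k
      rw [k, Pi.add_apply, a, b, c, e]
      have hd1 : DifferentiableAt ℝ θ x := hθ.differentiable (by simp) x
      have hd2 : DifferentiableAt ℝ φ x := hφ.differentiable (by simp) x
      simp only [gradient, fderiv_mul hd1 hd2, map_add, map_smul]
  have hcl : ∀ v : H10 Ω, A v.1 ∈ (testPairs Ω).topologicalClosure := fun v =>
    map_mem_closure A.continuous v.2 hmaps
  refine ⟨(A ∘L (testPairs Ω).topologicalClosure.subtypeL).codRestrict _ hcl,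
    fun v => coeFn_mulL m1 v.fn, fun v => ?_⟩
  have hn1 : ‖v.fn‖ ≤ ‖v‖ := WithLp.norm_fst_le _ v.1
  have hn2 : ‖v.grad‖ ≤ ‖v‖ := WithLp.norm_snd_le _ v.1
  have b1 : ‖mulL μ ℝ (m1.toLp θ) v.fn‖ ≤ B * ‖v.fn‖ := norm_mulL_le m1 hBae _
  have b2 : ‖mulL μ (E d) (m1.toLp θ) v.grad‖ ≤ B * ‖v.grad‖ := norm_mulL_le m1 hBae _
  have b3 : ‖D v.fn‖ ≤ L * ‖v.fn‖ := by
    refine Lp.norm_le_mul_norm_of_ae_le_mul ?_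
    filter_upwards [hDf v.fn] with x hx
    rw [hx, norm_smul, mul_comm]
    exact mul_le_mul_of_nonneg_right (hL x) (norm_nonneg _)
  have b4 := (norm_add_le (mulL μ (E d) (m1.toLp θ) v.grad) (D v.fn)).trans (add_le_add b2 b3)
  change ‖A v.1‖ ≤ _
  have hsq : ‖A v.1‖ ^ 2 = ‖mulL μ ℝ (m1.toLp θ) v.fn‖ ^ 2
      + ‖mulL μ (E d) (m1.toLp θ) v.grad + D v.fn‖ ^ 2 := by
    rw [WithLp.prod_norm_sq_eq_of_L2]; rfl
  have c1 : ‖A v.1‖ ≤ ‖mulL μ ℝ (m1.toLp θ) v.fn‖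
      + ‖mulL μ (E d) (m1.toLp θ) v.grad + D v.fn‖ := by
    refine (sq_le_sq₀ (norm_nonneg _) (by positivity)).mp ?_
    rw [hsq]
    have := mul_nonneg (norm_nonneg (mulL μ ℝ (m1.toLp θ) v.fn))
      (norm_nonneg (mulL μ (E d) (m1.toLp θ) v.grad + D v.fn))
    linarith [add_sq ‖mulL μ ℝ (m1.toLp θ) v.fn‖ ‖mulL μ (E d) (m1.toLp θ) v.grad + D v.fn‖]
  nlinarith [mul_le_mul_of_nonneg_left hn1 hB0, mul_le_mul_of_nonneg_left hn2 hB0,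
    mul_le_mul_of_nonneg_left hn1 hL0]

/-- A bounded sequence of operators on a Hilbert space has a weak limit along an ultrafilter. -/
theorem exists_weak_limit {V : Type*} [NormedAddCommGroup V] [InnerProductSpace ℝ V]
    [CompleteSpace V] (P : ℕ → V →L[ℝ] V) {K : ℝ} (hP : ∀ n v, ‖P n v‖ ≤ K * ‖v‖)
    (F : Ultrafilter ℕ) :
    ∃ P' : V →L[ℝ] V, ∀ v w, Tendsto (fun n => inner ℝ (P n v) w) F (𝓝 (inner ℝ (P' v) w)) := by
  have hb : ∀ v w n, |inner ℝ (P n v) w| ≤ K * ‖v‖ * ‖w‖ := fun v w n =>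
    (abs_real_inner_le_norm _ _).trans (mul_le_mul_of_nonneg_right (hP n v) (norm_nonneg _))
  have hlim : ∀ v w, ∃ b, |b| ≤ K * ‖v‖ * ‖w‖ ∧
      Tendsto (fun n => inner ℝ (P n v) w) F (𝓝 b) := by
    intro v w
    obtain ⟨b, hb1, hb2⟩ := isCompact_Icc.ultrafilter_le_nhds (F.map fun n => inner ℝ (P n v) w)
      (le_principal_iff.mpr (mem_map.mpr <| Eventually.of_forall fun n : ℕ => abs_le.mp (hb v w n)))
    exact ⟨b, abs_le.mpr hb1, hb2⟩
  choose b hb1 hb2 using hlim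
  let B : V →ₗ[ℝ] V →ₗ[ℝ] ℝ := LinearMap.mk₂ ℝ b
    (fun v v' w => tendsto_nhds_unique (hb2 (v + v') w) (by
      simpa only [map_add, inner_add_left] using (hb2 v w).add (hb2 v' w)))
    (fun r v w => tendsto_nhds_unique (hb2 (r • v) w) (by
      simpa only [map_smul, real_inner_smul_left, smul_eq_mul] using (hb2 v w).const_mul r))
    (fun v w w' => tendsto_nhds_unique (hb2 v (w + w')) (by
      simpa only [inner_add_right] using (hb2 v w).add (hb2 v w')))
    (fun r v w => tendsto_nhds_unique (hb2 v (r • w)) (by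
      simpa only [real_inner_smul_right, smul_eq_mul] using (hb2 v w).const_mul r))
  refine ⟨InnerProductSpace.continuousLinearMapOfBilin (𝕜 := ℝ) (B.mkContinuous₂ K hb1),
    fun v w => ?_⟩
  rw [InnerProductSpace.continuousLinearMapOfBilin_apply]
  exact hb2 v w

/-- Division by a positive Lipschitz weight acts on `H^1_0(Ω)`. It is the weak limit of the
multiplications by mollifications of the reciprocal weight. -/
theorem exists_lipschitzDivision (hΩ : IsOpen Ω) {c : E d → ℝ}
    (hc : MemLp c ∞ (volume.restrict Ω)) {L : ℝ≥0} (hL : LipschitzOnWith L c Ω) {c₀ : ℝ}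
    (hc₀ : 0 < c₀) (hcpos : ∀ x ∈ Ω, c₀ ≤ c x) :
    ∃ P : H10 Ω →L[ℝ] H10 Ω, ∀ (u : L2 Ω) (v : H10 Ω),
      ∫ x in Ω, c x * u x * (P v).fn x = ∫ x in Ω, u x * v.fn x := by
  have hinv : LipschitzOnWith (L / (c₀.toNNReal * c₀.toNNReal)) (fun x => (c x)⁻¹) Ω := by
    refine LipschitzOnWith.of_dist_le_mul fun x hx y hy => ?_
    have hx0 := hc₀.trans_le (hcpos x hx)
    have hy0 := hc₀.trans_le (hcpos y hy)
    have e : (c x)⁻¹ - (c y)⁻¹ = (c y - c x) / (c x * c y) := by field_simp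
    have h1 := hL.dist_le_mul x hx y hy
    rw [Real.dist_eq, abs_sub_comm] at h1
    rw [Real.dist_eq, e, abs_div, abs_of_pos (mul_pos hx0 hy0)]
    push_cast
    rw [Real.coe_toNNReal _ hc₀.le, div_mul_eq_mul_div]
    exact div_le_div₀ (by positivity) h1 (by positivity)
      (mul_le_mul (hcpos x hx) (hcpos y hy) hc₀.le hx0.le)
  obtain ⟨g, hg, hgc⟩ := hinv.extend_real
  obtain ⟨θ, hθ, hθL, hθg⟩ := exists_smooth_approx hg
  set K : ℝ := ((L / (c₀.toNNReal * c₀.toNNReal) : ℝ≥0) : ℝ) with hK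
  have hK0 : 0 ≤ K := NNReal.coe_nonneg _
  have hθB : ∀ n, ∀ x ∈ Ω, |θ n x| ≤ c₀⁻¹ + K := by
    intro n x hx
    have h1 := hθg n x
    have h2 : |g x| ≤ c₀⁻¹ := by
      rw [← hgc hx, abs_of_pos (inv_pos.mpr (hc₀.trans_le (hcpos x hx)))]
      exact inv_anti₀ hc₀ (hcpos x hx)
    have h3 : K * (1 / ((n : ℝ) + 1)) ≤ K * 1 := by
      refine mul_le_mul_of_nonneg_left ?_ hK0
      rw [div_le_one (by positivity)]
      linarith [(Nat.cast_nonneg n : (0 : ℝ) ≤ n)]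
    have h4 := abs_add_le (θ n x - g x) (g x)
    rw [sub_add_cancel] at h4
    linarith
  -- the bound on the multipliers does not depend on `n`
  choose P hP1 hP2 using fun n =>
    exists_smoothMultiplier hΩ (hθ n) (by positivity) hK0 (hθB n) (hθL n)
  obtain ⟨P', hP'⟩ := exists_weak_limit P hP2 (hyperfilter ℕ)
  refine ⟨P', fun u v => ?_⟩
  have hrep : ∀ w : H10 Ω, ∫ x in Ω, c x * u x * w.fn x
      = inner ℝ w (ContinuousLinearMap.adjoint (fnL Ω) (coefL hc u)) := fun w => by
    rw [ContinuousLinearMap.adjoint_inner_right, real_inner_comm, fnL_apply, inner_mulL_real]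
  have ht1 : Tendsto (fun n => ∫ x in Ω, c x * u x * (P n v).fn x) (hyperfilter ℕ)
      (𝓝 (∫ x in Ω, c x * u x * (P' v).fn x)) := by
    simp_rw [hrep]
    exact hP' v _
  refine tendsto_nhds_unique ht1 (Tendsto.mono_left ?_ Nat.hyperfilter_le_atTop)
  have hi := integrable_mul_mul hc u v.fn
  have hi2 : Integrable (fun x => u x * v.fn x) (volume.restrict Ω) := by
    refine (L2.integrable_inner (𝕜 := ℝ) u v.fn).congr (ae_of_all _ fun x => ?_)
    exact mul_comm _ _
  rw [tendsto_iff_dist_tendsto_zero]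
  refine squeeze_zero (g := fun n : ℕ => K * (1 / ((n : ℝ) + 1))
    * ∫ x in Ω, ‖c x * u x * v.fn x‖) (fun _ => dist_nonneg) (fun n => ?_) ?_
  · rw [dist_eq_norm, ← integral_sub (integrable_mul_mul hc u (P n v).fn) hi2,
      ← integral_const_mul]
    refine norm_integral_le_of_norm_le (hi.norm.const_mul _) ?_
    filter_upwards [hP1 n v, ae_restrict_mem hΩ.measurableSet] with x h1 hx
    have hx0 := hc₀.trans_le (hcpos x hx)
    have e : c x * u x * (P n v).fn x - u x * v.fn x
        = (θ n x - g x) * (c x * u x * v.fn x) := by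
      rw [h1, ← hgc hx]
      field_simp
    rw [e, norm_mul]
    exact mul_le_mul_of_nonneg_right (hθg n x) (norm_nonneg _)
  · have := (tendsto_one_div_add_atTop_nhds_zero_nat (𝕜 := ℝ)).const_mul K
    simpa using this.mul_const (∫ x in Ω, ‖c x * u x * v.fn x‖)

/-- Composition of functionals with an operator, pointwise in time. -/
noncomputable def precompLp {S V : Type*} [MeasurableSpace S] {μ : Measure S}
    [NormedAddCommGroup V] [NormedSpace ℝ V] (P : V →L[ℝ] V) (f : Lp (StrongDual ℝ V) 2 μ) :
    Lp (StrongDual ℝ V) 2 μ := ((ContinuousLinearMap.compL ℝ V V ℝ).flip P).compLp f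

theorem coeFn_precompLp {S V : Type*} [MeasurableSpace S] {μ : Measure S}
    [NormedAddCommGroup V] [NormedSpace ℝ V] (P : V →L[ℝ] V) (f : Lp (StrongDual ℝ V) 2 μ) :
    ∀ᵐ t ∂μ, ∀ v, precompLp P f t v = f t (P v) := by
  filter_upwards [((ContinuousLinearMap.compL ℝ V V ℝ).flip P).coeFn_compLp f] with t ht v
  rw [precompLp, ht]
  rfl

/-- For a Lipschitz weight, the weighted time derivative determines the unweighted one. -/
theorem exists_isTimeDeriv_one {T : ℝ} (hΩ : IsOpen Ω) {c : E d → ℝ}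
    (hc : MemLp c ∞ (volume.restrict Ω))
    {L : ℝ≥0} (hL : LipschitzOnWith L c Ω) {c₀ : ℝ} (hc₀ : 0 < c₀) (hcpos : ∀ x ∈ Ω, c₀ ≤ c x)
    {u : L2V Ω T} {f : L2V' Ω T} (hf : IsTimeDeriv c u f) :
    ∃ f' : L2V' Ω T, IsTimeDeriv (fun _ => 1) u f' := by
  obtain ⟨P, hP⟩ := exists_lipschitzDivision hΩ hc hL hc₀ hcpos
  refine ⟨precompLp P f, fun η hη hcs hs v => ?_⟩
  have e : ∫ t in Ioo 0 T, η t * precompLp P f t v = ∫ t in Ioo 0 T, η t * f t (P v) := by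
    refine integral_congr_ae ?_
    filter_upwards [coeFn_precompLp P f] with t ht
    rw [ht]
  rw [e, ← hf η hη hcs hs (P v)]
  simp_rw [hP, one_mul]

end Multipliers

end DualContinuum

theorem theoremA3 {d : ℕ} (Ω : Set (DualContinuum.E d)) (hΩ : IsOpen Ω)
    (hΩb : Bornology.IsBounded Ω) (T : ℝ) (hT : 0 < T)
    -- the two-scale coefficients: continuous, periodic in the fast variable, coercive
    (C κ : Fin 2 → DualContinuum.E d → DualContinuum.E d → ℝ)
    (Q : DualContinuum.E d → DualContinuum.E d → ℝ)
    (hC : ∀ k, ContinuousOn (Function.uncurry (C k)) (closure Ω ×ˢ univ))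
    (hκ : ∀ k, ContinuousOn (Function.uncurry (κ k)) (closure Ω ×ˢ univ))
    (hQ : ContinuousOn (Function.uncurry Q) (closure Ω ×ˢ univ))
    (hCper : ∀ k, ∀ x ∈ closure Ω, DualContinuum.IsPeriodic (C k x))
    (hκper : ∀ k, ∀ x ∈ closure Ω, DualContinuum.IsPeriodic (κ k x))
    (hQper : ∀ x ∈ closure Ω, DualContinuum.IsPeriodic (Q x))
    (hQavg : ∀ x ∈ closure Ω, ∫ y in DualContinuum.unitCube d, Q x y = 0)
    (c₀ κ₀ : ℝ) (hc₀ : 0 < c₀) (hκ₀ : 0 < κ₀)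
    (hCpos : ∀ k, ∀ x ∈ closure Ω, ∀ y, c₀ ≤ C k x y)
    (hκpos : ∀ k, ∀ x ∈ closure Ω, ∀ y, κ₀ ≤ κ k x y)
    -- the solutions of the cell problems
    (N : Fin 2 → Fin d → DualContinuum.E d → DualContinuum.PeriodicH1 d)
    (M : Fin 2 → DualContinuum.E d → DualContinuum.PeriodicH1 d)
    (hN : ∀ k i, ∀ x ∈ Ω, DualContinuum.SolvesGradientCell (κ k x) i (N k i x))
    (hM : ∀ k, ∀ x ∈ Ω, DualContinuum.SolvesExchangeCell (κ k x) (Q x) (M k x))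
    -- the source term and the initial data
    (q : ℝ × DualContinuum.E d → ℝ)
    (hq : MemLp q 2 ((volume.restrict (Ioo 0 T)).prod (volume.restrict Ω)))
    (g : Fin 2 → DualContinuum.L2 Ω) :
    (∃! u : Fin 2 → DualContinuum.L2V Ω T,
      DualContinuum.IsWeakSolution Ω T C κ Q N M q g u) ∧
    -- time derivatives without the weight, when multiplication by the weight acts on `H^{-1}`
    (∀ u : Fin 2 → DualContinuum.L2V Ω T,
      DualContinuum.IsWeakSolution Ω T C κ Q N M q g u →
      ∀ k, (∃ L : ℝ≥0, LipschitzOnWith L (DualContinuum.homCapacity C k) Ω) →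
        ∃ f : DualContinuum.L2V' Ω T, DualContinuum.IsTimeDeriv (fun _ => 1) (u k) f) := by
  have hcl : ∀ x ∈ Ω, x ∈ closure Ω := fun x hx => subset_closure hx
  have hc : ∀ k, MemLp (DualContinuum.homCapacity C k) ∞ (volume.restrict Ω) := fun k =>
    DualContinuum.memLp_homCapacity hΩ hΩb (hC k)
  have hcpos : ∀ k, ∀ x ∈ Ω, c₀ ≤ DualContinuum.homCapacity C k x := fun k x hx =>
    DualContinuum.le_homCapacity hΩb (hC k) (hCpos k) hx
  have h := DualContinuum.boundedCoefficients hΩ hΩb hκ hQ hQavg hκ₀ hκpos hN hM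
  have hell : ∀ k, ∀ x ∈ Ω, ∀ ξ : DualContinuum.E d, κ₀ * ‖ξ‖ ^ 2 ≤
      ∑ i, ∑ j, DualContinuum.homDiffusion κ N k i j x * ξ j * ξ i := fun k x hx ξ =>
    DualContinuum.le_homDiffusion (DualContinuum.memLp_top_slice hΩb (hκ k) (hcl x hx)) hκ₀
      (hκpos k x (hcl x hx)) (fun i => hN k i x hx) ξ
  obtain ⟨P, hι, hm, hA⟩ := DualContinuum.exists_parabolicOperator h hΩ hκ₀ hell hc hc₀ hcpos
  refine ⟨DualContinuum.existsUnique_isWeakSolution hT hc h hι hm hA hq g, ?_⟩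
  rintro u hu k ⟨L, hL⟩
  obtain ⟨f, hf, -⟩ := (hu k).2
  exact DualContinuum.exists_isTimeDeriv_one hΩ (hc k) hL hc₀ (hcpos k) hf
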